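/- Let $F_0$ be a probability distribution on a measurable space $\Omega$, let $\Theta\subseteq\mathbb{R}^d$, and let $\ell:\Theta\times\Omega\to[0,\infty)$ be a loss function, measurable in $x\in\Omega$ for each $\theta\in\Theta$. Write $\nabla$ for the gradient with respect to $\theta$ and assume the following regularity conditions. 1. For $F_0$-almost every $x$, $\theta\mapsto\ell(\theta,x)$ is continuous on $\Theta$. 2. $\theta_0\in\Theta$ is the unique minimiser over $\Theta$ of the expected loss $\theta\mapsto\int_\Omega \ell(\theta,x)\,dF_0(x)\in[0,\infty]$. 3. There are a compact set $K\subseteq\Theta$ and finitely many sets $U_1,\dots,U_m$ covering $\Theta\setminus K$ with $\int_\Omega \inf_{\theta\in U_j}\ell(\theta,x)\,dF_0(x)>\int_\Omega\ell(\theta_0,x)\,dF_0(x)$ for each $j$ (if $\Theta$ is compact this holds trivially, with $K=\Theta$ and $m=0$). Here the integral of an infimum that is not measurable is read as a lower integral. 4. There are an open ball $B\subseteq\Theta$ centred at $\theta_0$ and an $F_0$-integrable function $G$ such that, for $F_0$-almost every $x$, $\ell(\cdot,x)$ is twice continuously differentiable on $B$ with $\|\nabla\ell(\theta,x)\|^2\le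 G(x)$ and $\|\nabla^2\ell(\theta,x)\|\le G(x)$ for all $\theta\in B$. 5. The matrix $J(\theta_0)$ is positive definite, where $$I(\theta)=\int_\Omega\nabla\ell(\theta,x)\,\nabla\ell(\theta,x)^{\mathsf T}\,dF_0(x),\qquad J(\theta)=\int_\Omega\nabla^2\ell(\theta,x)\,dF_0(x).$$ Let $x_1,x_2,\dots$ be independent draws from $F_0$. Let $\hat\theta_n=\hat\theta_n(x_{1:n})$ be an empirical risk minimiser, i.e. a minimiser over $\theta\in\Theta$ of $n^{-1}\sum_{i=1}^n\ell(\theta,x_i)$. Given $x_{1:n}$, let $\tilde\theta_n$ be a loss-likelihood bootstrap draw, i.e. a random vector which almost surely minimises $\sum_{i=1}^n w_i\,\ell(\theta,x_i)$ over $\theta\in\Theta$, where $(w_1,\dots,w_n)\sim\mathrm{Dirichlet}(1,\dots,1)$ whatever the observations are; let $P_{LL}(\,\cdot\mid x_{1:n})$ denote its law. (For almost every data sequence, these minimisers are only required to exist for all sufficiently large $n$.) Let $z\sim N_d\{0,\,J(\theta_0)^{-1}I(\theta_0)J(\theta_0)^{-1}\}$. Then, for almost every data sequence $x_{1:\infty}$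 with respect to $F_0^\infty$, as $n\to\infty$: (i) $n^{1/2}(\tilde\theta_n-\hat\theta_n)$, conditional on $x_{1:n}$, converges in distribution to $z$; (ii) if moreover $I(\theta_0)$ is positive definite, then for every Borel set $A\subseteq\mathbb{R}^d$, $$P_{LL}\{n^{1/2}(\tilde\theta_n-\hat\theta_n)\in A\mid x_{1:n}\}\to P(z\in A).$$ -/

import Mathlib

open MeasureTheory ProbabilityTheory Filter Topology

namespace LossBootstrap

noncomputable section

/-- The Dirichlet distribution with parameters `α i > 0`, as a measure on `ι → ℝ` carried by the
probability simplex: the law of `(Y i / ∑ j, Y j)` for independent `Y i` with law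
`Gamma (α i, 1)`. -/
def dirichletMeasure {ι : Type*} [Fintype ι] (α : ι → ℝ) : Measure (ι → ℝ) :=
  (Measure.pi fun i => gammaMeasure (α i) 1).map fun y i => y i / ∑ j, y j

variable {d : ℕ} {Ω : Type*}

/-- The weighted empirical loss `∑ i, w i * ℓ (θ, x i)`, i.e. the integral of `ℓ (θ, ·)` with respect
to the discrete distribution `∑ i, w i • δ (x i)`. -/
def weightedLoss (ℓ : EuclideanSpace ℝ (Fin d) → Ω → ℝ) {n : ℕ} (w : Fin n → ℝ) (x : Fin n → Ω)
    (θ : EuclideanSpace ℝ (Fin d)) : ℝ :=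
  ∑ i, w i * ℓ θ (x i)

/-- `θ` is a minimiser over the parameter set `Θ` of the loss with weights `w`. -/
def IsWeightedMinimizer (Θ : Set (EuclideanSpace ℝ (Fin d)))
    (ℓ : EuclideanSpace ℝ (Fin d) → Ω → ℝ) {n : ℕ} (w : Fin n → ℝ) (x : Fin n → Ω)
    (θ : EuclideanSpace ℝ (Fin d)) : Prop :=
  θ ∈ Θ ∧ IsMinOn (weightedLoss ℓ w x) Θ θ

/-- `θ` is an empirical risk minimiser over `Θ`: it minimises `n⁻¹ * ∑ i, ℓ (θ, x i)`. -/
def IsEmpiricalRiskMinimizer (Θ : Set (EuclideanSpace ℝ (Fin d)))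
    (ℓ : EuclideanSpace ℝ (Fin d) → Ω → ℝ) {n : ℕ} (x : Fin n → Ω)
    (θ : EuclideanSpace ℝ (Fin d)) : Prop :=
  IsWeightedMinimizer Θ ℓ (fun _ => (n : ℝ)⁻¹) x θ

variable [MeasurableSpace Ω]

/-- The expected loss of `θ`, in `[0, ∞]` (the loss function is nonnegative). -/
def expectedLoss (ℓ : EuclideanSpace ℝ (Fin d) → Ω → ℝ) (F₀ : Measure Ω)
    (θ : EuclideanSpace ℝ (Fin d)) : ENNReal :=
  ∫⁻ x, ENNReal.ofReal (ℓ θ x) ∂F₀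

/-- The expected outer product of the loss gradients,
`I(θ) = ∫ ∇ℓ(θ, x) ∇ℓ(θ, x)ᵀ dF₀(x)`. -/
def gradientOuter (ℓ : EuclideanSpace ℝ (Fin d) → Ω → ℝ) (F₀ : Measure Ω)
    (θ : EuclideanSpace ℝ (Fin d)) : Matrix (Fin d) (Fin d) ℝ :=
  Matrix.of fun j k =>
    ∫ x, gradient (fun η => ℓ η x) θ j * gradient (fun η => ℓ η x) θ k ∂F₀

/-- The expected loss Hessian, `J(θ) = ∫ ∇²ℓ(θ, x) dF₀(x)`. -/
def expectedHessian (ℓ : EuclideanSpace ℝ (Fin d) → Ω → ℝ) (F₀ : Measure Ω)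
    (θ : EuclideanSpace ℝ (Fin d)) : Matrix (Fin d) (Fin d) ℝ :=
  Matrix.of fun j k =>
    ∫ x, iteratedFDeriv ℝ 2 (fun η => ℓ η x) θ
      ![EuclideanSpace.single j 1, EuclideanSpace.single k 1] ∂F₀

/-- The sandwich covariance matrix `J(θ)⁻¹ I(θ) J(θ)⁻¹`. -/
def sandwichCov (ℓ : EuclideanSpace ℝ (Fin d) → Ω → ℝ) (F₀ : Measure Ω)
    (θ : EuclideanSpace ℝ (Fin d)) : Matrix (Fin d) (Fin d) ℝ :=
  (expectedHessian ℓ F₀ θ)⁻¹ * gradientOuter ℓ F₀ θ * (expectedHessian ℓ F₀ θ)⁻¹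

/-- Regularity conditions on a loss function `ℓ : Θ × Ω → [0, ∞)` and a sampling distribution `F₀`
with target parameter `θ₀`. Values of `ℓ` at parameters outside `Θ` are irrelevant. -/
structure RegularLoss (Θ : Set (EuclideanSpace ℝ (Fin d)))
    (ℓ : EuclideanSpace ℝ (Fin d) → Ω → ℝ) (F₀ : Measure Ω)
    (θ₀ : EuclideanSpace ℝ (Fin d)) : Prop where
  /-- The loss is nonnegative. -/
  nonneg : ∀ θ ∈ Θ, ∀ x, 0 ≤ ℓ θ x
  /-- The loss is measurable in the observation. -/
  measurable : ∀ θ ∈ Θ, Measurable (ℓ θ)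
  /-- The loss is continuous in the parameter. -/
  continuousOn : ∀ᵐ x ∂F₀, ContinuousOn (fun θ => ℓ θ x) Θ
  /-- `θ₀` is the unique minimiser over `Θ` of the expected loss. -/
  unique_min : ∀ θ ∈ Θ, θ ≠ θ₀ → expectedLoss ℓ F₀ θ₀ < expectedLoss ℓ F₀ θ
  /-- Outside some compact part of `Θ`, the parameters can be split into finitely many sets `U`, on
  each of which the infimum over `U` of the loss still has an expectation exceeding the minimal
  expected loss. (If `Θ` is compact, this holds with `K = Θ` and no set `U`.) -/
  at_infinity : ∃ K ⊆ Θ, IsCompact K ∧ ∃ 𝒰 : Set (Set (EuclideanSpace ℝ (Fin d))), 𝒰.Finite ∧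
    Θ \ K ⊆ ⋃₀ 𝒰 ∧
    ∀ U ∈ 𝒰, expectedLoss ℓ F₀ θ₀ < ∫⁻ x, ⨅ θ ∈ U, ENNReal.ofReal (ℓ θ x) ∂F₀
  /-- `θ₀` is interior to `Θ`, and on a ball around it the loss is twice continuously differentiable,
  with the squared gradient and the Hessian dominated by an integrable function. -/
  smooth : ∃ r > 0, Metric.ball θ₀ r ⊆ Θ ∧ ∃ G : Ω → ℝ, Integrable G F₀ ∧
    ∀ᵐ x ∂F₀, ContDiffOn ℝ 2 (fun θ => ℓ θ x) (Metric.ball θ₀ r) ∧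
      ∀ θ ∈ Metric.ball θ₀ r, ‖gradient (fun η => ℓ η x) θ‖ ^ 2 ≤ G x ∧
        ‖iteratedFDeriv ℝ 2 (fun η => ℓ η x) θ‖ ≤ G x
  /-- The expected Hessian at `θ₀` is positive definite. -/
  hessian_posDef : (expectedHessian ℓ F₀ θ₀).PosDef

end

end LossBootstrap

/-! Fix a data sequence along which the strong law holds for the countably many integrable functions
that matter. The only randomness left is in the weights. Dirichlet(1, …, 1) weights are `y i / ∑ j,
y j` with independent standard exponential `y i`, so Chebyshev's inequality shows that weighted sums
behave like plain averages in probability (`isAveraging_dirichlet`), and Wald's argument makes both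
minimisers consistent (`tendsto_of_isWeightedMinimizer`).

For (i), both minimisers are then interior zeros of their gradients. Linearising the weighted
gradient between them (`RegularGradients.isLittleO_zero`) gives √n(θ̃ − θ̂) = −J⁻¹ √n ∑ wᵢ ∇ℓ(θ̂,
xᵢ) + o(1) in probability. Because ∑ ∇ℓ(θ̂, xᵢ) = 0, the sum on the right needs no centring, and the
explicit characteristic function of the exponential law yields a normal limit with covariance I(θ₀)
(`tendsto_charFun_dirichlet`).

For (ii), weak convergence says nothing about a general Borel set; it suffices that the laws are
asymptotically dominated by Lebesgue measure, uniformly in n (`tendsto_measure_of_uniform_bound`).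
No density of θ̃ is computed. Instead the weights are tilted to `exp ⟨s, u i⟩ * y i`, where `u i` is
a normalised gradient at θ₀ and `‖s‖ < 1 / (8√n)`. Such a tilt distorts probabilities of events only
boundedly (`sq_expSample_le`), yet it moves the zero of the weighted gradient by at least a multiple
of the change in `s` (`norm_le_of_tilted_zero`). So for fixed `y` the tilts that put a zero into a
set B have volume at most a multiple of that of B. Averaging over `s` bounds the squared probability
of a zero in B by vol B / vol(ball of tilts) (`expSample_zeroWeights_le`), and for B of scale 1/√n
the powers of n cancel. Positive definiteness of I(θ₀) ensures that tilts act in every direction. -/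

namespace LossBootstrap

/-! ### Convergence in probability as a filter, and Slutsky's lemma -/

section InProbability

variable {W W' : ℕ → Type*} [∀ n, MeasurableSpace (W n)] [∀ n, MeasurableSpace (W' n)]

/-- The filter of families of events whose probability tends to one. Convergence along this filter
is convergence in probability. -/
def inProb (P : (n : ℕ) → Measure (W n)) : Filter (Σ n, W n) where
  sets := {S | Tendsto (fun n => P n {ω | (⟨n, ω⟩ : Σ n, W n) ∉ S}) atTop (𝓝 0)}
  univ_sets := by simp
  sets_of_superset {S T} hS hST := by
    refine tendsto_of_tendsto_of_tendsto_of_le_of_le tendsto_const_nhds hS (fun _ => zero_le)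
      fun n => measure_mono fun ω hω h => hω (hST h)
  inter_sets {S T} hS hT := by
    have h := Tendsto.add hS hT
    rw [add_zero] at h
    refine tendsto_of_tendsto_of_tendsto_of_le_of_le tendsto_const_nhds h (fun _ => zero_le)
      fun n => (measure_mono fun ω hω => ?_).trans (measure_union_le _ _)
    by_contra hc
    simp only [Set.mem_union, Set.mem_ofPred_eq, not_or, not_not] at hc
    exact hω hc

lemma eventually_inProb_iff {P : (n : ℕ) → Measure (W n)} {p : (Σ n, W n) → Prop} :
    (∀ᶠ q in inProb P, p q) ↔ Tendsto (fun n => P n {ω | ¬ p ⟨n, ω⟩}) atTop (𝓝 0) := Iff.rfl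

lemma eventually_inProb_of_ae {P : (n : ℕ) → Measure (W n)} {p : (Σ n, W n) → Prop}
    (h : ∀ᶠ n in atTop, ∀ᵐ ω ∂P n, p ⟨n, ω⟩) : ∀ᶠ q in inProb P, p q := by
  rw [eventually_inProb_iff]
  refine tendsto_const_nhds.congr' ?_
  filter_upwards [h] with n hn
  exact (ae_iff.1 hn).symm

lemma tendsto_fst_inProb (P : (n : ℕ) → Measure (W n)) :
    Tendsto Sigma.fst (inProb P) atTop := by
  intro S hS
  refine eventually_inProb_of_ae (p := fun q => q.1 ∈ S) ?_
  filter_upwards [hS] with n hn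
  exact ae_of_all _ fun _ => hn

lemma tendsto_map_inProb (P : (n : ℕ) → Measure (W n)) {f : (n : ℕ) → W n → W' n}
    (hf : ∀ n, AEMeasurable (f n) (P n)) :
    Tendsto (Sigma.map id f) (inProb P) (inProb fun n => (P n).map (f n)) := by
  intro S hS
  refine tendsto_of_tendsto_of_tendsto_of_le_of_le tendsto_const_nhds hS (fun _ => zero_le)
    fun n => ?_
  exact Measure.le_map_apply (hf n) {ω | (⟨n, ω⟩ : Σ n, W' n) ∉ S}

/-- The converse transfer to `tendsto_map_inProb`. Measurability of `F` is needed here because the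
image measure of a non-measurable set may exceed the measure of its preimage. -/
lemma tendsto_inProb_map {V : Type*} [PseudoMetricSpace V] [MeasurableSpace V]
    [OpensMeasurableSpace V] (P : (n : ℕ) → Measure (W n)) {f : (n : ℕ) → W n → W' n}
    (hf : ∀ n, AEMeasurable (f n) (P n)) {F : (Σ n, W' n) → V} {c : V}
    (hF : ∀ n, Measurable fun ω => F ⟨n, ω⟩)
    (h : Tendsto (F ∘ Sigma.map id f) (inProb P) (𝓝 c)) :
    Tendsto F (inProb fun n => (P n).map (f n)) (𝓝 c) := by
  rw [Metric.nhds_basis_ball.tendsto_right_iff] at h ⊢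
  intro ε hε
  have := h ε hε
  rw [eventually_inProb_iff] at this ⊢
  refine this.congr fun n => ?_
  rw [Measure.map_apply_of_aemeasurable (hf n)]
  · rfl
  · exact (hF n Metric.isOpen_ball.measurableSet).compl

lemma tendsto_inProb_of_variance {P : (n : ℕ) → Measure (W n)} [∀ n, IsProbabilityMeasure (P n)]
    {f : (Σ n, W n) → ℝ} (hf : ∀ n, MemLp (fun ω => f ⟨n, ω⟩) 2 (P n)) {c : ℝ}
    (hc : Tendsto (fun n => (P n)[fun ω => f ⟨n, ω⟩]) atTop (𝓝 c))
    (hv : Tendsto (fun n => Var[fun ω => f ⟨n, ω⟩; P n]) atTop (𝓝 0)) :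
    Tendsto f (inProb P) (𝓝 c) := by
  rw [Metric.nhds_basis_ball.tendsto_right_iff]
  intro ε hε
  rw [eventually_inProb_iff]
  have h1 : Tendsto (fun n => ENNReal.ofReal (Var[fun ω => f ⟨n, ω⟩; P n] / (ε / 2) ^ 2))
      atTop (𝓝 0) := by
    have := ENNReal.tendsto_ofReal (hv.div_const ((ε / 2) ^ 2))
    simpa using this
  refine tendsto_of_tendsto_of_tendsto_of_le_of_le' tendsto_const_nhds h1
    (Eventually.of_forall fun _ => zero_le) ?_
  filter_upwards [hc (Metric.ball_mem_nhds c (half_pos hε))] with n hn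
  refine (measure_mono fun ω hω => ?_).trans (meas_ge_le_variance_div_sq (hf n) (half_pos hε))
  simp only [Metric.mem_ball, not_lt, Set.mem_ofPred_eq, Set.mem_preimage, Real.dist_eq] at hω hn ⊢
  have := abs_sub_le (f ⟨n, ω⟩) ((P n)[fun ω => f ⟨n, ω⟩]) c
  linarith

/-- Off an event of probability at most δ/2, tightness bounds `S` by some `M`; the little-o relation
with constant ε/(2M) then leaves at most ε/2. This turns Taylor remainders relative to a tight
quantity into negligible terms. -/
lemma tendsto_zero_of_isLittleO_of_isTight {V V' : Type*} [NormedAddCommGroup V]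
    [NormedAddCommGroup V'] [MeasurableSpace V'] [BorelSpace V'] [ProperSpace V']
    {P : (n : ℕ) → Measure (W n)} {R : (Σ n, W n) → V} {S : (Σ n, W n) → V'}
    (hRS : R =o[inProb P] S) (hS : ∀ n, AEMeasurable (fun ω => S ⟨n, ω⟩) (P n))
    (ht : IsTightMeasureSet (Set.range fun n => (P n).map fun ω => S ⟨n, ω⟩)) :
    Tendsto R (inProb P) (𝓝 0) := by
  rw [Metric.nhds_basis_ball.tendsto_right_iff]
  intro ε hε
  rw [eventually_inProb_iff, ENNReal.tendsto_nhds_zero]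
  intro δ hδ
  have hδ2 : (0 : ENNReal) < δ / 2 := ENNReal.half_pos hδ.ne'
  rw [isTightMeasureSet_iff_tendsto_measure_norm_gt, ENNReal.tendsto_nhds_zero] at ht
  obtain ⟨M, hM, hM0⟩ := ((ht (δ / 2) hδ2).and (eventually_gt_atTop 0)).exists
  have h1 := Asymptotics.isLittleO_iff.1 hRS (c := ε / (2 * M)) (by positivity)
  rw [eventually_inProb_iff, ENNReal.tendsto_nhds_zero] at h1
  filter_upwards [h1 (δ / 2) hδ2] with n hn
  have h2 : P n {ω | M < ‖S ⟨n, ω⟩‖} ≤ δ / 2 := by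
    refine le_trans ?_ (le_trans (le_iSup₂ (f := fun (μ : Measure V')
      (_ : μ ∈ Set.range fun n => (P n).map fun ω => S ⟨n, ω⟩) => μ {x | M < ‖x‖}) _ ⟨n, rfl⟩) hM)
    exact Measure.le_map_apply (hS n) _
  calc P n {ω | R ⟨n, ω⟩ ∉ Metric.ball 0 ε}
      ≤ P n ({ω | ¬ ‖R ⟨n, ω⟩‖ ≤ ε / (2 * M) * ‖S ⟨n, ω⟩‖} ∪ {ω | M < ‖S ⟨n, ω⟩‖}) := by
        refine measure_mono fun ω hω => ?_
        by_contra hc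
        simp only [Set.mem_union, Set.mem_ofPred_eq, not_or, not_not, not_lt] at hc
        apply hω
        rw [mem_ball_zero_iff]
        calc ‖R ⟨n, ω⟩‖ ≤ ε / (2 * M) * ‖S ⟨n, ω⟩‖ := hc.1
          _ ≤ ε / (2 * M) * M := by gcongr; exact hc.2
          _ = ε / 2 := by field_simp
          _ < ε := half_lt_self hε
    _ ≤ δ / 2 + δ / 2 := (measure_union_le _ _).trans (add_le_add hn h2)
    _ = δ := ENNReal.add_halves δ

lemma charFun_map_eq_integral {E Ω' : Type*} [NormedAddCommGroup E] [InnerProductSpace ℝ E]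
    [MeasurableSpace E] [BorelSpace E] [SecondCountableTopology E] [MeasurableSpace Ω']
    {μ : Measure Ω'} {X : Ω' → E} (hX : AEMeasurable X μ) (t : E) :
    charFun (μ.map X) t = ∫ ω, Complex.exp (inner ℝ (X ω) t * Complex.I) ∂μ := by
  rw [charFun_apply, integral_map hX]
  exact Measurable.aestronglyMeasurable (by fun_prop)

/-- Slutsky's lemma in terms of characteristic functions, on varying probability spaces. -/
lemma tendsto_charFun_of_tendsto_sub {E : Type*} [NormedAddCommGroup E] [InnerProductSpace ℝ E]
    [MeasurableSpace E] [BorelSpace E] [SecondCountableTopology E]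
    {P : (n : ℕ) → Measure (W n)} [∀ n, IsProbabilityMeasure (P n)] {X Z : (Σ n, W n) → E}
    (hX : ∀ n, AEMeasurable (fun ω => X ⟨n, ω⟩) (P n))
    (hZ : ∀ n, AEMeasurable (fun ω => Z ⟨n, ω⟩) (P n))
    (hXZ : Tendsto (fun q => X q - Z q) (inProb P) (𝓝 0)) {φ : ℂ} (t : E)
    (h : Tendsto (fun n => charFun ((P n).map fun ω => X ⟨n, ω⟩) t) atTop (𝓝 φ)) :
    Tendsto (fun n => charFun ((P n).map fun ω => Z ⟨n, ω⟩) t) atTop (𝓝 φ) := by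
  suffices hd : Tendsto (fun n => charFun ((P n).map fun ω => Z ⟨n, ω⟩) t -
      charFun ((P n).map fun ω => X ⟨n, ω⟩) t) atTop (𝓝 0) by
    simpa using hd.add h
  -- The difference of the two exponentials is bounded by 2, and it is at most `|⟨X - Z, t⟩|`, so it
  -- vanishes in probability. Its expectation is then split over the event where it is not small.
  let e : (Σ n, W n) → ℂ := fun q =>
    Complex.exp (inner ℝ (Z q) t * Complex.I) - Complex.exp (inner ℝ (X q) t * Complex.I)
  have hbd : ∀ q, ‖e q‖ ≤ 2 := fun q => by
    refine (norm_sub_le _ _).trans ?_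
    rw [Complex.norm_exp_ofReal_mul_I, Complex.norm_exp_ofReal_mul_I]
    norm_num
  have he0 : Tendsto e (inProb P) (𝓝 0) := by
    have h1 : Tendsto (fun q => inner ℝ (X q - Z q) t) (inProb P) (𝓝 0) := by
      simpa using hXZ.inner (tendsto_const_nhds (x := t))
    refine squeeze_zero_norm (fun q => ?_) (by simpa using h1.norm)
    calc ‖e q‖ = ‖Complex.exp (inner ℝ (Z q) t * Complex.I)‖ *
          ‖1 - Complex.exp (Complex.I * (inner ℝ (X q - Z q) t : ℝ))‖ := by
          rw [← norm_mul, mul_sub, mul_one, ← Complex.exp_add]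
          dsimp only [e]
          congr 3
          rw [inner_sub_left]; push_cast; ring
      _ ≤ ‖inner ℝ (X q - Z q) t‖ := by
          rw [Complex.norm_exp_ofReal_mul_I, one_mul, norm_sub_rev]
          exact Real.norm_exp_I_mul_ofReal_sub_one_le
  have hexp : Measurable fun z : E => Complex.exp (inner ℝ z t * Complex.I) := by fun_prop
  have hmeas : ∀ n, AEStronglyMeasurable (fun ω => e ⟨n, ω⟩) (P n) := fun n => by
    refine AEMeasurable.aestronglyMeasurable ?_
    exact (hexp.comp_aemeasurable (hZ n)).sub (hexp.comp_aemeasurable (hX n))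
  rw [Metric.tendsto_atTop']
  intro ε hε
  have h2 := he0 (Metric.ball_mem_nhds 0 (half_pos hε))
  have h3 : ∀ᶠ q in inProb P, e q ∈ Metric.ball (0 : ℂ) (ε / 2) := h2
  rw [eventually_inProb_iff] at h3
  have h4 : ∀ᶠ n in atTop, (P n).real {ω | e ⟨n, ω⟩ ∉ Metric.ball (0 : ℂ) (ε / 2)} < ε / 4 := by
    have := (ENNReal.tendsto_toReal (by simp)).comp h3
    exact this.eventually_lt_const (by simpa using by positivity)
  obtain ⟨N, hN⟩ := eventually_atTop.1 h4
  refine ⟨N, fun n hn => ?_⟩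
  have hn := hN n hn.le
  rw [dist_zero_right, charFun_map_eq_integral (hX n), charFun_map_eq_integral (hZ n),
    ← integral_sub]
  rotate_left
  · refine Integrable.of_bound (hexp.comp_aemeasurable (hZ n)).aestronglyMeasurable 1
      (ae_of_all _ fun ω => ?_)
    simp [Complex.norm_exp_ofReal_mul_I]
  · refine Integrable.of_bound (hexp.comp_aemeasurable (hX n)).aestronglyMeasurable 1
      (ae_of_all _ fun ω => ?_)
    simp [Complex.norm_exp_ofReal_mul_I]
  set A := {ω | e ⟨n, ω⟩ ∉ Metric.ball (0 : ℂ) (ε / 2)} with hA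
  have hAm : NullMeasurableSet A (P n) :=
    ((hmeas n).aemeasurable.nullMeasurableSet_preimage Metric.isOpen_ball.measurableSet).compl
  have hint : Integrable (fun ω => ‖e ⟨n, ω⟩‖) (P n) :=
    (Integrable.of_bound (hmeas n) 2 (ae_of_all _ fun ω => hbd _)).norm
  calc ‖∫ ω, e ⟨n, ω⟩ ∂P n‖ ≤ ∫ ω, ‖e ⟨n, ω⟩‖ ∂P n := norm_integral_le_integral_norm _
    _ ≤ ∫ ω, (ε / 2 + A.indicator (fun _ => 2) ω) ∂P n := by
        refine integral_mono hint ((integrable_const _).add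
          ((integrable_const _).indicator₀ hAm)) fun ω => ?_
        by_cases hω : ω ∈ A
        · simp only [Set.indicator_of_mem hω]
          have := hbd ⟨n, ω⟩
          linarith
        · simp only [Set.indicator_of_notMem hω, add_zero]
          simp only [hA, Set.mem_ofPred_eq, not_not, mem_ball_zero_iff] at hω
          exact hω.le
    _ = ε / 2 + (P n).real A * 2 := by
        rw [integral_add (integrable_const _) ((integrable_const _).indicator₀ hAm),
          integral_indicator₀ hAm]
        simp
    _ < ε := by linarith

end InProbability

/-! ### Deterministic sequences with a mean, and averaging weights -/

section Averages

/-- The averages of the sequence `a` converge to `m`, and the averages of its norms are bounded. -/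
structure HasMean {V : Type*} [NormedAddCommGroup V] [NormedSpace ℝ V] (a : ℕ → V) (m : V) :
    Prop where
  tendsto : Tendsto (fun n : ℕ => (n : ℝ)⁻¹ • ∑ i : Fin n, a i) atTop (𝓝 m)
  bounded : ∃ C, ∀ n : ℕ, ∑ i : Fin n, ‖a i‖ ≤ C * n

lemma hasMean_const {V : Type*} [NormedAddCommGroup V] [NormedSpace ℝ V] (v : V) :
    HasMean (fun _ => v) v := by
  refine ⟨tendsto_const_nhds.congr' ?_, ‖v‖, fun n => ?_⟩
  · filter_upwards [eventually_gt_atTop 0] with n hn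
    have : (n : ℝ) ≠ 0 := by positivity
    rw [Finset.sum_const, Finset.card_univ, Fintype.card_fin, ← Nat.cast_smul_eq_nsmul ℝ,
      smul_smul, inv_mul_cancel₀ this, one_smul]
  · simp [mul_comm]

lemma HasMean.map {V V' : Type*} [NormedAddCommGroup V] [NormedSpace ℝ V] [NormedAddCommGroup V']
    [NormedSpace ℝ V'] {a : ℕ → V} {m : V} (h : HasMean a m) (L : V →L[ℝ] V') :
    HasMean (fun i => L (a i)) (L m) := by
  obtain ⟨C, hC⟩ := h.bounded
  refine ⟨((L.continuous.tendsto m).comp h.tendsto).congr fun n => by simp, ‖L‖ * C, fun n => ?_⟩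
  calc ∑ i : Fin n, ‖L (a i)‖ ≤ ∑ i : Fin n, ‖L‖ * ‖a i‖ :=
        Finset.sum_le_sum fun i _ => L.le_opNorm _
    _ = ‖L‖ * ∑ i : Fin n, ‖a i‖ := by rw [Finset.mul_sum]
    _ ≤ ‖L‖ * (C * n) := by gcongr; exact hC n
    _ = ‖L‖ * C * n := by ring

/-- The term `a n` is the difference of the partial sums of lengths n + 1 and n, and both divided by
n tend to `m`. -/
lemma HasMean.tendsto_div {a : ℕ → ℝ} {m : ℝ} (h : HasMean a m) :
    Tendsto (fun n : ℕ => a n / n) atTop (𝓝 0) := by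
  have h1 : Tendsto (fun n : ℕ => ((n + 1 : ℕ) : ℝ) / n) atTop (𝓝 1) := by
    have : Tendsto (fun n : ℕ => 1 + 1 / (n : ℝ)) atTop (𝓝 (1 + 0)) :=
      tendsto_const_nhds.add tendsto_one_div_atTop_nhds_zero_nat
    rw [add_zero] at this
    refine this.congr' ?_
    filter_upwards [eventually_gt_atTop 0] with n hn
    have : (n : ℝ) ≠ 0 := by positivity
    push_cast
    field_simp
  have h2 := (h1.mul ((tendsto_add_atTop_iff_nat 1).2 h.tendsto)).sub h.tendsto
  simp only [one_mul, sub_self] at h2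
  refine h2.congr' ?_
  filter_upwards [eventually_gt_atTop 0] with n hn
  have h0 : (n : ℝ) ≠ 0 := by positivity
  have h0' : ((n + 1 : ℕ) : ℝ) ≠ 0 := by positivity
  rw [Fin.sum_univ_castSucc]
  simp only [smul_eq_mul, Fin.val_castSucc, Fin.val_last]
  field_simp
  ring

/-- Late terms satisfy `a i ≤ ε i ≤ ε n`, and the finitely many early ones are bounded by a
constant. This supplies the negligibility condition of the central limit theorem without moments
beyond those assumed. -/
lemma HasMean.eventually_forall_le {a : ℕ → ℝ} {m : ℝ} (h : HasMean a m) {ε : ℝ} (hε : 0 < ε) :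
    ∀ᶠ n : ℕ in atTop, ∀ i : Fin n, a i ≤ ε * n := by
  obtain ⟨N, hN⟩ := eventually_atTop.1 (h.tendsto_div.eventually_le_const hε)
  obtain ⟨C, hC⟩ : ∃ C, ∀ i < N + 1, a i ≤ C := by
    obtain ⟨C, hC⟩ := ((Finset.range (N + 1)).image a).bddAbove
    exact ⟨C, fun i hi => hC (by simpa using ⟨i, by omega, rfl⟩)⟩
  filter_upwards [tendsto_natCast_atTop_atTop.eventually_ge_atTop (C / ε)] with n hn i
  rcases lt_or_ge (i : ℕ) (N + 1) with hi | hi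
  · rw [div_le_iff₀ hε] at hn
    linarith [hC i hi]
  · have h1 := hN i (by omega)
    have h2 : (0 : ℝ) < (i : ℕ) := by exact_mod_cast (by omega : 0 < (i : ℕ))
    rw [div_le_iff₀ h2] at h1
    refine h1.trans ?_
    gcongr
    exact i.2.le

/-- The sum of squares is at most the maximum of `|a i|`, which is o(n), times the sum of `|a i|`,
which is O(n). Hence Chebyshev's inequality applies to weighted averages of merely integrable
observations. -/
lemma HasMean.tendsto_sum_sq_div {a : ℕ → ℝ} {m : ℝ} (h : HasMean a m) :
    Tendsto (fun n : ℕ => (∑ i : Fin n, a i ^ 2) / (n : ℝ) ^ 2) atTop (𝓝 0) := by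
  rw [Metric.nhds_basis_closedBall.tendsto_right_iff]
  intro ε hε
  obtain ⟨C, hC⟩ := h.bounded
  have hC0 : 0 ≤ C := by simpa using (Finset.sum_nonneg fun _ _ => norm_nonneg _).trans (hC 1)
  have hneg := h.map (-ContinuousLinearMap.id ℝ ℝ)
  filter_upwards [h.eventually_forall_le (ε := ε / (C + 1)) (by positivity),
    hneg.eventually_forall_le (ε := ε / (C + 1)) (by positivity),
    eventually_gt_atTop 0] with n h1 h2 hn
  have hn' : (0 : ℝ) < n := by positivity
  have hle : ∑ i : Fin n, a i ^ 2 ≤ ∑ i : Fin n, ε / (C + 1) * n * ‖a i‖ := by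
    refine Finset.sum_le_sum fun i _ => ?_
    rw [← sq_abs, sq, Real.norm_eq_abs]
    gcongr
    exact abs_le'.2 ⟨h1 i, by simpa using h2 i⟩
  rw [mem_closedBall_zero_iff, Real.norm_of_nonneg (by positivity), div_le_iff₀ (by positivity)]
  calc _ ≤ _ := hle
    _ = ε / (C + 1) * n * ∑ i : Fin n, ‖a i‖ := by rw [Finset.mul_sum]
    _ ≤ ε / (C + 1) * n * ((C + 1) * n) := by
        gcongr
        refine (hC n).trans ?_
        gcongr
        linarith
    _ = ε * n ^ 2 := by field_simp

lemma hasMean_of_nonneg {a : ℕ → ℝ} {m : ℝ} (ha : ∀ i, 0 ≤ a i)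
    (h : Tendsto (fun n : ℕ => (n : ℝ)⁻¹ • ∑ i : Fin n, a i) atTop (𝓝 m)) : HasMean a m := by
  obtain ⟨C, hC⟩ := h.bddAbove_range
  refine ⟨h, C, fun n => ?_⟩
  have := hC ⟨n, rfl⟩
  rcases Nat.eq_zero_or_pos n with rfl | hn
  · simp
  · have hn' : (0 : ℝ) < n := by positivity
    simp only [smul_eq_mul] at this
    rw [inv_mul_le_iff₀ hn'] at this
    simp only [Real.norm_of_nonneg (ha _)]
    linarith

/-- The weights `w q`, attached to the first `(w q).1` terms of a sequence, average out along the
filter `l`: for every sequence with a mean, the weighted sums converge to that mean. -/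
def IsAveraging {Q : Type*} (l : Filter Q) (w : Q → Σ n, Fin n → ℝ) : Prop :=
  ∀ (a : ℕ → ℝ) (m : ℝ), HasMean a m →
    Tendsto (fun q => ∑ i, (w q).2 i * a i) l (𝓝 m)

lemma IsAveraging.tendsto {Q : Type*} {l : Filter Q} {w : Q → Σ n, Fin n → ℝ}
    (hw : IsAveraging l w) {V : Type*} [NormedAddCommGroup V] [NormedSpace ℝ V]
    [FiniteDimensional ℝ V] {a : ℕ → V} {m : V} (h : HasMean a m) :
    Tendsto (fun q => ∑ i, (w q).2 i • a i) l (𝓝 m) := by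
  let b := Module.finBasis ℝ V
  let L := b.equivFunL
  rw [L.toHomeomorph.isInducing.tendsto_nhds_iff, tendsto_pi_nhds]
  intro j
  have := hw _ _ (h.map ((ContinuousLinearMap.proj (R := ℝ) j).comp L.toContinuousLinearMap))
  refine this.congr fun q => ?_
  simp

lemma IsAveraging.comp {Q Q' : Type*} {l : Filter Q} {l' : Filter Q'} {w : Q → Σ n, Fin n → ℝ}
    (hw : IsAveraging l w) {f : Q' → Q} (hf : Tendsto f l' l) : IsAveraging l' (w ∘ f) :=
  fun a m h => (hw a m h).comp hf

lemma isAveraging_uniform :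
    IsAveraging atTop (fun n : ℕ => (⟨n, fun _ => (n : ℝ)⁻¹⟩ : Σ n, Fin n → ℝ)) :=
  fun a m h => h.tendsto.congr fun n => by simp [Finset.mul_sum]

end Averages

/-! ### The standard exponential law -/

section Exponential

instance isProbabilityMeasure_gammaMeasure_one_one : IsProbabilityMeasure (gammaMeasure 1 1) :=
  isProbabilityMeasure_gammaMeasure one_pos one_pos

lemma gammaPDF_one (r x : ℝ) :
    gammaPDF 1 r x = (Set.Ici (0 : ℝ)).indicator
      (fun x => ENNReal.ofReal (r * Real.exp (-(r * x)))) x := by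
  rw [gammaPDF_eq, Set.indicator_apply]
  simp only [Set.mem_Ici]
  split_ifs <;> simp

lemma gammaMeasure_one_one :
    gammaMeasure 1 1 = (volume.restrict (Set.Ioi (0 : ℝ))).withDensity
      fun y => ENNReal.ofReal (Real.exp (-y)) := by
  rw [gammaMeasure, restrict_Ioi_eq_restrict_Ici, ← withDensity_indicator measurableSet_Ici]
  congr 1
  ext x
  rw [gammaPDF_one]
  simp

lemma ae_gammaMeasure_one_one_pos : ∀ᵐ y ∂gammaMeasure 1 1, 0 < y := by
  rw [gammaMeasure_one_one]
  exact (withDensity_absolutelyContinuous _ _).ae_le (ae_restrict_mem measurableSet_Ioi)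

lemma integral_gammaMeasure_one_one {V : Type*} [NormedAddCommGroup V] [NormedSpace ℝ V]
    (f : ℝ → V) :
    ∫ y, f y ∂gammaMeasure 1 1 = ∫ y in Set.Ioi (0 : ℝ), Real.exp (-y) • f y := by
  rw [gammaMeasure_one_one, integral_withDensity_eq_integral_toReal_smul (by fun_prop) (by simp)]
  simp [ENNReal.toReal_ofReal (Real.exp_pos _).le]

lemma integrable_pow_gammaMeasure_one_one (k : ℕ) :
    Integrable (fun y => y ^ k) (gammaMeasure 1 1) := by
  rw [gammaMeasure_one_one, integrable_withDensity_iff_integrable_smul' (by fun_prop) (by simp)]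
  have := Real.GammaIntegral_convergent (s := k + 1) (by positivity)
  simpa [ENNReal.toReal_ofReal (Real.exp_pos _).le, IntegrableOn] using this

lemma integral_pow_gammaMeasure_one_one (k : ℕ) :
    ∫ y, y ^ k ∂gammaMeasure 1 1 = k.factorial := by
  rw [integral_gammaMeasure_one_one, ← Real.Gamma_nat_eq_factorial,
    Real.Gamma_eq_integral (by positivity)]
  simp

lemma memLp_id_gammaMeasure_one_one : MemLp (fun y => y) 2 (gammaMeasure 1 1) :=
  (memLp_two_iff_integrable_sq (by fun_prop)).2 (integrable_pow_gammaMeasure_one_one 2)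

lemma variance_id_gammaMeasure_one_one : Var[fun y => y; gammaMeasure 1 1] = 1 := by
  rw [variance_eq_sub memLp_id_gammaMeasure_one_one]
  have h1 := integral_pow_gammaMeasure_one_one 1
  have h2 := integral_pow_gammaMeasure_one_one 2
  simp only [pow_one] at h1
  simp only [Pi.pow_apply, h1, h2]
  norm_num [Nat.factorial]

lemma integral_cexp_gammaMeasure_one_one (t : ℝ) :
    ∫ y, Complex.exp (t * y * Complex.I) ∂gammaMeasure 1 1 = (1 - t * Complex.I)⁻¹ := by
  rw [integral_gammaMeasure_one_one]
  have h := integral_exp_mul_complex_Ioi (a := -1 + t * Complex.I) (by simp) 0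
  simp only [Complex.ofReal_zero, mul_zero, Complex.exp_zero] at h
  rw [show (1 - t * Complex.I)⁻¹ = -1 / (-1 + t * Complex.I) by
    rw [show -1 + t * Complex.I = -(1 - t * Complex.I) by ring, neg_div_neg_eq, one_div], ← h]
  refine integral_congr_ae (ae_of_all _ fun y => ?_)
  simp only [Complex.real_smul, Complex.ofReal_exp, ← Complex.exp_add]
  congr 1
  push_cast
  ring

end Exponential

/-! ### Weak laws for exponential and Dirichlet weights -/

section WeightedAverages

/-- The law of `n` independent standard exponential variables. -/
noncomputable abbrev expSample (n : ℕ) : Measure (Fin n → ℝ) :=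
  Measure.pi fun _ => gammaMeasure 1 1

lemma dirichletMeasure_one (n : ℕ) :
    dirichletMeasure (fun _ : Fin n => (1 : ℝ)) =
      (expSample n).map fun y i => y i / ∑ j, y j := rfl

lemma ae_expSample_pos (n : ℕ) : ∀ᵐ y ∂expSample n, ∀ i, 0 < y i := by
  rw [ae_all_iff]
  intro i
  exact (measurePreserving_eval (fun _ : Fin n => gammaMeasure 1 1) i).quasiMeasurePreserving.ae
    ae_gammaMeasure_one_one_pos

/-- Exponential weights have mean and variance one, so the expectation is the plain average of `a`
and the variance is `∑ a i ^ 2 / n ^ 2`, which vanishes. -/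
lemma tendsto_expSample_average {a : ℕ → ℝ} {m : ℝ} (h : HasMean a m) :
    Tendsto (fun q : Σ n, Fin n → ℝ => (q.1 : ℝ)⁻¹ * ∑ i, q.2 i * a i) (inProb expSample)
      (𝓝 m) := by
  have hmem : ∀ n (i : Fin n), MemLp (fun y : ℝ => (n : ℝ)⁻¹ * (y * a i)) 2 (gammaMeasure 1 1) :=
    fun n i => (memLp_id_gammaMeasure_one_one.mul_const _).const_mul _
  have heq : ∀ n, (fun y : Fin n → ℝ => (n : ℝ)⁻¹ * ∑ i, y i * a i) =
      ∑ i : Fin n, fun y : Fin n → ℝ => (n : ℝ)⁻¹ * (y i * a i) := fun n => by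
    ext y
    simp [Finset.mul_sum]
  have hev : ∀ n (i : Fin n), MemLp (fun y : Fin n → ℝ => (n : ℝ)⁻¹ * (y i * a i)) 2
      (expSample n) := fun n i =>
    (hmem n i).comp_measurePreserving (measurePreserving_eval (fun _ => gammaMeasure 1 1) i)
  refine tendsto_inProb_of_variance (f := fun q : Σ n, Fin n → ℝ =>
    (q.1 : ℝ)⁻¹ * ∑ i, q.2 i * a i) (fun n => ?_) (h.tendsto.congr fun n => ?_) ?_
  · simp only [heq]
    exact memLp_finsetSum' _ fun i _ => hev n i
  · simp only
    rw [integral_const_mul]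
    change (n : ℝ)⁻¹ • ∑ i : Fin n, a i = (n : ℝ)⁻¹ *
      ∫ y : Fin n → ℝ, ∑ i : Fin n, y i * a i ∂expSample n
    rw [integral_finsetSum (f := fun (i : Fin n) (y : Fin n → ℝ) => y i * a i)]
    · rw [smul_eq_mul]
      congr 1
      refine Finset.sum_congr rfl fun i _ => ?_
      rw [integral_mul_const]
      have h1 := integral_pow_gammaMeasure_one_one 1
      have h2 : ∫ y : Fin n → ℝ, y i ∂expSample n = ∫ y, y ∂gammaMeasure 1 1 := by
        exact integral_comp_eval (μ := fun _ : Fin n => gammaMeasure 1 1) (f := fun y => y)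
          (i := i) (by fun_prop)
      simp only [pow_one, Nat.factorial_one, Nat.cast_one] at h1
      rw [h2, h1, one_mul]
    · intro i _
      have := (memLp_id_gammaMeasure_one_one.mul_const (a i)).comp_measurePreserving
        (measurePreserving_eval (fun _ : Fin n => gammaMeasure 1 1) i)
      exact this.integrable one_le_two
  · refine h.tendsto_sum_sq_div.congr fun n => ?_
    simp only [heq]
    rw [variance_sum_pi (X := fun (i : Fin n) y => (n : ℝ)⁻¹ * (y * a i)) (hmem n), Finset.sum_div]
    refine Finset.sum_congr rfl fun i _ => ?_
    rw [variance_const_mul, variance_mul_const, variance_id_gammaMeasure_one_one]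
    field_simp

lemma isAveraging_expSample : IsAveraging (inProb expSample)
    (fun q => ⟨q.1, fun i => (q.1 : ℝ)⁻¹ * q.2 i⟩) := fun a m h => by
  refine (tendsto_expSample_average h).congr fun q => ?_
  simp only [Finset.mul_sum, mul_assoc]

lemma tendsto_expSample_total :
    Tendsto (fun q : Σ n, Fin n → ℝ => (q.1 : ℝ)⁻¹ * ∑ i, q.2 i) (inProb expSample) (𝓝 1) := by
  simpa using tendsto_expSample_average (hasMean_const (1 : ℝ))

lemma measurable_normalize (n : ℕ) : Measurable fun (y : Fin n → ℝ) i => y i / ∑ j, y j := by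
  fun_prop

/-- A Dirichlet-weighted sum is the quotient of the exponential average of `a` by the exponential
average of 1. -/
lemma isAveraging_dirichlet :
    IsAveraging (inProb fun n => dirichletMeasure fun _ : Fin n => (1 : ℝ)) id := fun a m h => by
  simp only [id_eq]
  refine tendsto_inProb_map expSample (fun n => (measurable_normalize n).aemeasurable)
    (fun n => ?_) ?_
  · change Measurable fun y : Fin n → ℝ => ∑ i : Fin n, y i * a i
    fun_prop
  have := (tendsto_expSample_average h).div tendsto_expSample_total one_ne_zero
  rw [div_one] at this
  refine this.congr' ?_
  filter_upwards [(tendsto_fst_inProb expSample).eventually (eventually_gt_atTop 0)] with q hq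
  have : (q.1 : ℝ) ≠ 0 := by positivity
  simp only [Pi.div_apply, Function.comp_apply, Sigma.map, id_eq]
  rw [mul_div_mul_left _ _ (inv_ne_zero this), Finset.sum_div]
  exact Finset.sum_congr rfl fun i _ => by ring

end WeightedAverages

/-! ### Central limit theorem with Dirichlet weights -/

section CentralLimit

/-- Expand -log(1 - z) = z + z²/2 + `R z` at z = i b: the linear terms cancel by `h0`, the quadratic
ones give -s/2, and the cubic remainders sum to at most max |b| ∑ b². -/
lemma tendsto_prod_one_sub_mul_I_inv {b : (n : ℕ) → Fin n → ℝ} {s : ℝ}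
    (h0 : ∀ᶠ n in atTop, ∑ i, b n i = 0)
    (h2 : Tendsto (fun n => ∑ i, b n i ^ 2) atTop (𝓝 s))
    (hb : ∀ ε > 0, ∀ᶠ n in atTop, ∀ i, |b n i| ≤ ε) :
    Tendsto (fun n => ∏ i, (1 - b n i * Complex.I)⁻¹) atTop (𝓝 (Complex.exp (-s / 2))) := by
  let R : ℂ → ℂ := fun z => Complex.log (1 - z)⁻¹ - (z + z ^ 2 / 2)
  have hR : ∀ z : ℂ, ‖z‖ ≤ 1 / 2 → ‖R z‖ ≤ ‖z‖ ^ 3 := fun z hz => by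
    have h := Complex.norm_log_one_sub_inv_add_logTaylor_neg_le 2 (z := z) (by linarith)
    have he : R z = Complex.log (1 - z)⁻¹ + Complex.logTaylor (2 + 1) (-z) := by
      simp only [R, Complex.logTaylor_succ, Complex.logTaylor_zero]
      norm_num
      ring
    rw [he]
    refine h.trans ?_
    have h3 : (1 - ‖z‖)⁻¹ ≤ 2 := by
      rw [inv_le_comm₀ (by linarith) (by norm_num)]
      linarith
    calc ‖z‖ ^ (2 + 1) * (1 - ‖z‖)⁻¹ / ((2 : ℕ) + 1) ≤ ‖z‖ ^ 3 * 2 / ((2 : ℕ) + 1) := by gcongr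
      _ ≤ ‖z‖ ^ 3 := by
        have := pow_nonneg (norm_nonneg z) 3
        push_cast
        linarith
  have hnorm : ∀ x : ℝ, ‖(x * Complex.I : ℂ)‖ = |x| := fun x => by simp
  have hRsum : Tendsto (fun n => ∑ i, R (b n i * Complex.I)) atTop (𝓝 0) := by
    rw [Metric.nhds_basis_closedBall.tendsto_right_iff]
    intro ε hε
    have hs : 0 ≤ s := ge_of_tendsto' h2 fun n => by positivity
    filter_upwards [hb (1 / 2) (by norm_num), hb (ε / (s + 1)) (by positivity),
      h2.eventually_le_const (lt_add_one s)] with n h3 h4 h5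
    rw [mem_closedBall_zero_iff]
    calc ‖∑ i, R (b n i * Complex.I)‖ ≤ ∑ i, ε / (s + 1) * b n i ^ 2 := by
          refine norm_sum_le_of_le _ fun i _ => (hR _ (by rw [hnorm]; exact h3 i)).trans ?_
          rw [hnorm, ← sq_abs (b n i), pow_succ, mul_comm]
          gcongr
          exact h4 i
      _ = ε / (s + 1) * ∑ i, b n i ^ 2 := by rw [Finset.mul_sum]
      _ ≤ ε / (s + 1) * (s + 1) := by gcongr
      _ = ε := by field_simp
  have h2' : Tendsto (fun n => ((-(∑ i, b n i ^ 2) / 2 : ℝ) : ℂ)) atTop (𝓝 ((-s / 2 : ℝ) : ℂ)) :=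
    (Complex.continuous_ofReal.tendsto _).comp (h2.neg.div_const 2)
  have h6 := (Complex.continuous_exp.tendsto _).comp (h2'.add hRsum)
  rw [add_zero] at h6
  push_cast at h6
  refine h6.congr' ?_
  filter_upwards [h0, hb (1 / 2) (by norm_num)] with n hn hn2
  have hexp : ∀ i, (1 - b n i * Complex.I)⁻¹ =
      Complex.exp (b n i * Complex.I + (b n i * Complex.I) ^ 2 / 2 + R (b n i * Complex.I)) :=
    fun i => by
      simp only [R]
      rw [add_sub_cancel, Complex.exp_log]
      refine inv_ne_zero fun h => ?_
      have h7 := hn2 i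
      rw [← hnorm, ← sub_eq_zero.1 h, norm_one] at h7
      norm_num at h7
  simp only [hexp, ← Complex.exp_sum, Finset.sum_add_distrib, ← Finset.sum_mul,
    ← Complex.ofReal_sum, hn, Function.comp_apply]
  congr 1
  simp only [mul_pow, Complex.I_sq]
  push_cast
  rw [← Finset.sum_div, ← Finset.sum_mul]
  ring

variable {E : Type*} [NormedAddCommGroup E] [InnerProductSpace ℝ E] [MeasurableSpace E]
  [BorelSpace E] [FiniteDimensional ℝ E]

lemma charFun_expSample_sum {n : ℕ} (a : Fin n → E) (c : ℝ) (t : E) :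
    charFun ((expSample n).map fun y => c • ∑ i, y i • a i) t =
      ∏ i, (1 - (c * inner ℝ (a i) t : ℝ) * Complex.I)⁻¹ := by
  have : SecondCountableTopology E := secondCountable_of_proper
  rw [charFun_map_eq_integral (Measurable.aemeasurable (by fun_prop))]
  simp only [← integral_cexp_gammaMeasure_one_one]
  rw [← integral_fintype_prod_eq_prod (μ := fun _ : Fin n => gammaMeasure 1 1)
    (f := fun i (y : ℝ) => Complex.exp ((c * inner ℝ (a i) t : ℝ) * y * Complex.I))]
  refine integral_congr_ae (ae_of_all _ fun y => ?_)
  simp only [← Complex.exp_sum, inner_smul_left, sum_inner, RCLike.conj_to_real]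
  congr 1
  push_cast
  rw [Finset.mul_sum, Finset.sum_mul]
  exact Finset.sum_congr rfl fun i _ => by ring

/-- A central limit theorem for sums of triangular arrays with Dirichlet weights. -/
theorem tendsto_charFun_dirichlet {a : (n : ℕ) → Fin n → E} {Q : E → ℝ} (hQ : Continuous Q)
    (h0 : ∀ᶠ n in atTop, ∑ i, a n i = 0)
    (h2 : ∀ t, Tendsto (fun n : ℕ => (n : ℝ)⁻¹ * ∑ i, inner ℝ (a n i) t ^ 2) atTop (𝓝 (Q t)))
    (hb : ∀ ε > 0, ∀ᶠ n : ℕ in atTop, ∀ i, ‖a n i‖ ^ 2 ≤ ε * n) (t : E) :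
    Tendsto (fun n : ℕ => charFun ((dirichletMeasure fun _ : Fin n => (1 : ℝ)).map
      fun v => √(n : ℝ) • ∑ i, v i • a n i) t) atTop (𝓝 (Complex.exp (-Q t / 2))) := by
  have : SecondCountableTopology E := secondCountable_of_proper
  -- `X` uses raw exponential weights and `Z` normalised ones, so `Z` is `X` divided by the average
  -- of the weights. That average tends to one and `X` is tight, hence `X - Z` is negligible.
  let X : (Σ n, Fin n → ℝ) → E := fun q => (√(q.1 : ℝ))⁻¹ • ∑ i, q.2 i • a q.1 i
  let Z : (Σ n, Fin n → ℝ) → E := fun q => √(q.1 : ℝ) • ∑ i, (q.2 i / ∑ j, q.2 j) • a q.1 i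
  have hXm : ∀ n, Measurable fun y => X ⟨n, y⟩ := fun n => by
    change Measurable fun y : Fin n → ℝ => (√(n : ℝ))⁻¹ • ∑ i : Fin n, y i • a n i
    fun_prop
  have hZm' : ∀ n, Measurable fun v : Fin n → ℝ => √(n : ℝ) • ∑ i, v i • a n i := fun n => by
    fun_prop
  have hZm : ∀ n, Measurable fun y => Z ⟨n, y⟩ := fun n => (hZm' n).comp (measurable_normalize n)
  have hX : ∀ t, Tendsto (fun n => charFun ((expSample n).map fun y => X ⟨n, y⟩) t) atTop
      (𝓝 (Complex.exp (-Q t / 2))) := fun t => by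
    have hch : ∀ n, charFun ((expSample n).map fun y => X ⟨n, y⟩) t =
        ∏ i, (1 - ((√(n : ℝ))⁻¹ * inner ℝ (a n i) t : ℝ) * Complex.I)⁻¹ := fun n =>
      charFun_expSample_sum (a n) (√(n : ℝ))⁻¹ t
    simp only [hch]
    refine tendsto_prod_one_sub_mul_I_inv ?_ ((h2 t).congr fun n => ?_) fun ε hε => ?_
    · filter_upwards [h0] with n hn
      rw [← Finset.mul_sum, ← sum_inner, hn, inner_zero_left, mul_zero]
    · simp only [mul_pow, inv_pow, Real.sq_sqrt (Nat.cast_nonneg n), Finset.mul_sum]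
    · filter_upwards [hb ((ε / (‖t‖ + 1)) ^ 2) (by positivity), eventually_gt_atTop 0]
        with n hn hn0 i
      have hn' : (0 : ℝ) < √(n : ℝ) := by positivity
      have h1 : ‖a n i‖ ≤ ε / (‖t‖ + 1) * √(n : ℝ) := by
        refine le_of_sq_le_sq ?_ (by positivity)
        rw [mul_pow, Real.sq_sqrt (Nat.cast_nonneg n)]
        exact hn i
      rw [abs_mul, abs_of_pos (inv_pos.2 hn'), inv_mul_le_iff₀ hn']
      calc |inner ℝ (a n i) t| ≤ ‖a n i‖ * ‖t‖ := abs_real_inner_le_norm _ _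
        _ ≤ ε / (‖t‖ + 1) * √(n : ℝ) * (‖t‖ + 1) := by gcongr; linarith
        _ = √(n : ℝ) * ε := by field_simp
  have hprob : ∀ n, IsProbabilityMeasure ((expSample n).map fun y => X ⟨n, y⟩) := fun n =>
    Measure.isProbabilityMeasure_map (hXm n).aemeasurable
  have htight := isTightMeasureSet_of_tendsto_charFun
    (f := fun t => Complex.exp (-Q t / 2)) (by fun_prop) hX
  have hXZ : Tendsto (fun q => X q - Z q) (inProb expSample) (𝓝 0) := by
    refine tendsto_zero_of_isLittleO_of_isTight (S := X) ?_ (fun n => (hXm n).aemeasurable) htight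
    have h1 : Tendsto (fun q : Σ n, Fin n → ℝ => 1 - ((q.1 : ℝ)⁻¹ * ∑ i, q.2 i)⁻¹)
        (inProb expSample) (𝓝 0) := by
      simpa using (tendsto_expSample_total.inv₀ one_ne_zero).const_sub 1
    have h3 := ((Asymptotics.isLittleO_one_iff ℝ).2 h1).smul_isBigO
      (Asymptotics.isBigO_refl X (inProb expSample))
    simp only [one_smul] at h3
    refine h3.congr' ?_ EventuallyEq.rfl
    filter_upwards [(tendsto_fst_inProb expSample).eventually (eventually_gt_atTop 0)] with q hq
    have hq' : (0 : ℝ) < √(q.1 : ℝ) := by positivity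
    simp only [X, Z]
    rw [sub_smul, one_smul]
    congr 1
    have h4 : ∑ i, (q.2 i / ∑ j, q.2 j) • a q.1 i = (∑ j, q.2 j)⁻¹ • ∑ i, q.2 i • a q.1 i := by
      rw [Finset.smul_sum]
      exact Finset.sum_congr rfl fun i _ => by rw [smul_smul]; congr 1; ring
    rw [h4, smul_smul, smul_smul]
    congr 1
    rw [mul_inv, inv_inv]
    nth_rewrite 1 [← Real.sq_sqrt (Nat.cast_nonneg q.1)]
    field_simp
  have hZ := tendsto_charFun_of_tendsto_sub (fun n => (hXm n).aemeasurable)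
    (fun n => (hZm n).aemeasurable) hXZ t (hX t)
  refine hZ.congr fun n => ?_
  rw [dirichletMeasure_one, Measure.map_map (hZm' n) (measurable_normalize n)]
  rfl

end CentralLimit

/-! ### Distortion of exponential laws under coordinatewise scaling -/

section Scaling

lemma setLIntegral_Ioi_zero_scale {c : ℝ} (hc : 0 < c) {F : ℝ → ENNReal} (hF : Measurable F) :
    ∫⁻ y in Set.Ioi (0 : ℝ), F y = ENNReal.ofReal c * ∫⁻ y in Set.Ioi (0 : ℝ), F (c * y) := by
  rw [← lintegral_indicator measurableSet_Ioi, ← lintegral_indicator measurableSet_Ioi]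
  conv_lhs => rw [← Real.smul_map_volume_mul_left hc.ne']
  rw [lintegral_smul_measure, lintegral_map (hF.indicator measurableSet_Ioi) (by fun_prop),
    abs_of_pos hc, smul_eq_mul]
  congr 1
  refine lintegral_congr fun y => ?_
  simp [Set.indicator_apply, hc]

lemma lintegral_gammaMeasure_one_one {F : ℝ → ENNReal} (hF : Measurable F) :
    ∫⁻ y, F y ∂gammaMeasure 1 1 =
      ∫⁻ y in Set.Ioi (0 : ℝ), ENNReal.ofReal (Real.exp (-y)) * F y := by
  rw [gammaMeasure_one_one, lintegral_withDensity_eq_lintegral_mul _ (by fun_prop) hF]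
  rfl

lemma lintegral_exp_gammaMeasure_one_one {a : ℝ} (ha : a < 1) :
    ∫⁻ y, ENNReal.ofReal (Real.exp (a * y)) ∂gammaMeasure 1 1 = ENNReal.ofReal (1 - a)⁻¹ := by
  have h1 : 0 < 1 - a := by linarith
  have h := lintegral_gammaPDF_eq_one (a := 1) (r := 1 - a) one_pos h1
  simp only [gammaPDF_one] at h
  rw [lintegral_indicator measurableSet_Ici, ← restrict_Ioi_eq_restrict_Ici] at h
  simp only [ENNReal.ofReal_mul h1.le] at h
  rw [lintegral_const_mul _ (by fun_prop)] at h
  rw [lintegral_gammaMeasure_one_one (by fun_prop), ENNReal.ofReal_inv_of_pos h1]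
  refine ENNReal.eq_inv_of_mul_eq_one_left ?_
  rw [mul_comm, ← h]
  congr 1
  refine lintegral_congr fun y => ?_
  rw [← ENNReal.ofReal_mul (Real.exp_pos _).le, ← Real.exp_add]
  congr 2
  ring

/-- Scaling an exponential variable by `c` has a bounded effect on mean squares. -/
lemma sq_lintegral_gammaMeasure_le {c : ℝ} (hc : 1 / 2 < c) {f : ℝ → ENNReal}
    (hf : Measurable f) :
    (∫⁻ y, f y ∂gammaMeasure 1 1) ^ 2 ≤
      ENNReal.ofReal (c ^ 2 / (2 * c - 1)) * ∫⁻ y, f (c * y) ^ 2 ∂gammaMeasure 1 1 := by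
  have hc0 : 0 < c := by linarith
  have hc1 : 0 < 2 * c - 1 := by linarith
  -- Substituting `c * y` introduces the density ratio `c * exp ((1 - c) * y)`. Cauchy–Schwarz
  -- separates it from `f (c * y)`; its second moment `c ^ 2 / (2 * c - 1)` is finite because `c > 1
  -- / 2`.
  have h1 : ∫⁻ y, f y ∂gammaMeasure 1 1 =
      ∫⁻ y, f (c * y) * ENNReal.ofReal (c * Real.exp ((1 - c) * y)) ∂gammaMeasure 1 1 := by
    rw [lintegral_gammaMeasure_one_one hf, lintegral_gammaMeasure_one_one (by fun_prop),
      setLIntegral_Ioi_zero_scale hc0 (by fun_prop), ← lintegral_const_mul _ (by fun_prop)]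
    refine lintegral_congr fun y => ?_
    rw [mul_comm (f _), ← mul_assoc, ← mul_assoc, ← ENNReal.ofReal_mul hc0.le,
      ← ENNReal.ofReal_mul (Real.exp_pos _).le]
    congr 2
    rw [mul_left_comm, ← Real.exp_add]
    congr 2
    ring
  have h2 : ∫⁻ y, ENNReal.ofReal (c * Real.exp ((1 - c) * y)) ^ (2 : ℝ) ∂gammaMeasure 1 1 =
      ENNReal.ofReal (c ^ 2 / (2 * c - 1)) := by
    have h3 : ∀ y, ENNReal.ofReal (c * Real.exp ((1 - c) * y)) ^ (2 : ℝ) =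
        ENNReal.ofReal (c ^ 2) * ENNReal.ofReal (Real.exp ((2 - 2 * c) * y)) := fun y => by
      rw [ENNReal.rpow_two, ← ENNReal.ofReal_pow (by positivity), mul_pow, ← Real.exp_nat_mul,
        ← ENNReal.ofReal_mul (by positivity)]
      congr 3
      push_cast
      ring
    simp only [h3]
    rw [lintegral_const_mul _ (by fun_prop), lintegral_exp_gammaMeasure_one_one (by linarith),
      ← ENNReal.ofReal_mul (by positivity), div_eq_mul_inv]
    congr 3
    ring
  have hCS := ENNReal.lintegral_mul_le_Lp_mul_Lq (gammaMeasure 1 1) Real.HolderConjugate.two_two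
    (f := fun y => f (c * y)) (g := fun y => ENNReal.ofReal (c * Real.exp ((1 - c) * y)))
    (by fun_prop) (by fun_prop)
  simp only [Pi.mul_apply] at hCS
  rw [h2] at hCS
  rw [h1]
  calc _ ≤ _ := pow_le_pow_left₀ zero_le hCS 2
    _ = _ := by
      rw [mul_pow, ← ENNReal.rpow_mul_natCast, ← ENNReal.rpow_mul_natCast]
      norm_num
      rw [mul_comm]

/-- Tensorisation: apply the one-dimensional bound to the integral over the remaining coordinates,
then the induction hypothesis for each value of the first. -/
lemma sq_lintegral_expSample_le {n : ℕ} {c : Fin n → ℝ} (hc : ∀ i, 1 / 2 < c i)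
    {f : (Fin n → ℝ) → ENNReal} (hf : Measurable f) :
    (∫⁻ y, f y ∂expSample n) ^ 2 ≤
      (∏ i, ENNReal.ofReal (c i ^ 2 / (2 * c i - 1))) * ∫⁻ y, f (c * y) ^ 2 ∂expSample n := by
  induction n with
  | zero =>
    have h : ∀ y : Fin 0 → ℝ, f y = f 0 := fun y => by rw [Subsingleton.elim y 0]
    simp only [h, lintegral_const, measure_univ, mul_one]
    simp
  | succ n ih =>
    have hmp := (measurePreserving_piFinSuccAbove
      (fun _ : Fin (n + 1) => gammaMeasure 1 1) 0).symm
    have hsplit : ∀ F : (Fin (n + 1) → ℝ) → ENNReal, Measurable F →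
        ∫⁻ y, F y ∂expSample (n + 1) =
          ∫⁻ a, ∫⁻ y, F (Fin.cons a y) ∂expSample n ∂gammaMeasure 1 1 := fun F hF => by
      rw [← hmp.lintegral_comp hF]
      refine (lintegral_prod _ (hF.comp hmp.measurable).aemeasurable).trans ?_
      simp [MeasurableEquiv.piFinSuccAbove, Fin.insertNthEquiv]
    have hcons : Measurable fun p : ℝ × (Fin n → ℝ) => (Fin.cons p.1 p.2 : Fin (n + 1) → ℝ) := by
      refine measurable_pi_iff.2 fun i => ?_
      refine Fin.cases ?_ (fun j => ?_) i
      · simpa using measurable_fst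
      · simp only [Fin.cons_succ]
        fun_prop
    have hcm : Measurable fun y : Fin (n + 1) → ℝ => f (c * y) ^ 2 := by fun_prop
    rw [hsplit f hf, hsplit _ hcm]
    have hh : Measurable fun a => ∫⁻ y, f (Fin.cons a y) ∂expSample n :=
      (hf.comp hcons).lintegral_prod_right'
    refine (sq_lintegral_gammaMeasure_le (hc 0) hh).trans ?_
    rw [Fin.prod_univ_succ, mul_assoc]
    gcongr
    rw [← lintegral_const_mul]
    swap
    · exact (hcm.comp hcons).lintegral_prod_right'
    refine lintegral_mono fun a => ?_
    have hf' : Measurable fun y : Fin n → ℝ => f (Fin.cons (c 0 * a) y) :=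
      hf.comp (hcons.comp measurable_prodMk_left)
    refine (ih (c := fun i => c i.succ) (fun i => hc _) hf').trans_eq ?_
    congr 1
    refine lintegral_congr fun y => ?_
    congr 2
    ext i
    refine Fin.cases ?_ (fun j => ?_) i <;> simp

/-- Each factor is c²/(2c − 1) = 1 + (c − 1)²/(2c − 1) ≤ exp(1/n), so scaling every coordinate by 1
+ O(n^(-1/2)) costs only a constant, whatever n is. -/
lemma sq_expSample_le {n : ℕ} {c : Fin n → ℝ} (hc : ∀ i, (c i - 1) ^ 2 ≤ 1 / (16 * n))
    {A : Set (Fin n → ℝ)} (hA : MeasurableSet A) :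
    expSample n A ^ 2 ≤ ENNReal.ofReal (Real.exp 1) * expSample n {y | c * y ∈ A} := by
  have hc2 : ∀ i, 3 / 4 ≤ c i := fun i => by
    have hn : (1 : ℝ) ≤ n := by exact_mod_cast i.pos
    have h1 : (c i - 1) ^ 2 ≤ (1 / 4) ^ 2 := (hc i).trans (by
      rw [div_le_iff₀ (by positivity)]; linarith)
    have := abs_le.1 (abs_le_of_sq_le_sq h1 (by norm_num))
    linarith [this.1]
  have h := sq_lintegral_expSample_le (fun i => by linarith [hc2 i] : ∀ i, 1 / 2 < c i)
    (measurable_one.indicator hA : Measurable (A.indicator (1 : (Fin n → ℝ) → ENNReal)))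
  have hcm : Measurable fun y : Fin n → ℝ => c * y := by fun_prop
  have hsq : ∀ y, A.indicator (1 : (Fin n → ℝ) → ENNReal) (c * y) ^ 2 =
      ((fun y => c * y) ⁻¹' A).indicator 1 y := fun y => by
    by_cases hy : c * y ∈ A <;> simp [hy]
  simp only [hsq] at h
  rw [lintegral_indicator_one hA, lintegral_indicator_one (hcm hA)] at h
  refine h.trans (mul_le_mul' ?_ le_rfl)
  calc ∏ i, ENNReal.ofReal (c i ^ 2 / (2 * c i - 1))
      ≤ ∏ i : Fin n, ENNReal.ofReal (Real.exp (1 / n)) := by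
        refine Finset.prod_le_prod' fun i _ => ENNReal.ofReal_le_ofReal ?_
        have h2 := hc2 i
        have h3 := hc i
        have h4 := Real.add_one_le_exp (1 / (n : ℝ))
        have hn : (1 : ℝ) ≤ n := by exact_mod_cast i.pos
        rw [div_le_iff₀ (by linarith)]
        have h5 : 1 / (16 * (n : ℝ)) = 1 / 16 * (1 / n) := by field_simp
        have h6 : 0 < 1 / (n : ℝ) := by positivity
        nlinarith
    _ ≤ ENNReal.ofReal (Real.exp 1) := by
        rw [Finset.prod_const, Finset.card_univ, Fintype.card_fin,
          ← ENNReal.ofReal_pow (Real.exp_pos _).le, ← Real.exp_nat_mul]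
        refine ENNReal.ofReal_le_ofReal (Real.exp_le_exp.2 ?_)
        rcases Nat.eq_zero_or_pos n with rfl | hn
        · simp
        · have : (n : ℝ) ≠ 0 := by positivity
          field_simp
          exact le_rfl

end Scaling

/-! ### Tilting the weights moves the zero of the gradient -/

section Expansion

/-- Any choice of a related point of `A` for each `s` is antilipschitz. Hausdorff measure tolerates
an arbitrary, possibly non-measurable choice, so neither uniqueness nor regularity of zeros is
required. -/
lemma hausdorffMeasure_le_of_expanding {X Y : Type*} [MetricSpace X] [MeasurableSpace X]
    [BorelSpace X] [MetricSpace Y] [MeasurableSpace Y] [BorelSpace Y] {S : Set X} {A : Set Y}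
    {r : X → Y → Prop} (hr : ∀ s ∈ S, ∃ y ∈ A, r s y) {C : NNReal}
    (hC : ∀ s ∈ S, ∀ s' ∈ S, ∀ y ∈ A, ∀ y' ∈ A, r s y → r s' y' → dist s s' ≤ C * dist y y')
    {d : ℝ} (hd : 0 ≤ d) :
    Measure.hausdorffMeasure d S ≤ (C : ENNReal) ^ d * Measure.hausdorffMeasure d A := by
  choose φ hφA hφ using hr
  have hanti : AntilipschitzWith C fun s : S => φ s s.2 := AntilipschitzWith.of_le_mul_dist
    fun s s' => hC s s.2 s' s'.2 _ (hφA s s.2) _ (hφA s' s'.2) (hφ s s.2) (hφ s' s'.2)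
  have h1 := hanti.le_hausdorffMeasure_image hd Set.univ
  have h2 := (isometry_subtype_coe (s := S)).hausdorffMeasure_image (Or.inl hd) Set.univ
  rw [Set.image_univ, Subtype.range_coe] at h2
  rw [h2]
  refine h1.trans ?_
  gcongr
  rintro _ ⟨s, -, rfl⟩
  exact hφA s s.2

variable {E : Type*} [NormedAddCommGroup E] [InnerProductSpace ℝ E]

lemma half_sq_le_mul_exp_sub_one {z : ℝ} (hz : |z| ≤ 1 / 2) : z ^ 2 / 2 ≤ (Real.exp z - 1) * z := by
  have h := Real.abs_exp_sub_one_sub_id_le (x := z) (by linarith)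
  have h1 : |(Real.exp z - 1 - z) * z| ≤ z ^ 2 * (1 / 2) := by
    rw [abs_mul]
    gcongr
  have := (abs_le.1 h1).1
  nlinarith

/-- If the weights `y i` are tilted by the factors `exp z i`, where `z i` is the inner product of
`v` with a normalized gradient, then the zero of the weighted gradient moves at least by a constant
multiple of `v`. -/
lemma norm_le_of_tilted_zero {n : ℕ} (hn : 0 < n) {y : Fin n → ℝ} (hy : ∀ i, 0 ≤ y i)
    {g₀ g g' : Fin n → E} {G : Fin n → ℝ} {v : E} (hv : ‖v‖ ≤ 1 / 2) {κ C ρ δ : ℝ}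
    (hz : ∑ i, (y i * Real.exp (inner ℝ v (g₀ i) / (1 + ‖g₀ i‖))) • g i = 0)
    (hz' : ∑ i, y i • g' i = 0) (hρ : ∀ i, ‖g i - g₀ i‖ ≤ ρ * G i)
    (hδ : ∀ i, ‖g i - g' i‖ ≤ δ * G i) (hG : ∑ i, y i * G i ≤ C * n) (hρ0 : 0 ≤ ρ) (hδ0 : 0 ≤ δ)
    (hκ : κ * n * ‖v‖ ^ 2 ≤ ∑ i, y i * (inner ℝ v (g₀ i) ^ 2 / (1 + ‖g₀ i‖)))
    (hκρ : 8 * C * ρ ≤ κ) : κ * ‖v‖ ≤ 4 * C * δ := by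
  set z : Fin n → ℝ := fun i => inner ℝ v (g₀ i) / (1 + ‖g₀ i‖) with hzdef
  have hpos : ∀ i, 0 < 1 + ‖g₀ i‖ := fun i => by positivity
  have hzv : ∀ i, |z i| ≤ ‖v‖ := fun i => by
    rw [hzdef, abs_div, abs_of_pos (hpos i), div_le_iff₀ (hpos i)]
    refine (abs_real_inner_le_norm _ _).trans ?_
    gcongr
    linarith
  -- Subtract the two zero equations after pairing them with `v`. The left side will be of order
  -- `‖v‖ ^ 2` from below, the right side of order `‖v‖ * δ` from above.
  have h1 : ∑ i, y i * ((Real.exp (z i) - 1) * inner ℝ v (g i)) =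
      -∑ i, y i * inner ℝ v (g i - g' i) := by
    have e1 := congrArg (fun x => inner ℝ v x) hz
    have e2 := congrArg (fun x => inner ℝ v x) hz'
    simp only [inner_sum, inner_smul_right, inner_zero_right] at e1 e2
    rw [← sub_eq_zero, sub_neg_eq_add, ← Finset.sum_add_distrib, ← e1]
    rw [← sub_eq_zero, ← Finset.sum_sub_distrib, ← neg_eq_zero, ← Finset.sum_neg_distrib, ← e2]
    refine Finset.sum_congr rfl fun i _ => ?_
    rw [inner_sub_right]
    ring
  have h2 : -∑ i, y i * inner ℝ v (g i - g' i) ≤ ‖v‖ * δ * ∑ i, y i * G i := by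
    rw [← Finset.sum_neg_distrib, Finset.mul_sum]
    refine Finset.sum_le_sum fun i _ => ?_
    have : -inner ℝ v (g i - g' i) ≤ ‖v‖ * (δ * G i) :=
      (neg_le_abs _).trans ((abs_real_inner_le_norm _ _).trans (by gcongr; exact hδ i))
    nlinarith [hy i]
  -- With `g₀ i` in place of `g i` the product is `(exp z - 1) * z * (1 + ‖g₀ i‖)`, at least half
  -- the quadratic form; the replacement costs `|exp z - 1| ≤ 2 * ‖v‖` times `‖v‖ * ρ * G i`.
  have h3 : ∀ i, inner ℝ v (g₀ i) ^ 2 / (1 + ‖g₀ i‖) / 2 - 2 * ‖v‖ ^ 2 * ρ * G i ≤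
      (Real.exp (z i) - 1) * inner ℝ v (g i) := fun i => by
    have e1 : inner ℝ v (g i) = inner ℝ v (g₀ i) + inner ℝ v (g i - g₀ i) := by
      rw [inner_sub_right]; ring
    have e2 : inner ℝ v (g₀ i) = z i * (1 + ‖g₀ i‖) := by
      rw [hzdef]; exact (div_mul_cancel₀ _ (hpos i).ne').symm
    have e3 : |(Real.exp (z i) - 1) * inner ℝ v (g i - g₀ i)| ≤ 2 * ‖v‖ * (‖v‖ * (ρ * G i)) := by
      rw [abs_mul]
      have e4 := Real.abs_exp_sub_one_le (x := z i) (by linarith [hzv i])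
      have e5 := (abs_real_inner_le_norm v (g i - g₀ i)).trans
        (mul_le_mul_of_nonneg_left (hρ i) (norm_nonneg v))
      gcongr
      exact e4.trans (by linarith [hzv i])
    have e6 := half_sq_le_mul_exp_sub_one ((hzv i).trans hv)
    have e7 := (abs_le.1 e3).1
    have e8 : inner ℝ v (g₀ i) ^ 2 / (1 + ‖g₀ i‖) = z i ^ 2 * (1 + ‖g₀ i‖) := by
      rw [e2]; field_simp
    rw [e1, mul_add, e8]
    rw [e2]
    nlinarith [hpos i]
  have h4 : (∑ i, y i * (inner ℝ v (g₀ i) ^ 2 / (1 + ‖g₀ i‖))) / 2 -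
      2 * ‖v‖ ^ 2 * ρ * ∑ i, y i * G i ≤ ∑ i, y i * ((Real.exp (z i) - 1) * inner ℝ v (g i)) := by
    rw [Finset.sum_div, Finset.mul_sum, ← Finset.sum_sub_distrib]
    refine Finset.sum_le_sum fun i _ => ?_
    have := mul_le_mul_of_nonneg_left (h3 i) (hy i)
    linarith
  have hn' : (0 : ℝ) < n := by positivity
  have h5 : ‖v‖ * δ * ∑ i, y i * G i ≤ ‖v‖ * δ * (C * n) := by gcongr
  have h6 : 2 * ‖v‖ ^ 2 * ρ * ∑ i, y i * G i ≤ 2 * ‖v‖ ^ 2 * ρ * (C * n) := by gcongr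
  have h7 : (κ * n * ‖v‖ ^ 2) / 2 - 2 * ‖v‖ ^ 2 * ρ * (C * n) ≤ ‖v‖ * δ * (C * n) := by linarith
  have h8 : κ * ‖v‖ ^ 2 / 2 - 2 * ‖v‖ ^ 2 * ρ * C ≤ ‖v‖ * δ * C := by
    refine le_of_mul_le_mul_right ?_ hn'
    linarith
  have hC : 0 ≤ C * n ∨ C * n < 0 := le_or_gt _ _
  -- If `v = 0`, only `0 ≤ 4 * C * δ` remains, and `δ > 0` forces `G ≥ 0` and hence `C ≥ 0`.
  -- Otherwise `hκρ` bounds the subtracted term of `h8` by `κ * ‖v‖ ^ 2 / 4`, and one factor `‖v‖`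
  -- cancels.
  rcases (norm_nonneg v).eq_or_lt with h0 | h0
  · rw [← h0, mul_zero]
    rcases eq_or_lt_of_le hδ0 with hδ0 | hδ0
    · rw [← hδ0, mul_zero]
    · have h9 : 0 ≤ ∑ i, y i * G i := Finset.sum_nonneg fun i _ => mul_nonneg (hy i) (by
        have := (norm_nonneg _).trans (hδ i)
        exact nonneg_of_mul_nonneg_right this hδ0)
      have : 0 ≤ C := nonneg_of_mul_nonneg_left (h9.trans hG) hn'
      positivity
  · refine le_of_mul_le_mul_right ?_ h0
    nlinarith [sq_nonneg ‖v‖]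

end Expansion

/-! ### Anti-concentration of the zero of the weighted gradient -/

section AntiConcentration

variable {E : Type*} [NormedAddCommGroup E] [InnerProductSpace ℝ E]

/-- Weights for which the weighted gradients at `θ₀` are non-degenerate and the weighted dominating
functions are bounded. -/
def nondegenerateWeights {n : ℕ} (g₀ : Fin n → E) (G : Fin n → ℝ) (C κ : ℝ) :
    Set (Fin n → ℝ) :=
  {y | (∀ i, 0 ≤ y i) ∧ ∑ i, y i * G i ≤ C * n ∧
    ∀ v, κ * n * ‖v‖ ^ 2 ≤ ∑ i, y i * (inner ℝ v (g₀ i) ^ 2 / (1 + ‖g₀ i‖))}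

/-- Weights for which the weighted gradient has a zero in `B`. -/
def zeroWeights {n : ℕ} (g : Fin n → E → E) (B : Set E) : Set (Fin n → ℝ) :=
  {y | ∃ θ ∈ B, ∑ i, y i • g i θ = 0}

lemma isClosed_nondegenerateWeights {n : ℕ} (g₀ : Fin n → E) (G : Fin n → ℝ) (C κ : ℝ) :
    IsClosed (nondegenerateWeights g₀ G C κ) := by
  refine IsClosed.inter ?_ (IsClosed.inter ?_ ?_)
  · change IsClosed {y : Fin n → ℝ | ∀ i, 0 ≤ y i}
    simp only [Set.ofPred_forall]
    exact isClosed_iInter fun i => isClosed_le (by fun_prop) (by fun_prop)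
  · exact isClosed_le (f := fun y : Fin n → ℝ => ∑ i, y i * G i) (by fun_prop) continuous_const
  · change IsClosed {y : Fin n → ℝ | ∀ v, κ * n * ‖v‖ ^ 2 ≤
      ∑ i, y i * (inner ℝ v (g₀ i) ^ 2 / (1 + ‖g₀ i‖))}
    simp only [Set.ofPred_forall]
    exact isClosed_iInter fun v => isClosed_le (by fun_prop) (by fun_prop)

/-- It is the projection of a closed set along the compact factor `B`. Closedness makes the event
measurable without a measurable selection of zeros. -/
lemma isClosed_zeroWeights {n : ℕ} {g : Fin n → E → E} {B : Set E} (hB : IsCompact B)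
    (hg : ∀ i, ContinuousOn (g i) B) : IsClosed (zeroWeights g B) := by
  have : CompactSpace B := isCompact_iff_compactSpace.1 hB
  have hcont : Continuous fun p : (Fin n → ℝ) × B => ∑ i, p.1 i • g i p.2 := by
    have h := fun i => (hg i).domRestrict
    refine continuous_finsetSum _ fun i _ => ?_
    exact ((continuous_apply i).comp continuous_fst).smul ((h i).comp continuous_snd)
  have h1 : IsClosed {p : (Fin n → ℝ) × B | ∑ i, p.1 i • g i p.2 = 0} :=
    isClosed_eq hcont continuous_const
  have h2 := isClosedMap_fst_of_compactSpace (X := Fin n → ℝ) (Y := B) _ h1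
  convert h2 using 1
  ext y
  constructor
  · rintro ⟨θ, hθ, h⟩
    exact ⟨(y, ⟨θ, hθ⟩), h, rfl⟩
  · rintro ⟨⟨y', θ⟩, h, rfl⟩
    exact ⟨θ, θ.2, h⟩

variable [FiniteDimensional ℝ E] [MeasurableSpace E] [BorelSpace E]

/-- An anti-concentration inequality: with independent exponential weights, the zero of the weighted
gradient falls into a small set with small probability only. -/
theorem expSample_zeroWeights_le {n : ℕ} (hn : 0 < n) {g : Fin n → E → E} {G : Fin n → ℝ} {θ₀ : E}
    {ρ κ C : ℝ} (hρ : 0 ≤ ρ) (hκ : 0 < κ) (hC : 0 ≤ C) (hκρ : 8 * C * ρ ≤ κ) {B : Set E}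
    (hB : IsCompact B) (hBρ : B ⊆ Metric.closedBall θ₀ ρ)
    (hg : ∀ i, ∀ θ ∈ Metric.closedBall θ₀ ρ, ∀ θ' ∈ Metric.closedBall θ₀ ρ,
      ‖g i θ - g i θ'‖ ≤ G i * ‖θ - θ'‖) (hG : ∀ i, 0 ≤ G i) :
    Measure.hausdorffMeasure (Module.finrank ℝ E) (Metric.ball (0 : E) (1 / (8 * √(n : ℝ)))) *
      expSample n (zeroWeights g B ∩ nondegenerateWeights (fun i => g i θ₀) G C κ) ^ 2 ≤
    ENNReal.ofReal (Real.exp 1) * (ENNReal.ofReal (4 * C / κ) ^ (Module.finrank ℝ E : ℝ) *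
      Measure.hausdorffMeasure (Module.finrank ℝ E) B) := by
  set lam : Measure E := Measure.hausdorffMeasure (Module.finrank ℝ E) with hlam
  set A := zeroWeights g B ∩ nondegenerateWeights (fun i => g i θ₀) G C κ with hA
  have hθ₀ : θ₀ ∈ Metric.closedBall θ₀ ρ := Metric.mem_closedBall_self hρ
  have hgc : ∀ i, ContinuousOn (g i) B := fun i => by
    refine LipschitzOnWith.continuousOn (K := (G i).toNNReal)
      (LipschitzOnWith.of_dist_le_mul fun θ hθ θ' hθ' => ?_)
    rw [dist_eq_norm, dist_eq_norm, Real.coe_toNNReal _ (hG i)]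
    exact hg i θ (hBρ hθ) θ' (hBρ hθ')
  have hAc : IsClosed A :=
    (isClosed_zeroWeights hB hgc).inter (isClosed_nondegenerateWeights _ _ _ _)
  -- Normalising makes `‖u i‖ ≤ 1`, so a tilt by `s` changes every weight by a factor uniformly
  -- close to one, however heavy the tails of the gradients are.
  let u : Fin n → E := fun i => (1 + ‖g i θ₀‖)⁻¹ • g i θ₀
  have hu : ∀ i (v : E), inner ℝ v (u i) = inner ℝ v (g i θ₀) / (1 + ‖g i θ₀‖) := fun i v => by
    simp only [u, inner_smul_right]
    rw [div_eq_inv_mul]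
  have hul : ∀ i, ‖u i‖ ≤ 1 := fun i => by
    simp only [u]
    rw [norm_smul, norm_inv, Real.norm_of_nonneg (by positivity), inv_mul_le_iff₀ (by positivity)]
    linarith
  let T : E → (Fin n → ℝ) → Fin n → ℝ := fun s y i => Real.exp (inner ℝ s (u i)) * y i
  have hTc : Continuous fun p : E × (Fin n → ℝ) => T p.1 p.2 := by
    dsimp only [T]
    fun_prop
  have hn1 : (1 : ℝ) ≤ √(n : ℝ) := by
    rw [Real.one_le_sqrt]
    exact_mod_cast hn
  have hsmall : ∀ s ∈ Metric.ball (0 : E) (1 / (8 * √(n : ℝ))), ‖s‖ ≤ 1 / 8 := fun s hs => by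
    rw [mem_ball_zero_iff] at hs
    refine hs.le.trans (one_div_le_one_div_of_le (by norm_num) (by linarith))
  -- The radius gives `|exp ⟨s, u i⟩ - 1| ≤ 1 / (4√n)`, whose square is the `1 / (16 n)` allowed by
  -- `sq_expSample_le`.
  have h1 : ∀ s ∈ Metric.ball (0 : E) (1 / (8 * √(n : ℝ))),
      expSample n A ^ 2 ≤ ENNReal.ofReal (Real.exp 1) * expSample n {y | T s y ∈ A} := by
    intro s hs
    refine sq_expSample_le (c := fun i => Real.exp (inner ℝ s (u i))) (fun i => ?_)
      hAc.measurableSet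
    have h2 : |inner ℝ s (u i)| ≤ ‖s‖ :=
      (abs_real_inner_le_norm _ _).trans (mul_le_of_le_one_right (norm_nonneg _) (hul i))
    have h3 := Real.abs_exp_sub_one_le (x := inner ℝ s (u i)) (by linarith [hsmall s hs])
    rw [mem_ball_zero_iff] at hs
    have h4 : |Real.exp (inner ℝ s (u i)) - 1| ≤ 1 / (4 * √(n : ℝ)) :=
      h3.trans ((mul_le_mul_of_nonneg_left (h2.trans hs.le) zero_le_two).trans
        (le_of_eq (by field_simp; norm_num)))
    rw [← sq_abs]
    refine (pow_le_pow_left₀ (abs_nonneg _) h4 2).trans (le_of_eq ?_)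
    rw [div_pow, mul_pow, Real.sq_sqrt (Nat.cast_nonneg n)]
    norm_num
  -- For fixed `y`, the weights `T s y` are `T s' y` tilted by `s - s'`, so zeros for `s` and `s'`
  -- are at least `κ / (4 * C)` times `‖s - s'‖` apart.
  have h2 : ∀ y, lam (Metric.ball (0 : E) (1 / (8 * √(n : ℝ))) ∩ {s | T s y ∈ A}) ≤
      ENNReal.ofReal (4 * C / κ) ^ (Module.finrank ℝ E : ℝ) * lam B := by
    intro y
    refine hausdorffMeasure_le_of_expanding
      (r := fun s θ => ∑ i, T s y i • g i θ = 0) (C := (4 * C / κ).toNNReal)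
      (fun s hs => hs.2.1) ?_ (by positivity)
    intro s hs s' hs' θ hθ θ' hθ' hr hr'
    have hd : ‖s - s'‖ ≤ 1 / 2 := (norm_sub_le _ _).trans
      (by linarith [hsmall s hs.1, hsmall s' hs'.1])
    obtain ⟨hy, hyG, hyκ⟩ := hs'.2.2
    have h3 := norm_le_of_tilted_zero hn hy (g₀ := fun i => g i θ₀) (g := fun i => g i θ)
      (g' := fun i => g i θ') (G := G) (v := s - s') hd (κ := κ) (C := C) (ρ := ρ)
      (δ := ‖θ - θ'‖) ?_ hr' ?_ ?_ hyG hρ (norm_nonneg _) (hyκ _) hκρ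
    · rw [dist_eq_norm, dist_eq_norm, Real.coe_toNNReal _ (by positivity), div_mul_eq_mul_div,
        le_div_iff₀ hκ]
      linarith
    · rw [← hr]
      refine Finset.sum_congr rfl fun i _ => ?_
      congr 1
      rw [← hu]
      simp only [T]
      rw [mul_right_comm, ← Real.exp_add]
      congr 2
      rw [inner_sub_left]
      ring
    · intro i
      refine (hg i θ (hBρ hθ) θ₀ hθ₀).trans ?_
      rw [mul_comm]
      have := mem_closedBall_iff_norm.1 (hBρ hθ)
      exact mul_le_mul_of_nonneg_right this (hG i)
    · intro i
      refine (hg i θ (hBρ hθ) θ' (hBρ hθ')).trans_eq (mul_comm _ _)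
  have hpre : MeasurableSet {p : E × (Fin n → ℝ) | T p.1 p.2 ∈ A} :=
    (hAc.preimage hTc).measurableSet
  -- Average `h1` over the tilts, exchange the integrals, and bound the volume of admissible tilts
  -- for each `y` by `h2`.
  calc lam (Metric.ball (0 : E) (1 / (8 * √(n : ℝ)))) * expSample n A ^ 2
      = ∫⁻ _ in Metric.ball (0 : E) (1 / (8 * √(n : ℝ))), expSample n A ^ 2 ∂lam := by
        rw [setLIntegral_const, mul_comm]
    _ ≤ ∫⁻ s in Metric.ball (0 : E) (1 / (8 * √(n : ℝ))),
          ENNReal.ofReal (Real.exp 1) * expSample n {y | T s y ∈ A} ∂lam :=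
        setLIntegral_mono' Metric.isOpen_ball.measurableSet h1
    _ = ENNReal.ofReal (Real.exp 1) *
          ∫⁻ s in Metric.ball (0 : E) (1 / (8 * √(n : ℝ))), expSample n {y | T s y ∈ A} ∂lam := by
        rw [lintegral_const_mul]
        exact measurable_measure_prodMk_left hpre
    _ = ENNReal.ofReal (Real.exp 1) * ∫⁻ y, lam.restrict (Metric.ball (0 : E) (1 / (8 * √(n : ℝ))))
          {s | T s y ∈ A} ∂expSample n := by
        congr 1
        have e1 := Measure.prod_apply (μ := lam.restrict (Metric.ball (0 : E) (1 / (8 * √(n : ℝ)))))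
          (ν := expSample n) hpre
        have e2 := Measure.prod_apply_symm
          (μ := lam.restrict (Metric.ball (0 : E) (1 / (8 * √(n : ℝ))))) (ν := expSample n) hpre
        exact e1.symm.trans e2
    _ ≤ ENNReal.ofReal (Real.exp 1) * ∫⁻ _, ENNReal.ofReal (4 * C / κ) ^ (Module.finrank ℝ E : ℝ) *
          lam B ∂expSample n := by
        gcongr with y
        rw [Measure.restrict_apply' Metric.isOpen_ball.measurableSet, Set.inter_comm]
        exact h2 y
    _ = _ := by simp

end AntiConcentration

/-! ### From weak to setwise convergence -/

section SetwiseConvergence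

variable {E : Type*} [NormedAddCommGroup E] [NormedSpace ℝ E] [FiniteDimensional ℝ E]
  [MeasurableSpace E] [BorelSpace E]

/-- Weak convergence together with asymptotic absolute continuity yields convergence on every
measurable set. -/
theorem tendsto_measure_of_uniform_bound {μ : ℕ → ProbabilityMeasure E} {ν : ProbabilityMeasure E}
    (h : Tendsto μ atTop (𝓝 ν)) {lam : Measure E} [lam.OuterRegular] [IsLocallyFiniteMeasure lam]
    {ε : ℕ → ENNReal} (hε : Tendsto ε atTop (𝓝 0)) {K : ENNReal} (hK : K ≠ ⊤)
    (hbd : ∀ᶠ n in atTop, ∀ A, IsCompact A →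
      (μ n : Measure E) A ≤ (K * lam A) ^ (1 / 2 : ℝ) + ε n)
    {A : Set E} (hA : MeasurableSet A) :
    Tendsto (fun n => (μ n : Measure E) A) atTop (𝓝 ((ν : Measure E) A)) := by
  have hbd' : ∀ᶠ n in atTop, ∀ A, MeasurableSet A →
      (μ n : Measure E) A ≤ (K * lam A) ^ (1 / 2 : ℝ) + ε n := by
    filter_upwards [hbd] with n hn A hA
    rw [hA.measure_eq_iSup_isCompact_of_ne_top (measure_ne_top _ _)]
    refine iSup₂_le fun F hF => iSup_le fun hFc => (hn F hFc).trans ?_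
    gcongr
  -- Lower bound: cut `A` down to finite volume, enclose it in an open `U` of barely larger volume,
  -- and use the portmanteau inequality on `U`. By `hbd'` the excess `U \ Ak` carries little mass
  -- for all large n.
  have hlow : ∀ A : Set E, MeasurableSet A → ∀ c < (ν : Measure E) A,
      ∀ᶠ n in atTop, c < (μ n : Measure E) A := by
    intro A hA c hc
    have hmono : Monotone fun k : ℕ => A ∩ Metric.closedBall (0 : E) k := fun k l hkl =>
      Set.inter_subset_inter_right _ (Metric.closedBall_subset_closedBall (by exact_mod_cast hkl))
    have hU : ⋃ k : ℕ, A ∩ Metric.closedBall (0 : E) k = A := by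
      rw [← Set.inter_iUnion, Metric.iUnion_closedBall_nat, Set.inter_univ]
    have hlim := tendsto_measure_iUnion_atTop (μ := (ν : Measure E)) hmono
    rw [hU] at hlim
    obtain ⟨k, hk⟩ := (hlim.eventually_const_lt hc).exists
    set Ak := A ∩ Metric.closedBall (0 : E) k with hAk
    have hAkm : MeasurableSet Ak := hA.inter Metric.isClosed_closedBall.measurableSet
    have hAkfin : lam Ak ≠ ⊤ := ((measure_mono Set.inter_subset_right).trans_lt
      (isCompact_closedBall (0 : E) k).measure_lt_top).ne
    obtain ⟨c', hcc', hc'⟩ := exists_between hk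
    set e := (c' - c) / 2 with he
    have hc'top : c' ≠ ⊤ := (hc'.trans_le le_top).ne
    have hepos : 0 < e := ENNReal.half_pos (tsub_pos_of_lt hcc').ne'
    have hetop : e ≠ ⊤ := (ENNReal.div_lt_top (ENNReal.sub_ne_top hc'top) (by simp)).ne
    have hee : c + (e + e) = c' := by
      rw [he, ENNReal.add_halves, add_tsub_cancel_of_le hcc'.le]
    -- Chosen so that `(K * η) ^ (1 / 2) ≤ e`; the added 1 covers `K = 0`.
    have hη : e ^ 2 / (K + 1) ≠ 0 :=
      (ENNReal.div_pos (pow_ne_zero 2 hepos.ne') (by simp [hK])).ne'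
    obtain ⟨U, hUA, hUo, -, hUl⟩ := hAkm.exists_isOpen_sdiff_lt hAkfin hη
    have hKe : (K * lam (U \ Ak)) ^ (1 / 2 : ℝ) ≤ e := by
      calc (K * lam (U \ Ak)) ^ (1 / 2 : ℝ) ≤ (e ^ 2) ^ (1 / 2 : ℝ) := by
            gcongr
            calc K * lam (U \ Ak) ≤ (K + 1) * (e ^ 2 / (K + 1)) := by
                  gcongr
                  exact le_self_add
              _ ≤ e ^ 2 := ENNReal.mul_div_le
        _ = e := by
            rw [← ENNReal.rpow_two, ← ENNReal.rpow_mul]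
            norm_num
    have hUlim : c' < atTop.liminf fun n => (μ n : Measure E) U :=
      (hc'.trans_le (measure_mono hUA)).trans_le
        (ProbabilityMeasure.le_liminf_measure_open_of_tendsto h hUo)
    filter_upwards [hbd', eventually_lt_of_lt_liminf hUlim, hε.eventually_le_const hepos]
      with n h1 h2 h3
    have h4 : c' < (μ n : Measure E) Ak + (e + e) := by
      calc c' < (μ n : Measure E) U := h2
        _ ≤ (μ n : Measure E) Ak + (μ n : Measure E) (U \ Ak) := by
            rw [← Set.union_sdiff_cancel hUA]
            simpa using measure_union_le (μ := (μ n : Measure E)) Ak (U \ Ak)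
        _ ≤ (μ n : Measure E) Ak + (e + e) := by
            gcongr
            exact (h1 _ (hUo.measurableSet.diff hAkm)).trans (add_le_add hKe h3)
    rw [← hee] at h4
    exact (lt_of_add_lt_add_right h4).trans_le (measure_mono Set.inter_subset_left)
  -- The upper bound is the lower bound for the complement, all masses being one.
  refine tendsto_order.2 ⟨hlow A hA, fun c hc => ?_⟩
  rcases lt_or_ge 1 c with hc1 | hc1
  · exact Eventually.of_forall fun n => prob_le_one.trans_lt hc1
  · have h1 : 1 - c < (ν : Measure E) Aᶜ := by
      rw [prob_compl_eq_one_sub hA, lt_tsub_iff_left]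
      calc (ν : Measure E) A + (1 - c) < c + (1 - c) :=
            ENNReal.add_lt_add_right (by simp) hc
        _ = 1 := add_tsub_cancel_of_le hc1
    filter_upwards [hlow _ hA.compl _ h1] with n hn
    by_contra hcon
    rw [prob_compl_eq_one_sub hA] at hn
    exact absurd hn (not_lt.2 (tsub_le_tsub_left (not_lt.1 hcon) 1))

end SetwiseConvergence

/-! ### Measurability and regularity of gradients and Hessians -/

section Derivatives

variable {E : Type*} [NormedAddCommGroup E] [InnerProductSpace ℝ E] [FiniteDimensional ℝ E]
  {Ω : Type*} [MeasurableSpace Ω] {μ : Measure Ω}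

lemma aestronglyMeasurable_clm {V : Type*} [NormedAddCommGroup V] [NormedSpace ℝ V]
    {L : Ω → E →L[ℝ] V} (h : ∀ v, AEStronglyMeasurable (fun x => L x v) μ) :
    AEStronglyMeasurable L μ := by
  let b := stdOrthonormalBasis ℝ E
  have hL : L = fun x => ∑ i, ContinuousLinearMap.smulRightL ℝ E V (innerSL ℝ (b i))
      (L x (b i)) := by
    ext x v
    conv_lhs => rw [← b.sum_repr' v]
    simp
  rw [hL]
  refine Finset.aestronglyMeasurable_fun_sum _ fun i _ => ?_
  exact (ContinuousLinearMap.continuous _).comp_aestronglyMeasurable (h (b i))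

lemma aestronglyMeasurable_fderiv {V : Type*} [NormedAddCommGroup V] [NormedSpace ℝ V]
    {f : E → Ω → V} {θ : E} (hf : ∀ᶠ η in 𝓝 θ, AEStronglyMeasurable (f η) μ)
    (hd : ∀ᵐ x ∂μ, DifferentiableAt ℝ (fun η => f η x) θ) :
    AEStronglyMeasurable (fun x => fderiv ℝ (fun η => f η x) θ) μ := by
  refine aestronglyMeasurable_clm fun v => ?_
  have hlim : Tendsto (fun n : ℕ => θ + (n : ℝ)⁻¹ • v) atTop (𝓝 θ) := by
    have : Tendsto (fun n : ℕ => θ + (n : ℝ)⁻¹ • v) atTop (𝓝 (θ + (0 : ℝ) • v)) :=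
      tendsto_const_nhds.add (tendsto_inv_atTop_nhds_zero_nat.smul_const v)
    simpa using this
  -- Measurability is known only near `θ`, so the difference quotients start at index `N`.
  obtain ⟨N, hN⟩ := eventually_atTop.1 (hlim.eventually hf)
  refine aestronglyMeasurable_of_tendsto_ae atTop
    (f := fun n x => ((n + N : ℕ) : ℝ) • (f (θ + ((n + N : ℕ) : ℝ)⁻¹ • v) x - f θ x))
    (fun n => ((hN _ (by omega)).sub hf.self_of_nhds).const_smul _) ?_
  filter_upwards [hd] with x hx
  have h1 : Tendsto (fun n : ℕ => (n : ℝ) • (f (θ + (n : ℝ)⁻¹ • v) x - f θ x)) atTop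
      (𝓝 (fderiv ℝ (fun η => f η x) θ v)) := by
    refine hx.hasFDerivAt.lim v ?_
    simpa using tendsto_natCast_atTop_atTop
  exact (tendsto_add_atTop_iff_nat N).2 h1

/-- The gradient is a fixed continuous linear image of the derivative, which lets measurability and
smoothness pass from one to the other. -/
lemma gradient_eq_sum (f : E → ℝ) (θ : E) :
    gradient f θ = (∑ i, (ContinuousLinearMap.apply ℝ ℝ (stdOrthonormalBasis ℝ E i)).smulRight
      (stdOrthonormalBasis ℝ E i)) (fderiv ℝ f θ) := by
  rw [← (stdOrthonormalBasis ℝ E).sum_repr' (gradient f θ)]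
  simp

lemma contDiffOn_gradient {f : E → ℝ} {U : Set E} (hU : IsOpen U) (hf : ContDiffOn ℝ 2 f U) :
    ContDiffOn ℝ 1 (gradient f) U := by
  have h := hf.fderiv_of_isOpen hU (m := 1) (by norm_num)
  let D : (E →L[ℝ] ℝ) →L[ℝ] E :=
    ∑ i, (ContinuousLinearMap.apply ℝ ℝ (stdOrthonormalBasis ℝ E i)).smulRight
      (stdOrthonormalBasis ℝ E i)
  have h2 : gradient f = D ∘ fderiv ℝ f := by
    ext1 θ
    exact gradient_eq_sum f θ
  rw [h2]
  exact (ContinuousLinearMap.contDiff _).comp_contDiffOn h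

lemma differentiableAt_gradient {f : E → ℝ} {U : Set E} (hU : IsOpen U) (hf : ContDiffOn ℝ 2 f U)
    {θ : E} (hθ : θ ∈ U) : DifferentiableAt ℝ (gradient f) θ :=
  ((contDiffOn_gradient hU hf).contDiffAt (hU.mem_nhds hθ)).differentiableAt one_ne_zero

lemma continuousOn_fderiv_gradient {f : E → ℝ} {U : Set E} (hU : IsOpen U)
    (hf : ContDiffOn ℝ 2 f U) : ContinuousOn (fderiv ℝ (gradient f)) U :=
  (contDiffOn_gradient hU hf).continuousOn_fderiv_of_isOpen hU le_rfl

lemma inner_fderiv_gradient {f : E → ℝ} {U : Set E} (hU : IsOpen U) (hf : ContDiffOn ℝ 2 f U)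
    {θ : E} (hθ : θ ∈ U) (v w : E) :
    inner ℝ (fderiv ℝ (gradient f) θ v) w = iteratedFDeriv ℝ 2 f θ ![v, w] := by
  have h1 : HasFDerivAt (fun η => inner ℝ (gradient f η) w) _ θ :=
    (differentiableAt_gradient hU hf hθ).hasFDerivAt.inner ℝ (hasFDerivAt_const w θ)
  have h2 : DifferentiableAt ℝ (fderiv ℝ f) θ :=
    ((hf.fderiv_of_isOpen hU (m := 1) (by norm_num)).contDiffAt
      (hU.mem_nhds hθ)).differentiableAt one_ne_zero
  have h3 := h2.hasFDerivAt.clm_apply (hasFDerivAt_const w θ)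
  simp only [inner_gradient_left] at h1
  have h4 := congrArg (fun L => L v) (h1.unique h3)
  rw [iteratedFDeriv_two_apply]
  simpa using h4

lemma norm_fderiv_gradient_le {f : E → ℝ} {U : Set E} (hU : IsOpen U) (hf : ContDiffOn ℝ 2 f U)
    {θ : E} (hθ : θ ∈ U) : ‖fderiv ℝ (gradient f) θ‖ ≤ ‖iteratedFDeriv ℝ 2 f θ‖ := by
  refine ContinuousLinearMap.opNorm_le_bound _ (norm_nonneg _) fun v => ?_
  set z := fderiv ℝ (gradient f) θ v with hz
  rcases eq_or_ne z 0 with h0 | h0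
  · rw [h0, norm_zero]; positivity
  · have h1 : ‖z‖ * ‖z‖ ≤ ‖iteratedFDeriv ℝ 2 f θ‖ * ‖v‖ * ‖z‖ := by
      rw [← real_inner_self_eq_norm_mul_norm]
      nth_rewrite 1 [hz]
      rw [inner_fderiv_gradient hU hf hθ]
      refine (le_abs_self _).trans (((iteratedFDeriv ℝ 2 f θ).le_opNorm _).trans_eq ?_)
      rw [Fin.prod_univ_two]
      simp [mul_assoc]
    exact le_of_mul_le_mul_right h1 (norm_pos_iff.2 h0)

end Derivatives

/-! ### Integrable moduli of continuity -/

section Modulus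

variable {E : Type*} [NormedAddCommGroup E] [SecondCountableTopology E]
  {Ω : Type*} [MeasurableSpace Ω] {μ : Measure Ω} {V : Type*} [NormedAddCommGroup V]

/-- A dominated family of functions depending continuously on a parameter has a modulus of
continuity at a given parameter with arbitrarily small integral. -/
lemma exists_integrable_modulus {F : E → Ω → V} {θ₀ : E} {r : ℝ} (hr : 0 < r) {G : Ω → ℝ}
    (hG : Integrable G μ) (hF : ∀ θ ∈ Metric.ball θ₀ r, AEStronglyMeasurable (F θ) μ)
    (hc : ∀ᵐ x ∂μ, ContinuousOn (fun θ => F θ x) (Metric.ball θ₀ r) ∧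
      ∀ θ ∈ Metric.ball θ₀ r, ‖F θ x‖ ≤ G x) {η : ℝ} (hη : 0 < η) :
    ∃ ρ > 0, ρ ≤ r ∧ ∃ m : Ω → ℝ, Integrable m μ ∧ (∀ x, 0 ≤ m x) ∧ ∫ x, m x ∂μ < η ∧
      ∀ᵐ x ∂μ, ∀ θ ∈ Metric.ball θ₀ ρ, ‖F θ x - F θ₀ x‖ ≤ m x := by
  classical
  let D : ℕ → E := TopologicalSpace.denseSeq E
  let ρ : ℕ → ℝ := fun k => r / (k + 1)
  have hρpos : ∀ k, 0 < ρ k := fun k => by positivity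
  have hρr : ∀ k, ρ k ≤ r := fun k => div_le_self hr.le (by linarith [Nat.cast_nonneg (α := ℝ) k])
  have hρ0 : Tendsto ρ atTop (𝓝 0) := by
    have := (tendsto_const_div_atTop_nhds_zero_nat r).comp (tendsto_add_atTop_nat 1)
    refine this.congr fun k => by simp [ρ]
  -- The supremum runs over a dense sequence to be measurable; continuity in the parameter recovers
  -- the whole ball. It tends to zero as the ball shrinks and is dominated by `2 * G`.
  let M : ℕ → Ω → ENNReal := fun k x =>
    ⨆ j, if D j ∈ Metric.ball θ₀ (ρ k) then ‖F (D j) x - F θ₀ x‖ₑ else 0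
  have hθ₀ : θ₀ ∈ Metric.ball θ₀ r := Metric.mem_ball_self hr
  have hMm : ∀ k, AEMeasurable (M k) μ := fun k => by
    refine AEMeasurable.iSup fun j => ?_
    split_ifs with h
    · exact ((hF _ (Metric.ball_subset_ball (hρr k) h)).sub (hF _ hθ₀)).enorm
    · exact aemeasurable_const
  have hMb : ∀ k, ∀ᵐ x ∂μ, M k x ≤ ENNReal.ofReal (2 * G x) := fun k => by
    filter_upwards [hc] with x hx
    refine iSup_le fun j => ?_
    split_ifs with h
    · rw [← ofReal_norm]
      refine ENNReal.ofReal_le_ofReal ((norm_sub_le _ _).trans ?_)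
      linarith [hx.2 _ (Metric.ball_subset_ball (hρr k) h), hx.2 _ hθ₀]
    · exact zero_le
  have hfin : ∫⁻ x, ENNReal.ofReal (2 * G x) ∂μ ≠ ⊤ := (hG.const_mul 2).lintegral_lt_top.ne
  have hlim : ∀ᵐ x ∂μ, Tendsto (fun k => M k x) atTop (𝓝 0) := by
    filter_upwards [hc] with x hx
    rw [ENNReal.tendsto_nhds_zero]
    intro ε hε
    have h1 : ContinuousAt (fun θ => F θ x) θ₀ := hx.1.continuousAt (Metric.ball_mem_nhds _ hr)
    have h2 : Tendsto (fun θ => ‖F θ x - F θ₀ x‖ₑ) (𝓝 θ₀) (𝓝 0) := by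
      have := (h1.sub (continuousAt_const (y := F θ₀ x))).enorm
      simpa [ContinuousAt] using this
    obtain ⟨δ, hδ, hδ'⟩ := Metric.eventually_nhds_iff_ball.1
      (ENNReal.tendsto_nhds_zero.1 h2 ε hε)
    filter_upwards [hρ0.eventually_le_const hδ] with k hk
    refine iSup_le fun j => ?_
    split_ifs with h
    · exact hδ' _ (Metric.ball_subset_ball hk h)
    · exact zero_le
  have hint := tendsto_lintegral_of_dominated_convergence' _ hMm hMb hfin hlim
  rw [lintegral_zero] at hint
  obtain ⟨k, hk⟩ := (hint.eventually_lt_const (ENNReal.ofReal_pos.2 hη)).exists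
  have hMtop : ∀ᵐ x ∂μ, M k x < ⊤ := by
    filter_upwards [hMb k] with x hx using hx.trans_lt ENNReal.ofReal_lt_top
  refine ⟨ρ k, hρpos k, hρr k, fun x => (M k x).toReal,
    integrable_toReal_of_lintegral_ne_top (hMm k) (hk.trans ENNReal.ofReal_lt_top).ne,
    fun x => ENNReal.toReal_nonneg, ?_, ?_⟩
  · rw [integral_toReal (hMm k) hMtop]
    exact (ENNReal.lt_ofReal_iff_toReal_lt (hk.trans ENNReal.ofReal_lt_top).ne).1 hk
  · filter_upwards [hc, hMtop] with x hx hxtop θ hθ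
    rw [← ENNReal.ofReal_le_iff_le_toReal hxtop.ne, ofReal_norm]
    have hcl : θ ∈ closure (Metric.ball θ₀ (ρ k) ∩ Set.range D) :=
      (TopologicalSpace.denseRange_denseSeq E).open_subset_closure_inter Metric.isOpen_ball hθ
    have hcont : ContinuousWithinAt (fun θ => ‖F θ x - F θ₀ x‖ₑ)
        (Metric.ball θ₀ (ρ k) ∩ Set.range D) θ := by
      have h1 : ContinuousAt (fun θ => F θ x) θ := hx.1.continuousAt
        (Metric.isOpen_ball.mem_nhds (Metric.ball_subset_ball (hρr k) hθ))
      exact ((h1.sub continuousAt_const).enorm).continuousWithinAt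
    have hmaps : Set.MapsTo (fun θ => ‖F θ x - F θ₀ x‖ₑ)
        (Metric.ball θ₀ (ρ k) ∩ Set.range D) (Set.Iic (M k x)) := by
      rintro _ ⟨hb, j, rfl⟩
      refine le_trans ?_ (le_iSup (fun j => if D j ∈ Metric.ball θ₀ (ρ k) then
        ‖F (D j) x - F θ₀ x‖ₑ else 0) j)
      rw [if_pos hb]
    have := hcont.mem_closure hcl hmaps
    rwa [closure_Iic] at this

end Modulus

/-! ### Strong law along the data sequence -/

section LargeNumbers

variable {Ω : Type*} [MeasurableSpace Ω] {F₀ : Measure Ω} [IsProbabilityMeasure F₀]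

lemma ae_infinitePi_forall {p : Ω → Prop} (h : ∀ᵐ x ∂F₀, p x) :
    ∀ᵐ x ∂(Measure.infinitePi fun _ : ℕ => F₀), ∀ i, p (x i) := by
  rw [ae_all_iff]
  intro i
  exact (measurePreserving_eval_infinitePi (fun _ : ℕ => F₀) i).quasiMeasurePreserving.ae h

lemma ae_tendsto_average {V : Type*} [NormedAddCommGroup V] [NormedSpace ℝ V] [CompleteSpace V]
    {f : Ω → V} (hf : Integrable f F₀) :
    ∀ᵐ x ∂(Measure.infinitePi fun _ : ℕ => F₀),
      Tendsto (fun n : ℕ => (n : ℝ)⁻¹ • ∑ i : Fin n, f (x i)) atTop (𝓝 (∫ x, f x ∂F₀)) := by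
  borelize V
  set f' := hf.1.mk f with hf'
  have hfm : StronglyMeasurable f' := hf.1.stronglyMeasurable_mk
  have hff' : f =ᵐ[F₀] f' := hf.1.ae_eq_mk
  have hmp := measurePreserving_eval_infinitePi (fun _ : ℕ => F₀)
  have hint : Integrable (fun x : ℕ → Ω => f' (x 0)) (Measure.infinitePi fun _ : ℕ => F₀) :=
    (hmp 0).integrable_comp_of_integrable (hf.congr hff')
  have hind : iIndepFun (fun (i : ℕ) (x : ℕ → Ω) => f' (x i))
      (Measure.infinitePi fun _ : ℕ => F₀) :=
    iIndepFun_infinitePi (P := fun _ : ℕ => F₀) (X := fun _ => f') fun _ => hfm.measurable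
  have hid : ∀ i, IdentDistrib (fun x : ℕ → Ω => f' (x i)) (fun x : ℕ → Ω => f' (x 0))
      (Measure.infinitePi fun _ : ℕ => F₀) (Measure.infinitePi fun _ : ℕ => F₀) := fun i => by
    refine ⟨(hfm.measurable.comp (measurable_pi_apply i)).aemeasurable,
      (hfm.measurable.comp (measurable_pi_apply 0)).aemeasurable, ?_⟩
    have h : ∀ j, (Measure.infinitePi fun _ : ℕ => F₀).map (fun x : ℕ → Ω => f' (x j)) =
        F₀.map f' := fun j => by
      have := Measure.map_map (μ := Measure.infinitePi fun _ : ℕ => F₀) hfm.measurable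
        (hmp j).measurable
      rw [(hmp j).map_eq] at this
      exact this.symm
    rw [h, h]
  have hlaw := strong_law_ae (fun (i : ℕ) (x : ℕ → Ω) => f' (x i)) hint
    (fun i j hij => hind.indepFun hij) hid
  have hmean : ∫ x : ℕ → Ω, f' (x 0) ∂(Measure.infinitePi fun _ : ℕ => F₀) = ∫ x, f x ∂F₀ := by
    have := integral_map (μ := Measure.infinitePi fun _ : ℕ => F₀) (f := f')
      (hmp 0).measurable.aemeasurable hfm.aestronglyMeasurable
    rw [(hmp 0).map_eq] at this
    rw [integral_congr_ae hff', this]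
  rw [hmean] at hlaw
  filter_upwards [hlaw, ae_infinitePi_forall hff'] with x hx hxf
  refine hx.congr fun n => ?_
  rw [← Fin.sum_univ_eq_sum_range (fun i => f' (x i))]
  simp only [hxf]

lemma ae_hasMean {V : Type*} [NormedAddCommGroup V] [NormedSpace ℝ V] [CompleteSpace V]
    {f : Ω → V} (hf : Integrable f F₀) :
    ∀ᵐ x ∂(Measure.infinitePi fun _ : ℕ => F₀), HasMean (fun i => f (x i)) (∫ x, f x ∂F₀) := by
  filter_upwards [ae_tendsto_average hf, ae_tendsto_average hf.norm] with x hx hx'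
  obtain ⟨C, hC⟩ :=
    (hasMean_of_nonneg (a := fun i => ‖f (x i)‖) (fun i => norm_nonneg _) hx').bounded
  refine ⟨hx, C, fun n => ?_⟩
  simpa only [norm_norm] using hC n

end LargeNumbers

/-! ### Local separation of parameters, after Wald -/

section Separation

variable {E : Type*} {Ω : Type*} [MeasurableSpace Ω] {F₀ : Measure Ω}

/-- The Lebesgue integral in `[0, ∞]` is a supremum over simple functions below `f`, i.e. a lower
integral, so `f` need not be measurable. -/
lemma exists_integrable_le_of_lt_lintegral [IsFiniteMeasure F₀] {f : Ω → ENNReal} {c : ENNReal}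
    (h : c < ∫⁻ x, f x ∂F₀) :
    ∃ φ : Ω → ℝ, Integrable φ F₀ ∧ (∀ x, 0 ≤ φ x) ∧ (∀ x, ENNReal.ofReal (φ x) ≤ f x) ∧
      c < ENNReal.ofReal (∫ x, φ x ∂F₀) := by
  rw [lintegral_eq_nnreal] at h
  obtain ⟨φ, hφ⟩ := lt_iSup_iff.1 h
  obtain ⟨hφf, hφ⟩ := lt_iSup_iff.1 hφ
  have hint : Integrable (fun x => (φ x : ℝ)) F₀ :=
    (SimpleFunc.integrable_of_isFiniteMeasure (φ.map ((↑) : NNReal → ℝ)))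
  refine ⟨fun x => φ x, hint, fun x => (φ x).2, fun x => ?_, ?_⟩
  · simpa using hφf x
  · rw [ofReal_integral_eq_lintegral_ofReal hint (ae_of_all _ fun x => (φ x).2)]
    rw [← SimpleFunc.lintegral_eq_lintegral] at hφ
    simpa using hφ

/-- The parameters in `V` are separated from `θ₀`: the loss on `V` has a lower bound whose
expectation exceeds the expected loss of `θ₀`. -/
def IsSeparated (Θ : Set E) (ℓ : E → Ω → ℝ) (F₀ : Measure Ω) (θ₀ : E) (V : Set E) : Prop :=
  Integrable (ℓ θ₀) F₀ ∧ ∃ φ : Ω → ℝ, Integrable φ F₀ ∧ ∫ x, ℓ θ₀ x ∂F₀ < ∫ x, φ x ∂F₀ ∧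
    ∀ᵐ x ∂F₀, ∀ θ ∈ V ∩ Θ, φ x ≤ ℓ θ x

lemma isSeparated_of_lt_lintegral [IsFiniteMeasure F₀] {Θ : Set E} {ℓ : E → Ω → ℝ} {θ₀ : E}
    (hθ₀ : θ₀ ∈ Θ) (hnn : ∀ θ ∈ Θ, ∀ x, 0 ≤ ℓ θ x) (hm : ∀ θ ∈ Θ, Measurable (ℓ θ)) {V : Set E}
    {f : Ω → ENNReal} (hf : ∀ᵐ x ∂F₀, ∀ θ ∈ V ∩ Θ, f x ≤ ENNReal.ofReal (ℓ θ x))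
    (h : ∫⁻ x, ENNReal.ofReal (ℓ θ₀ x) ∂F₀ < ∫⁻ x, f x ∂F₀) : IsSeparated Θ ℓ F₀ θ₀ V := by
  have hint : Integrable (ℓ θ₀) F₀ := by
    refine ⟨(hm θ₀ hθ₀).aestronglyMeasurable, ?_⟩
    rw [hasFiniteIntegral_iff_ofReal (ae_of_all _ fun x => hnn θ₀ hθ₀ x)]
    exact h.trans_le le_top
  obtain ⟨φ, hφ, hφ0, hφf, hlt⟩ := exists_integrable_le_of_lt_lintegral h
  refine ⟨hint, φ, hφ, ?_, ?_⟩
  · rw [← ofReal_integral_eq_lintegral_ofReal hint (ae_of_all _ fun x => hnn θ₀ hθ₀ x)] at hlt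
    exact (ENNReal.ofReal_lt_ofReal_iff_of_nonneg (integral_nonneg fun x => hnn θ₀ hθ₀ x)).1 hlt
  · filter_upwards [hf] with x hx θ hθ
    exact (ENNReal.ofReal_le_ofReal_iff (hnn θ hθ.2 x)).1 ((hφf x).trans (hx θ hθ))

/-- As balls around `θ₁` shrink, the infimum of the loss over them increases to at least the loss at
`θ₁`, by continuity. Monotone convergence makes some ball suffice; a countable dense subset of `Θ`
keeps the infima measurable. -/
lemma exists_nhds_isSeparated [NormedAddCommGroup E] [SecondCountableTopology E]
    [IsFiniteMeasure F₀] {Θ : Set E} {ℓ : E → Ω → ℝ} {θ₀ θ₁ : E} (hθ₀ : θ₀ ∈ Θ) (hθ₁ : θ₁ ∈ Θ)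
    (hnn : ∀ θ ∈ Θ, ∀ x, 0 ≤ ℓ θ x) (hm : ∀ θ ∈ Θ, Measurable (ℓ θ))
    (hc : ∀ᵐ x ∂F₀, ContinuousOn (fun θ => ℓ θ x) Θ)
    (h : ∫⁻ x, ENNReal.ofReal (ℓ θ₀ x) ∂F₀ < ∫⁻ x, ENNReal.ofReal (ℓ θ₁ x) ∂F₀) :
    ∃ V ∈ 𝓝 θ₁, IsSeparated Θ ℓ F₀ θ₀ V := by
  classical
  obtain ⟨s, hs, hsd⟩ := TopologicalSpace.exists_countable_dense Θ
  have : Countable s := hs.to_subtype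
  let V : ℕ → Set E := fun k => Metric.ball θ₁ (1 / (k + 1))
  let f : ℕ → Ω → ENNReal := fun k x =>
    ⨅ t : s, if (t : E) ∈ V k then ENNReal.ofReal (ℓ t x) else ⊤
  have hfm : ∀ k, Measurable (f k) := fun k => by
    refine Measurable.iInf fun t => ?_
    split_ifs
    · exact (hm _ (t : Θ).2).ennreal_ofReal
    · exact measurable_const
  have hVanti : ∀ k l, k ≤ l → V l ⊆ V k := fun k l hkl =>
    Metric.ball_subset_ball (one_div_le_one_div_of_le (by positivity) (by gcongr))
  have hmono : Monotone f := fun k l hkl x => by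
    refine iInf_mono fun t => ?_
    split_ifs with h1 h2 h2
    · exact le_rfl
    · exact le_top
    · exact absurd (hVanti k l hkl h2) h1
    · exact le_rfl
  have hsup : ∀ᵐ x ∂F₀, ENNReal.ofReal (ℓ θ₁ x) ≤ ⨆ k, f k x := by
    filter_upwards [hc] with x hx
    refine le_of_forall_lt fun c hcx => ?_
    obtain ⟨c', hcc', hc'⟩ := exists_between hcx
    have h1 : ContinuousWithinAt (fun θ => ENNReal.ofReal (ℓ θ x)) Θ θ₁ :=
      (ENNReal.continuous_ofReal.tendsto _).comp (hx θ₁ hθ₁)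
    have h2 := h1.eventually_const_lt hc'
    rw [eventually_nhdsWithin_iff, Metric.eventually_nhds_iff_ball] at h2
    obtain ⟨δ, hδ, h3⟩ := h2
    obtain ⟨k, hk⟩ := exists_nat_one_div_lt hδ
    refine hcc'.trans_le (le_trans ?_ (le_iSup (fun k => f k x) k))
    refine le_iInf fun t => ?_
    split_ifs with h4
    · exact (h3 _ (Metric.ball_subset_ball hk.le h4) (t : Θ).2).le
    · exact le_top
  have hlt : ∫⁻ x, ENNReal.ofReal (ℓ θ₀ x) ∂F₀ < ⨆ k, ∫⁻ x, f k x ∂F₀ := by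
    rw [← lintegral_iSup hfm hmono]
    exact h.trans_le (lintegral_mono_ae hsup)
  obtain ⟨k, hk⟩ := lt_iSup_iff.1 hlt
  refine ⟨V k, Metric.ball_mem_nhds _ (by positivity), ?_⟩
  refine isSeparated_of_lt_lintegral hθ₀ hnn hm (f := f k) ?_ hk
  filter_upwards [hc] with x hx θ hθ
  have hopen : IsOpen ((↑) ⁻¹' V k : Set Θ) := Metric.isOpen_ball.preimage continuous_subtype_val
  have hcl : (⟨θ, hθ.2⟩ : Θ) ∈ closure (((↑) ⁻¹' V k : Set Θ) ∩ s) :=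
    hsd.open_subset_closure_inter hopen hθ.1
  have hcont : Continuous fun t : Θ => ENNReal.ofReal (ℓ t x) :=
    ENNReal.continuous_ofReal.comp hx.domRestrict
  have hmaps : Set.MapsTo (fun t : Θ => ENNReal.ofReal (ℓ t x)) (((↑) ⁻¹' V k : Set Θ) ∩ s)
      (Set.Ici (f k x)) := by
    rintro t ⟨h1, h2⟩
    refine (iInf_le (fun t : s => if (t : E) ∈ V k then ENNReal.ofReal (ℓ t x) else ⊤)
      ⟨t, h2⟩).trans ?_
    rw [if_pos]
    exact h1
  have := hcont.continuousWithinAt.mem_closure hcl hmaps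
  rwa [closure_Ici] at this

end Separation

/-! ### Consistency of weighted minimisers -/

section Consistency

variable {d : ℕ} {Ω : Type*} {Θ : Set (EuclideanSpace ℝ (Fin d))}
  {ℓ : EuclideanSpace ℝ (Fin d) → Ω → ℝ} {θ₀ : EuclideanSpace ℝ (Fin d)}

/-- Along the sequence `x`, the parameters in `V` have a larger average loss than `θ₀`. -/
def IsSeparatedAlong (Θ : Set (EuclideanSpace ℝ (Fin d))) (ℓ : EuclideanSpace ℝ (Fin d) → Ω → ℝ)
    (θ₀ : EuclideanSpace ℝ (Fin d)) (x : ℕ → Ω) (V : Set (EuclideanSpace ℝ (Fin d))) : Prop :=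
  ∃ (φ : ℕ → ℝ) (c c₀ : ℝ), HasMean φ c ∧ HasMean (fun i => ℓ θ₀ (x i)) c₀ ∧ c₀ < c ∧
    ∀ i, ∀ θ ∈ V ∩ Θ, φ i ≤ ℓ θ (x i)

/-- Consistency of weighted minimisers, for weights that average out. -/
theorem tendsto_of_isWeightedMinimizer {x : ℕ → Ω} (hθ₀ : θ₀ ∈ Θ)
    (hx : ∀ ρ > 0, ∃ 𝒱 : Set (Set (EuclideanSpace ℝ (Fin d))), 𝒱.Finite ∧
      Θ \ Metric.ball θ₀ ρ ⊆ ⋃₀ 𝒱 ∧ ∀ V ∈ 𝒱, IsSeparatedAlong Θ ℓ θ₀ x V)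
    {Q : Type*} {l : Filter Q} {w : Q → Σ n, Fin n → ℝ} (hw : IsAveraging l w)
    (hw0 : ∀ᶠ q in l, ∀ i, 0 ≤ (w q).2 i) {θ : Q → EuclideanSpace ℝ (Fin d)}
    (hθ : ∀ᶠ q in l, IsWeightedMinimizer Θ ℓ (w q).2 (fun i => x i) (θ q)) :
    Tendsto θ l (𝓝 θ₀) := by
  rw [Metric.nhds_basis_ball.tendsto_right_iff]
  intro ρ hρ
  obtain ⟨𝒱, h𝒱, hcov, hsep⟩ := hx ρ hρ
  -- A minimiser in `V` would have weighted loss at least that of `φ`, which eventually exceeds the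
  -- weighted loss of `θ₀`.
  have h1 : ∀ V ∈ 𝒱, ∀ᶠ q in l, θ q ∉ V := fun V hV => by
    obtain ⟨φ, c, c₀, hφ, hℓ, hlt, hle⟩ := hsep V hV
    filter_upwards [(hw _ _ hℓ).eventually_lt (hw _ _ hφ) hlt, hw0, hθ] with q h2 h3 h4 h5
    have h6 : ∑ i, (w q).2 i * φ i ≤ ∑ i, (w q).2 i * ℓ (θ q) (x i) :=
      Finset.sum_le_sum fun i _ => mul_le_mul_of_nonneg_left (hle i _ ⟨h5, h4.1⟩) (h3 i)
    have h7 : ∑ i, (w q).2 i * ℓ (θ q) (x i) ≤ ∑ i, (w q).2 i * ℓ θ₀ (x i) := h4.2 hθ₀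
    linarith
  filter_upwards [(eventually_all_finite h𝒱).2 h1, hθ] with q h2 h3
  by_contra h4
  obtain ⟨V, hV, hqV⟩ := hcov ⟨h3.1, h4⟩
  exact h2 V hV hqV

variable [MeasurableSpace Ω] {F₀ : Measure Ω}

lemma RegularLoss.mem (hreg : RegularLoss Θ ℓ F₀ θ₀) : θ₀ ∈ Θ := by
  obtain ⟨r, hr, hrΘ, -⟩ := hreg.smooth
  exact hrΘ (Metric.mem_ball_self hr)

variable [IsProbabilityMeasure F₀]

/-- The sets of `at_infinity` cover the part outside `K`; compactness of `K` minus the open ball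
leaves finitely many local neighbourhoods. -/
lemma RegularLoss.exists_separated_cover (hreg : RegularLoss Θ ℓ F₀ θ₀) {ρ : ℝ} (hρ : 0 < ρ) :
    ∃ 𝒱 : Set (Set (EuclideanSpace ℝ (Fin d))), 𝒱.Finite ∧ Θ \ Metric.ball θ₀ ρ ⊆ ⋃₀ 𝒱 ∧
      ∀ V ∈ 𝒱, IsSeparated Θ ℓ F₀ θ₀ V := by
  obtain ⟨K, hKΘ, hK, 𝒰, h𝒰, hcov, h𝒰sep⟩ := hreg.at_infinity
  have hloc : ∀ θ ∈ K \ Metric.ball θ₀ ρ, ∃ V ∈ 𝓝 θ, IsSeparated Θ ℓ F₀ θ₀ V := fun θ hθ => by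
    refine exists_nhds_isSeparated hreg.mem (hKΘ hθ.1) hreg.nonneg hreg.measurable
      hreg.continuousOn (hreg.unique_min θ (hKΘ hθ.1) ?_)
    rintro rfl
    exact hθ.2 (Metric.mem_ball_self hρ)
  choose! V hV hVsep using hloc
  obtain ⟨t, ht, htcov⟩ := (hK.diff Metric.isOpen_ball).elim_nhds_subcover V hV
  refine ⟨𝒰 ∪ V '' t, h𝒰.union (t.finite_toSet.image V), fun θ hθ => ?_, ?_⟩
  · by_cases hθK : θ ∈ K
    · obtain ⟨s, hs, hθs⟩ := Set.mem_iUnion₂.1 (htcov ⟨hθK, hθ.2⟩)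
      exact ⟨V s, Or.inr ⟨s, hs, rfl⟩, hθs⟩
    · obtain ⟨U, hU, hθU⟩ := hcov ⟨hθ.1, hθK⟩
      exact ⟨U, Or.inl hU, hθU⟩
  · rintro U (hU | ⟨s, hs, rfl⟩)
    · refine isSeparated_of_lt_lintegral hreg.mem hreg.nonneg hreg.measurable
        (f := fun x => ⨅ θ ∈ U, ENNReal.ofReal (ℓ θ x)) (ae_of_all _ fun x θ hθ => ?_) (h𝒰sep U hU)
      exact iInf₂_le θ hθ.1
    · exact hVsep s (ht s hs)

lemma RegularLoss.ae_exists_separated_cover (hreg : RegularLoss Θ ℓ F₀ θ₀) :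
    ∀ᵐ x ∂(Measure.infinitePi fun _ : ℕ => F₀), ∀ ρ > 0,
      ∃ 𝒱 : Set (Set (EuclideanSpace ℝ (Fin d))), 𝒱.Finite ∧ Θ \ Metric.ball θ₀ ρ ⊆ ⋃₀ 𝒱 ∧
        ∀ V ∈ 𝒱, IsSeparatedAlong Θ ℓ θ₀ x V := by
  have h : ∀ k : ℕ, ∀ᵐ x ∂(Measure.infinitePi fun _ : ℕ => F₀),
      ∃ 𝒱 : Set (Set (EuclideanSpace ℝ (Fin d))), 𝒱.Finite ∧
        Θ \ Metric.ball θ₀ (1 / (k + 1)) ⊆ ⋃₀ 𝒱 ∧ ∀ V ∈ 𝒱, IsSeparatedAlong Θ ℓ θ₀ x V :=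
      fun k => by
    obtain ⟨𝒱, h𝒱, hcov, hsep⟩ := hreg.exists_separated_cover (ρ := 1 / (k + 1)) (by positivity)
    have h1 : ∀ V ∈ 𝒱, ∀ᵐ x ∂(Measure.infinitePi fun _ : ℕ => F₀),
        IsSeparatedAlong Θ ℓ θ₀ x V := fun V hV => by
      obtain ⟨hint, φ, hφ, hlt, hle⟩ := hsep V hV
      filter_upwards [ae_hasMean hint, ae_hasMean hφ, ae_infinitePi_forall hle] with x h1 h2 h3
      exact ⟨fun i => φ (x i), _, _, h2, h1, hlt, h3⟩
    filter_upwards [(ae_ball_iff h𝒱.countable).2 h1] with x hx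
    exact ⟨𝒱, h𝒱, hcov, hx⟩
  filter_upwards [ae_all_iff.2 h] with x hx ρ hρ
  obtain ⟨k, hk⟩ := exists_nat_one_div_lt hρ
  obtain ⟨𝒱, h𝒱, hcov, hsep⟩ := hx k
  exact ⟨𝒱, h𝒱, (Set.sdiff_subset_sdiff_right (Metric.ball_subset_ball hk.le)).trans hcov, hsep⟩

end Consistency

/-! ### Weighted averages at a converging parameter -/

section Modulus

/-- A sequence of functions of a parameter with a dominating sequence near `θ₀` that has arbitrarily
small mean. -/
def HasSmallModulus {E V : Type*} [NormedAddCommGroup E] [NormedAddCommGroup V] (F : ℕ → E → V)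
    (θ₀ : E) : Prop :=
  ∀ η > 0, ∃ ρ > 0, ∃ (m : ℕ → ℝ) (c : ℝ), HasMean m c ∧ c < η ∧
    ∀ i, ∀ θ ∈ Metric.ball θ₀ ρ, ‖F i θ - F i θ₀‖ ≤ m i

lemma tendsto_of_hasSmallModulus {E V Q : Type*} [NormedAddCommGroup E] [NormedAddCommGroup V]
    [NormedSpace ℝ V] [FiniteDimensional ℝ V] {l : Filter Q} {w : Q → Σ n, Fin n → ℝ}
    {F : ℕ → E → V} {θ₀ : E} (hF : HasSmallModulus F θ₀) {m : V}
    (hm : HasMean (fun i => F i θ₀) m) (hw : IsAveraging l w) (hw0 : ∀ᶠ q in l, ∀ i, 0 ≤ (w q).2 i)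
    {θ : Q → E} (hθ : Tendsto θ l (𝓝 θ₀)) :
    Tendsto (fun q => ∑ i, (w q).2 i • F i (θ q)) l (𝓝 m) := by
  suffices h : Tendsto (fun q => ∑ i, (w q).2 i • F i (θ q) - ∑ i, (w q).2 i • F i θ₀) l (𝓝 0) by
    simpa using h.add (hw.tendsto hm)
  rw [Metric.nhds_basis_ball.tendsto_right_iff]
  intro η hη
  obtain ⟨ρ, hρ, b, c, hb, hc, hle⟩ := hF η hη
  filter_upwards [hθ (Metric.ball_mem_nhds _ hρ), hw0, (hw _ _ hb).eventually_lt_const hc]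
    with q h1 h2 h3
  rw [mem_ball_zero_iff, ← Finset.sum_sub_distrib]
  refine lt_of_le_of_lt (norm_sum_le_of_le _ fun i _ => ?_) h3
  rw [← smul_sub, norm_smul, Real.norm_of_nonneg (h2 i)]
  exact mul_le_mul_of_nonneg_left (hle i _ h1) (h2 i)

end Modulus

/-! ### Linearisation of the weighted gradient -/

section Linearization

variable {E : Type*} [NormedAddCommGroup E] [InnerProductSpace ℝ E]

/-- The rank one operator `v vᵀ`. -/
noncomputable def outer (v : E) : E →L[ℝ] E := (innerSL ℝ v).smulRight v

lemma outer_apply (v t : E) : outer v t = inner ℝ v t • v := rfl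

lemma inner_outer_apply (v t : E) : inner ℝ (outer v t) t = inner ℝ v t ^ 2 := by
  rw [outer_apply, real_inner_smul_left, sq]

lemma norm_outer (v : E) : ‖outer v‖ = ‖v‖ ^ 2 := by
  rw [outer, ContinuousLinearMap.norm_smulRight_apply, innerSL_apply_norm, sq]

lemma continuous_outer : Continuous (outer : E → E →L[ℝ] E) :=
  ((ContinuousLinearMap.smulRightL ℝ E E).continuous.comp (innerSL ℝ).continuous).clm_apply
    continuous_id

/-- A sequence of gradients `g i`, dominated on a ball around `θ₀`, whose derivatives and outer
products have means `J` and `S`. -/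
structure RegularGradients (g : ℕ → E → E) (θ₀ : E) (r : ℝ) (G : ℕ → ℝ) (J S M : E →L[ℝ] E) :
    Prop where
  pos : 0 < r
  differentiableAt : ∀ i, ∀ θ ∈ Metric.ball θ₀ r, DifferentiableAt ℝ (g i) θ
  norm_sq_le : ∀ i, ∀ θ ∈ Metric.ball θ₀ r, ‖g i θ‖ ^ 2 ≤ G i
  norm_fderiv_le : ∀ i, ∀ θ ∈ Metric.ball θ₀ r, ‖fderiv ℝ (g i) θ‖ ≤ G i
  mean_dominating : ∃ c, HasMean G c
  mean_hessian : HasMean (fun i => fderiv ℝ (g i) θ₀) J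
  mean_outer : HasMean (fun i => outer (g i θ₀)) S
  mean_normalized : HasMean (fun i => (1 + ‖g i θ₀‖)⁻¹ • outer (g i θ₀)) M
  modulus_hessian : HasSmallModulus (fun i => fderiv ℝ (g i)) θ₀
  modulus_outer : HasSmallModulus (fun i θ => outer (g i θ)) θ₀

variable [FiniteDimensional ℝ E] {Q : Type*} {l : Filter Q} {w : Q → Σ n, Fin n → ℝ}

/-- The mean value inequality bounds each Taylor remainder by the Hessian modulus `m i` times `‖θ -
θ'‖`. The weighted moduli have a limit below η/2, and the weighted Hessians at `θ₀` tend to `J`. -/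
lemma RegularGradients.isLittleO {g : ℕ → E → E} {θ₀ : E} {r : ℝ} {G : ℕ → ℝ}
    {J S M : E →L[ℝ] E} (hg : RegularGradients g θ₀ r G J S M) (hw : IsAveraging l w)
    (hw0 : ∀ᶠ q in l, ∀ i, 0 ≤ (w q).2 i) {θ θ' : Q → E} (hθ : Tendsto θ l (𝓝 θ₀))
    (hθ' : Tendsto θ' l (𝓝 θ₀)) :
    (fun q => ∑ i, (w q).2 i • g i (θ q) - ∑ i, (w q).2 i • g i (θ' q) - J (θ q - θ' q)) =o[l]
      (fun q => θ q - θ' q) := by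
  rw [Asymptotics.isLittleO_iff]
  intro η hη
  obtain ⟨ρ, hρ, m, c, hm, hc, hle⟩ := hg.modulus_hessian (η / 2) (half_pos hη)
  have hρr : 0 < min ρ r := lt_min hρ hg.pos
  have hJ : Tendsto (fun q => ∑ i, (w q).2 i • fderiv ℝ (g i) θ₀ - J) l (𝓝 0) := by
    simpa using (hw.tendsto hg.mean_hessian).sub_const J
  filter_upwards [hθ (Metric.ball_mem_nhds _ hρr), hθ' (Metric.ball_mem_nhds _ hρr), hw0,
    (hw _ _ hm).eventually_lt_const hc, hJ (Metric.ball_mem_nhds _ (half_pos hη))]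
    with q h1 h2 h3 h4 h5
  rw [Set.mem_preimage, mem_ball_zero_iff] at h5
  have hsub1 : Metric.ball θ₀ (min ρ r) ⊆ Metric.ball θ₀ ρ :=
    Metric.ball_subset_ball (min_le_left _ _)
  have hsub2 : Metric.ball θ₀ (min ρ r) ⊆ Metric.ball θ₀ r :=
    Metric.ball_subset_ball (min_le_right _ _)
  have hmv : ∀ i, ‖g i (θ q) - g i (θ' q) - fderiv ℝ (g i) θ₀ (θ q - θ' q)‖ ≤
      m i * ‖θ q - θ' q‖ := fun i =>
    (convex_ball θ₀ (min ρ r)).norm_image_sub_le_of_norm_hasFDerivWithin_le'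
      (fun η hη => (hg.differentiableAt i η (hsub2 hη)).hasFDerivAt.hasFDerivWithinAt)
      (fun η hη => hle i η (hsub1 hη)) h2 h1
  have heq : ∑ i, (w q).2 i • g i (θ q) - ∑ i, (w q).2 i • g i (θ' q) - J (θ q - θ' q) =
      ∑ i, (w q).2 i • (g i (θ q) - g i (θ' q) - fderiv ℝ (g i) θ₀ (θ q - θ' q)) +
        (∑ i, (w q).2 i • fderiv ℝ (g i) θ₀ - J) (θ q - θ' q) := by
    simp only [smul_sub, Finset.sum_sub_distrib, sub_apply,
      sum_apply, smul_apply]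
    abel
  rw [heq]
  calc _ ≤ ‖∑ i, (w q).2 i • (g i (θ q) - g i (θ' q) - fderiv ℝ (g i) θ₀ (θ q - θ' q))‖ +
        ‖(∑ i, (w q).2 i • fderiv ℝ (g i) θ₀ - J) (θ q - θ' q)‖ := norm_add_le _ _
    _ ≤ (∑ i, (w q).2 i * m i) * ‖θ q - θ' q‖ + η / 2 * ‖θ q - θ' q‖ := by
        refine add_le_add ?_ ((ContinuousLinearMap.le_opNorm _ _).trans ?_)
        · rw [Finset.sum_mul]
          refine norm_sum_le_of_le _ fun i _ => ?_
          rw [norm_smul, Real.norm_of_nonneg (h3 i), mul_assoc]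
          exact mul_le_mul_of_nonneg_left (hmv i) (h3 i)
        · gcongr
    _ ≤ η / 2 * ‖θ q - θ' q‖ + η / 2 * ‖θ q - θ' q‖ := by gcongr
    _ = η * ‖θ q - θ' q‖ := by ring

/-- The difference between a zero `θ` of the weighted gradient and any other consistent sequence
`θ'` is approximately linear in the weighted gradient at `θ'`. -/
lemma RegularGradients.isLittleO_zero {g : ℕ → E → E} {θ₀ : E} {r : ℝ} {G : ℕ → ℝ}
    {J S M : E →L[ℝ] E} (hg : RegularGradients g θ₀ r G J S M) {J' : E →L[ℝ] E}
    (hJ' : ∀ v, J' (J v) = v) (hw : IsAveraging l w)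
    (hw0 : ∀ᶠ q in l, ∀ i, 0 ≤ (w q).2 i) {θ θ' : Q → E} (hθ : Tendsto θ l (𝓝 θ₀))
    (hθ' : Tendsto θ' l (𝓝 θ₀)) (hz : ∀ᶠ q in l, ∑ i, (w q).2 i • g i (θ q) = 0) :
    (fun q => θ q - θ' q + J' (∑ i, (w q).2 i • g i (θ' q))) =o[l]
      (fun q => ∑ i, (w q).2 i • g i (θ' q)) := by
  have h1 : (fun q => θ q - θ' q + J' (∑ i, (w q).2 i • g i (θ' q))) =o[l]
      (fun q => θ q - θ' q) := by
    have h2 := ((-J').isBigO_comp (fun q => ∑ i, (w q).2 i • g i (θ q) -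
      ∑ i, (w q).2 i • g i (θ' q) - J (θ q - θ' q)) l).trans_isLittleO
      (hg.isLittleO hw hw0 hθ hθ')
    refine h2.congr' ?_ EventuallyEq.rfl
    filter_upwards [hz] with q hq
    rw [hq]
    simp only [zero_sub, neg_apply, map_sub, map_neg, hJ']
    abel
  -- Since the error in `h1` is small relative to `θ - θ'` itself, `θ - θ'` is of the order of the
  -- linear term, and the error may be measured against the latter.
  have h3 : (fun q => θ q - θ' q) =O[l] (fun q => J' (∑ i, (w q).2 i • g i (θ' q))) := by
    rw [← Asymptotics.isBigO_neg_right]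
    refine h1.right_isBigO_sub.congr_right fun q => ?_
    abel
  exact h1.trans_isBigO (h3.trans (J'.isBigO_comp _ _))

end Linearization

/-! ### Interior minimisers are stationary -/

section Stationarity

variable {d : ℕ} {Ω : Type*} {Θ : Set (EuclideanSpace ℝ (Fin d))}
  {ℓ : EuclideanSpace ℝ (Fin d) → Ω → ℝ}

lemma IsWeightedMinimizer.sum_gradient_eq_zero {n : ℕ} {w : Fin n → ℝ} {x : Fin n → Ω}
    {θ : EuclideanSpace ℝ (Fin d)} (h : IsWeightedMinimizer Θ ℓ w x θ) (hΘ : Θ ∈ 𝓝 θ)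
    (hd : ∀ i, DifferentiableAt ℝ (fun η => ℓ η (x i)) θ) :
    ∑ i, w i • gradient (fun η => ℓ η (x i)) θ = 0 := by
  have h1 : IsLocalMin (weightedLoss ℓ w x) θ := h.2.isLocalMin hΘ
  have h2 : HasFDerivAt (weightedLoss ℓ w x)
      (∑ i, w i • fderiv ℝ (fun η => ℓ η (x i)) θ) θ :=
    HasFDerivAt.fun_sum fun i _ => (hd i).hasFDerivAt.const_mul (w i)
  have h3 := h1.hasFDerivAt_eq_zero h2
  refine ext_inner_right ℝ fun v => ?_
  have h4 := congrArg (fun L => L v) h3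
  simpa [sum_inner, inner_smul_left, inner_gradient_left] using h4

end Stationarity

/-! ### Asymptotic normality -/

section Limit

variable {E : Type*} [NormedAddCommGroup E] [InnerProductSpace ℝ E] [FiniteDimensional ℝ E]
  [MeasurableSpace E] [BorelSpace E] {W : ℕ → Type*} [∀ n, MeasurableSpace (W n)]
  {P : (n : ℕ) → Measure (W n)} {w : (n : ℕ) → W n → Fin n → ℝ}

lemma isAveraging_of_hasLaw
    (hw : ∀ n, HasLaw (w n) (dirichletMeasure fun _ : Fin n => (1 : ℝ)) (P n)) :
    IsAveraging (inProb P) (fun q => ⟨q.1, w q.1 q.2⟩) := by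
  have h := tendsto_map_inProb P (f := w) fun n => (hw n).aemeasurable
  simp only [fun n => (hw n).map_eq] at h
  exact isAveraging_dirichlet.comp h

lemma ae_dirichlet_nonneg (n : ℕ) :
    ∀ᵐ v ∂dirichletMeasure (fun _ : Fin n => (1 : ℝ)), ∀ i, 0 ≤ v i := by
  rw [dirichletMeasure_one, ae_map_iff (measurable_normalize n).aemeasurable]
  · filter_upwards [ae_expSample_pos n] with y hy i
    exact div_nonneg (hy i).le (Finset.sum_nonneg fun j _ => (hy j).le)
  · exact measurableSet_le measurable_const measurable_id |>.congr (by rfl)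

lemma eventually_nonneg_of_hasLaw
    (hw : ∀ n, HasLaw (w n) (dirichletMeasure fun _ : Fin n => (1 : ℝ)) (P n)) :
    ∀ᶠ q in inProb P, ∀ i, 0 ≤ w q.1 q.2 i := by
  refine eventually_inProb_of_ae (p := fun q => ∀ i, 0 ≤ w q.1 q.2 i)
    (Eventually.of_forall fun n => ?_)
  have := ae_dirichlet_nonneg n
  rw [← (hw n).map_eq] at this
  exact ae_of_ae_map (hw n).aemeasurable this

/-- Asymptotic normality of the bootstrap draw around the empirical minimiser, in terms of
characteristic functions. -/
theorem RegularGradients.tendsto_charFun [∀ n, IsProbabilityMeasure (P n)] {g : ℕ → E → E}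
    {θ₀ : E} {r : ℝ} {G : ℕ → ℝ} {J S M : E →L[ℝ] E} (hg : RegularGradients g θ₀ r G J S M)
    {J' : E →L[ℝ] E} (hJ' : ∀ v, J' (J v) = v) (hsymm : ∀ v u, inner ℝ (J' v) u = inner ℝ v (J' u))
    (hw : ∀ n, HasLaw (w n) (dirichletMeasure fun _ : Fin n => (1 : ℝ)) (P n))
    {θ : (n : ℕ) → W n → E} {θ' : ℕ → E} (hm : ∀ n, AEMeasurable (θ n) (P n))
    (hθ : Tendsto (fun q : Σ n, W n => θ q.1 q.2) (inProb P) (𝓝 θ₀))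
    (hθ' : Tendsto θ' atTop (𝓝 θ₀))
    (hz : ∀ᶠ q : Σ n, W n in inProb P, ∑ i, w q.1 q.2 i • g i (θ q.1 q.2) = 0)
    (hz' : ∀ᶠ n : ℕ in atTop, ∑ i : Fin n, g i (θ' n) = 0) (t : E) :
    Tendsto (fun n : ℕ => charFun ((P n).map fun ω => √(n : ℝ) • (θ n ω - θ' n)) t) atTop
      (𝓝 (Complex.exp (-(inner ℝ (S (J' t)) (J' t) : ℝ) / 2))) := by
  have : SecondCountableTopology E := secondCountable_of_proper
  -- The weighted gradient at the empirical minimiser, rescaled; the rescaled draw is `-J' Z` up to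
  -- a negligible error.
  let Z : (Σ n, W n) → E := fun q => √(q.1 : ℝ) • ∑ i, w q.1 q.2 i • g i (θ' q.1)
  have hF : ∀ n, Measurable fun v : Fin n → ℝ => √(n : ℝ) • ∑ i, v i • g i (θ' n) := fun n => by
    fun_prop
  have hZm : ∀ n, AEMeasurable (fun ω => Z ⟨n, ω⟩) (P n) := fun n =>
    (hF n).comp_aemeasurable (hw n).aemeasurable
  have hZlaw : ∀ n, (P n).map (fun ω => Z ⟨n, ω⟩) =
      (dirichletMeasure fun _ : Fin n => (1 : ℝ)).map
        fun v : Fin n → ℝ => √(n : ℝ) • ∑ i, v i • g i (θ' n) := fun n => by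
    rw [← (hw n).map_eq, AEMeasurable.map_map_of_aemeasurable (hF n).aemeasurable
      (hw n).aemeasurable]
    rfl
  have hout : Tendsto (fun n : ℕ => ∑ i : Fin n, (n : ℝ)⁻¹ • outer (g i (θ' n))) atTop (𝓝 S) :=
    tendsto_of_hasSmallModulus hg.modulus_outer hg.mean_outer isAveraging_uniform
      (Eventually.of_forall fun n i => by positivity) hθ'
  obtain ⟨c, hc⟩ := hg.mean_dominating
  have hZ : ∀ t, Tendsto (fun n => charFun ((P n).map fun ω => Z ⟨n, ω⟩) t) atTop
      (𝓝 (Complex.exp (-(inner ℝ (S t) t : ℝ) / 2))) := fun t => by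
    simp only [hZlaw]
    refine tendsto_charFun_dirichlet (a := fun n i => g i (θ' n))
      (Q := fun t => inner ℝ (S t) t) (by fun_prop) hz' (fun t => ?_) (fun ε hε => ?_) t
    · have h1 : Tendsto (fun n : ℕ => inner ℝ ((∑ i : Fin n, (n : ℝ)⁻¹ • outer (g i (θ' n))) t) t)
          atTop (𝓝 (inner ℝ (S t) t)) :=
        (((ContinuousLinearMap.apply ℝ E t).continuous.tendsto S).comp hout).inner
          tendsto_const_nhds
      refine h1.congr fun n => ?_
      simp only [sum_apply, smul_apply, sum_inner,
        real_inner_smul_left, inner_outer_apply, Finset.mul_sum]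
    · filter_upwards [hc.eventually_forall_le hε, hθ' (Metric.ball_mem_nhds _ hg.pos)]
        with n h1 h2 i
      exact (hg.norm_sq_le i _ h2).trans (h1 i)
  have hprob : ∀ n, IsProbabilityMeasure ((P n).map fun ω => Z ⟨n, ω⟩) := fun n =>
    Measure.isProbabilityMeasure_map (hZm n)
  have htight := isTightMeasureSet_of_tendsto_charFun
    (f := fun t => Complex.exp (-(inner ℝ (S t) t : ℝ) / 2)) (by fun_prop) hZ
  have hlo := hg.isLittleO_zero hJ' (isAveraging_of_hasLaw hw) (eventually_nonneg_of_hasLaw hw) hθ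
    (hθ'.comp (tendsto_fst_inProb P)) hz
  have hlo' := (Asymptotics.isBigO_refl (fun q : Σ n, W n => √(q.1 : ℝ)) (inProb P)).smul_isLittleO
    hlo
  have hdiff := tendsto_zero_of_isLittleO_of_isTight hlo' hZm htight
  have hJZm : ∀ n, AEMeasurable (fun ω => -J' (Z ⟨n, ω⟩)) (P n) := fun n =>
    (J'.continuous.measurable.comp_aemeasurable (hZm n)).neg
  have hTm : ∀ n : ℕ, AEMeasurable (fun ω => √(n : ℝ) • (θ n ω - θ' n)) (P n) := fun n =>
    ((hm n).sub_const _).const_smul _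
  refine tendsto_charFun_of_tendsto_sub (X := fun q => -J' (Z q))
    (Z := fun q => √(q.1 : ℝ) • (θ q.1 q.2 - θ' q.1)) hJZm hTm ?_ t ?_
  · have := hdiff.neg
    rw [neg_zero] at this
    refine this.congr fun q => ?_
    simp only [Z, Function.comp_apply, smul_add, map_smul]
    abel
  -- By symmetry of `J'`, the characteristic function of `-J' Z` at `t` is that of `Z` at `-J' t`.
  · have h5 := hZ (-J' t)
    simp only [map_neg, inner_neg_left, inner_neg_right, neg_neg] at h5
    refine h5.congr fun n => ?_
    rw [charFun_map_eq_integral (hJZm n), charFun_map_eq_integral (hZm n)]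
    simp only [inner_neg_left, inner_neg_right, hsymm]

end Limit

/-! ### Uniform volume bound for the rescaled draw -/

section UniformBound

variable {E : Type*} [NormedAddCommGroup E] [InnerProductSpace ℝ E] {g : ℕ → E → E} {θ₀ : E}
  {r : ℝ} {G : ℕ → ℝ} {J S M : E →L[ℝ] E}

lemma RegularGradients.norm_sub_le (hg : RegularGradients g θ₀ r G J S M) {ρ : ℝ} (hρ : ρ < r)
    (i : ℕ) {θ θ' : E} (hθ : θ ∈ Metric.closedBall θ₀ ρ) (hθ' : θ' ∈ Metric.closedBall θ₀ ρ) :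
    ‖g i θ - g i θ'‖ ≤ G i * ‖θ - θ'‖ :=
  (convex_ball θ₀ r).norm_image_sub_le_of_norm_fderiv_le (hg.differentiableAt i)
    (hg.norm_fderiv_le i) (Metric.closedBall_subset_ball hρ hθ')
    (Metric.closedBall_subset_ball hρ hθ)

lemma RegularGradients.nonneg (hg : RegularGradients g θ₀ r G J S M) (i : ℕ) : 0 ≤ G i :=
  (norm_nonneg _).trans (hg.norm_fderiv_le i θ₀ (Metric.mem_ball_self hg.pos))

variable [FiniteDimensional ℝ E]

/-- Both conditions are weak laws with slack: the weighted mean of `G` tends to `c < C`, and the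
weighted normalised outer products come within κ of `M` in operator norm, leaving κ of the
coercivity 2κ. -/
lemma RegularGradients.eventually_nondegenerate (hg : RegularGradients g θ₀ r G J S M) {C κ : ℝ}
    {c : ℝ} (hc : HasMean G c) (hcC : c < C) (hκ : 0 < κ)
    (hM : ∀ v, 2 * κ * ‖v‖ ^ 2 ≤ inner ℝ (M v) v) :
    ∀ᶠ q : Σ n, Fin n → ℝ in inProb expSample,
      q.2 ∈ nondegenerateWeights (fun i : Fin q.1 => g i θ₀) (fun i => G i) C κ := by
  have h1 := isAveraging_expSample _ _ hc
  have h2 : Tendsto (fun q : Σ n, Fin n → ℝ => ∑ i : Fin q.1, ((q.1 : ℝ)⁻¹ * q.2 i) •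
      ((1 + ‖g i θ₀‖)⁻¹ • outer (g i θ₀)) - M) (inProb expSample) (𝓝 0) := by
    simpa using (isAveraging_expSample.tendsto hg.mean_normalized).sub_const M
  have h3 : ∀ᶠ q : Σ n, Fin n → ℝ in inProb expSample, ∀ i, 0 < q.2 i :=
    eventually_inProb_of_ae (p := fun q : Σ n, Fin n → ℝ => ∀ i, 0 < q.2 i)
      (Eventually.of_forall ae_expSample_pos)
  filter_upwards [h1.eventually_lt_const hcC, h2 (Metric.ball_mem_nhds _ hκ), h3,
    (tendsto_fst_inProb expSample).eventually (eventually_gt_atTop 0)] with q h4 h5 h6 h7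
  have hn : (0 : ℝ) < q.1 := by exact_mod_cast h7
  refine ⟨fun i => (h6 i).le, ?_, fun v => ?_⟩
  · simp only [mul_assoc, ← Finset.mul_sum] at h4
    rw [inv_mul_lt_iff₀ hn] at h4
    linarith
  · rw [Set.mem_preimage, mem_ball_zero_iff] at h5
    set A := ∑ i : Fin q.1, ((q.1 : ℝ)⁻¹ * q.2 i) • ((1 + ‖g i θ₀‖)⁻¹ • outer (g i θ₀)) with hA
    have h8 : inner ℝ (A v) v = (q.1 : ℝ)⁻¹ *
        ∑ i : Fin q.1, q.2 i * (inner ℝ v (g i θ₀) ^ 2 / (1 + ‖g i θ₀‖)) := by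
      simp only [hA, sum_apply, smul_apply, sum_inner, real_inner_smul_left, inner_outer_apply,
        Finset.mul_sum]
      refine Finset.sum_congr rfl fun i _ => ?_
      rw [real_inner_comm]
      ring
    have h9 : |inner ℝ ((A - M) v) v| ≤ κ * ‖v‖ ^ 2 := by
      refine (abs_real_inner_le_norm _ _).trans ?_
      calc ‖(A - M) v‖ * ‖v‖ ≤ ‖A - M‖ * ‖v‖ * ‖v‖ := by gcongr; exact (A - M).le_opNorm v
        _ ≤ κ * ‖v‖ * ‖v‖ := by gcongr
        _ = κ * ‖v‖ ^ 2 := by ring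
    have h10 : inner ℝ (A v) v = inner ℝ (M v) v + inner ℝ ((A - M) v) v := by
      rw [← inner_add_left, sub_apply, add_sub_cancel]
    have h11 : κ * ‖v‖ ^ 2 ≤ inner ℝ (A v) v := by
      linarith [hM v, (abs_le.1 h9).1]
    rw [h8, le_inv_mul_iff₀ hn] at h11
    linarith

variable [MeasurableSpace E] [BorelSpace E]

/-- The anti-concentration inequality at the scale `1 / √n`. -/
lemma expSample_zeroWeights_scaled_le {n : ℕ} (hn : 0 < n) {f : Fin n → E → E} {D : Fin n → ℝ}
    {ρ κ C : ℝ} (hρ : 0 ≤ ρ) (hκ : 0 < κ) (hC : 0 ≤ C) (hκρ : 8 * C * ρ ≤ κ)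
    (hf : ∀ i, ∀ θ ∈ Metric.closedBall θ₀ ρ, ∀ θ' ∈ Metric.closedBall θ₀ ρ,
      ‖f i θ - f i θ'‖ ≤ D i * ‖θ - θ'‖) (hD : ∀ i, 0 ≤ D i) {A : Set E} (hA : IsCompact A)
    (θ' : E) :
    expSample n (zeroWeights f (Metric.closedBall θ₀ ρ ∩ (fun a => θ' + (√(n : ℝ))⁻¹ • a) '' A) ∩
      nondegenerateWeights (fun i => f i θ₀) D C κ) ≤
    (ENNReal.ofReal (Real.exp 1) * ENNReal.ofReal (4 * C / κ) ^ (Module.finrank ℝ E : ℝ) /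
      (ENNReal.ofReal (1 / 8) ^ (Module.finrank ℝ E : ℝ) *
        Measure.hausdorffMeasure (Module.finrank ℝ E) (Metric.ball (0 : E) 1)) *
      Measure.hausdorffMeasure (Module.finrank ℝ E) A) ^ (1 / 2 : ℝ) := by
  set N := Module.finrank ℝ E with hN
  set lam : Measure E := Measure.hausdorffMeasure N with hlam
  set B := Metric.closedBall θ₀ ρ ∩ (fun a => θ' + (√(n : ℝ))⁻¹ • a) '' A with hBdef
  have hn' : (0 : ℝ) < √(n : ℝ) := by positivity
  have hB : IsCompact B := (hA.image (by fun_prop)).inter_left Metric.isClosed_closedBall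
  have h1 := expSample_zeroWeights_le hn hρ hκ hC hκρ hB Set.inter_subset_left hf hD
  set p := expSample n (zeroWeights f B ∩ nondegenerateWeights (fun i => f i θ₀) D C κ) with hp
  -- The factor `s ^ N` appears in the volumes of both the ball of tilts and the target set, and
  -- cancels.
  set s := ENNReal.ofReal (√(n : ℝ))⁻¹ with hs
  have hs0 : s ^ (N : ℝ) ≠ 0 := by
    rw [ENNReal.rpow_natCast]
    exact pow_ne_zero _ (ENNReal.ofReal_pos.2 (inv_pos.2 hn')).ne'
  have hs_top : s ^ (N : ℝ) ≠ ⊤ := by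
    rw [ENNReal.rpow_natCast]
    exact ENNReal.pow_ne_top ENNReal.ofReal_ne_top
  have h2 : lam B ≤ s ^ (N : ℝ) * lam A := by
    refine (measure_mono Set.inter_subset_right).trans ?_
    have hlip : LipschitzWith (√(n : ℝ))⁻¹.toNNReal fun a : E => θ' + (√(n : ℝ))⁻¹ • a := by
      refine LipschitzWith.of_dist_le_mul fun a b => ?_
      rw [dist_add_left, dist_smul₀, Real.norm_of_nonneg (by positivity),
        Real.coe_toNNReal _ (by positivity)]
    exact hlip.hausdorffMeasure_image_le (by positivity) A
  have h3 : lam (Metric.ball (0 : E) (1 / (8 * √(n : ℝ)))) =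
      s ^ (N : ℝ) * (ENNReal.ofReal (1 / 8) ^ (N : ℝ) * lam (Metric.ball (0 : E) 1)) := by
    have hhaar : lam.IsAddHaarMeasure := isAddHaarMeasure_hausdorffMeasure
    rw [Measure.addHaar_ball_of_pos lam _ (by positivity), ← mul_assoc, hs, ENNReal.rpow_natCast,
      ENNReal.rpow_natCast, ← mul_pow, ← ENNReal.ofReal_mul (by positivity),
      ← ENNReal.ofReal_pow (by positivity)]
    congr 3
    field_simp
  have hb0 : lam (Metric.ball (0 : E) 1) ≠ 0 := by
    have hhaar : lam.IsAddHaarMeasure := isAddHaarMeasure_hausdorffMeasure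
    exact (Metric.measure_ball_pos lam _ one_pos).ne'
  have hbtop : lam (Metric.ball (0 : E) 1) ≠ ⊤ := by
    have hhaar : lam.IsAddHaarMeasure := isAddHaarMeasure_hausdorffMeasure
    exact measure_ball_lt_top.ne
  set β := ENNReal.ofReal (1 / 8) ^ (N : ℝ) * lam (Metric.ball (0 : E) 1) with hβ
  have h8 : ENNReal.ofReal (1 / 8) ≠ 0 := (ENNReal.ofReal_pos.2 (by norm_num)).ne'
  have hβ0 : β ≠ 0 := by
    rw [hβ, ENNReal.rpow_natCast]
    exact mul_ne_zero (pow_ne_zero _ h8) hb0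
  have hβtop : β ≠ ⊤ := by
    rw [hβ, ENNReal.rpow_natCast]
    exact ENNReal.mul_ne_top (ENNReal.pow_ne_top ENNReal.ofReal_ne_top) hbtop
  rw [h3] at h1
  have h4 : s ^ (N : ℝ) * (β * p ^ 2) ≤ s ^ (N : ℝ) *
      (ENNReal.ofReal (Real.exp 1) * ENNReal.ofReal (4 * C / κ) ^ (N : ℝ) * lam A) := by
    rw [← mul_assoc]
    refine h1.trans ?_
    calc _ ≤ ENNReal.ofReal (Real.exp 1) * (ENNReal.ofReal (4 * C / κ) ^ (N : ℝ) *
          (s ^ (N : ℝ) * lam A)) := by gcongr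
      _ = _ := by ring
  rw [ENNReal.mul_le_mul_iff_right hs0 hs_top] at h4
  have h5 : p ^ 2 ≤ ENNReal.ofReal (Real.exp 1) * ENNReal.ofReal (4 * C / κ) ^ (N : ℝ) / β *
      lam A := by
    rw [div_eq_mul_inv, mul_right_comm, ← div_eq_mul_inv,
      ENNReal.le_div_iff_mul_le (Or.inl hβ0) (Or.inl hβtop), mul_comm]
    exact h4
  calc p = (p ^ 2) ^ (1 / 2 : ℝ) := by
        rw [← ENNReal.rpow_two, ← ENNReal.rpow_mul]
        norm_num
    _ ≤ _ := by gcongr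

variable {W : ℕ → Type*} [∀ n, MeasurableSpace (W n)] {P : (n : ℕ) → Measure (W n)}
  {w : (n : ℕ) → W n → Fin n → ℝ}

/-- If the normalized outer products have a coercive mean, then the law of the rescaled bootstrap
draw is, up to an error tending to zero, bounded on compact sets in terms of their volume. -/
theorem RegularGradients.exists_uniform_bound (hg : RegularGradients g θ₀ r G J S M) {κ : ℝ}
    (hκ : 0 < κ) (hM : ∀ v, 2 * κ * ‖v‖ ^ 2 ≤ inner ℝ (M v) v)
    (hw : ∀ n, HasLaw (w n) (dirichletMeasure fun _ : Fin n => (1 : ℝ)) (P n))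
    {θ : (n : ℕ) → W n → E} (θ' : ℕ → E)
    (hθ : Tendsto (fun q : Σ n, W n => θ q.1 q.2) (inProb P) (𝓝 θ₀))
    (hz : ∀ᶠ q : Σ n, W n in inProb P, ∑ i, w q.1 q.2 i • g i (θ q.1 q.2) = 0) :
    ∃ (K : ENNReal) (ε : ℕ → ENNReal), K ≠ ⊤ ∧ Tendsto ε atTop (𝓝 0) ∧
      ∀ᶠ n : ℕ in atTop, ∀ A : Set E, IsCompact A →
        P n {ω | √(n : ℝ) • (θ n ω - θ' n) ∈ A} ≤
          (K * Measure.hausdorffMeasure (Module.finrank ℝ E) A) ^ (1 / 2 : ℝ) + ε n := by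
  obtain ⟨c, hc⟩ := hg.mean_dominating
  have hc0 : 0 ≤ c := ge_of_tendsto' hc.tendsto fun n =>
    smul_nonneg (by positivity) (Finset.sum_nonneg fun i _ => hg.nonneg i)
  set C := c + 1 with hC
  have hC0 : 0 < C := by linarith
  -- The first bound keeps the closed ball inside the domain of regularity, the second is the
  -- smallness `8 * C * ρ ≤ κ`.
  set ρ := min (r / 2) (κ / (8 * C)) with hρ
  have hρ0 : 0 < ρ := lt_min (half_pos hg.pos) (by positivity)
  have hρr : ρ < r := (min_le_left _ _).trans_lt (half_lt_self hg.pos)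
  have hκρ : 8 * C * ρ ≤ κ := by
    have := min_le_right (r / 2) (κ / (8 * C))
    rw [le_div_iff₀ (by positivity)] at this
    linarith
  set Good : (n : ℕ) → Set (Fin n → ℝ) := fun n =>
    nondegenerateWeights (fun i : Fin n => g i θ₀) (fun i => G i) C κ with hGood
  have hgood : Tendsto (fun n => expSample n (Good n)ᶜ) atTop (𝓝 0) :=
    hg.eventually_nondegenerate hc (lt_add_one c) hκ hM
  have hnice : ∀ᶠ q : Σ n, W n in inProb P, θ q.1 q.2 ∈ Metric.closedBall θ₀ ρ ∧
      ∑ i, w q.1 q.2 i • g i (θ q.1 q.2) = 0 :=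
    (hθ.eventually (Metric.closedBall_mem_nhds _ hρ0)).and hz
  rw [eventually_inProb_iff] at hnice
  refine ⟨ENNReal.ofReal (Real.exp 1) * ENNReal.ofReal (4 * C / κ) ^ (Module.finrank ℝ E : ℝ) /
      (ENNReal.ofReal (1 / 8) ^ (Module.finrank ℝ E : ℝ) *
        Measure.hausdorffMeasure (Module.finrank ℝ E) (Metric.ball (0 : E) 1)),
    fun n => P n {ω | ¬(θ n ω ∈ Metric.closedBall θ₀ ρ ∧ ∑ i, w n ω i • g i (θ n ω) = 0)} +
      expSample n (Good n)ᶜ, ?_, by simpa only [add_zero] using hnice.add hgood, ?_⟩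
  · have hhaar : (Measure.hausdorffMeasure (Module.finrank ℝ E) : Measure E).IsAddHaarMeasure :=
      isAddHaarMeasure_hausdorffMeasure
    simp only [ENNReal.rpow_natCast]
    refine (ENNReal.div_lt_top (ENNReal.mul_ne_top ENNReal.ofReal_ne_top
      (ENNReal.pow_ne_top ENNReal.ofReal_ne_top)) (mul_ne_zero (pow_ne_zero _ ?_)
        (Metric.measure_ball_pos _ _ one_pos).ne')).ne
    exact (ENNReal.ofReal_pos.2 (by norm_num)).ne'
  · filter_upwards [eventually_gt_atTop 0] with n hn A hA
    have hn' : (0 : ℝ) < √(n : ℝ) := by positivity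
    set B := Metric.closedBall θ₀ ρ ∩ (fun a => θ' n + (√(n : ℝ))⁻¹ • a) '' A with hB
    have hLip : ∀ i : Fin n, ∀ η ∈ Metric.closedBall θ₀ ρ, ∀ η' ∈ Metric.closedBall θ₀ ρ,
        ‖g i η - g i η'‖ ≤ G i * ‖η - η'‖ := fun i η hη η' hη' => hg.norm_sub_le hρr i hη hη'
    have hBc : IsCompact B := (hA.image (by fun_prop)).inter_left Metric.isClosed_closedBall
    have hZ : IsClosed (zeroWeights (fun i : Fin n => g i) B) :=
      isClosed_zeroWeights hBc fun i η hη =>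
        (hg.differentiableAt i η (Metric.closedBall_subset_ball hρr hη.1)).continuousAt
          |>.continuousWithinAt
    have h1 := expSample_zeroWeights_scaled_le hn hρ0.le hκ hC0.le hκρ hLip
      (fun i => hg.nonneg i) hA (θ' n)
    -- Zeros of the weighted gradient are unaffected by normalising the weights, so the Dirichlet
    -- event is an exponential one.
    have h2 : P n {ω | w n ω ∈ zeroWeights (fun i : Fin n => g i) B} ≤
        expSample n (zeroWeights (fun i : Fin n => g i) B ∩ Good n) + expSample n (Good n)ᶜ := by
      have h3 : P n {ω | w n ω ∈ zeroWeights (fun i : Fin n => g i) B} =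
          expSample n ((fun y i => y i / ∑ j, y j) ⁻¹' zeroWeights (fun i : Fin n => g i) B) := by
        rw [← Measure.map_apply (measurable_normalize n) hZ.measurableSet, ← dirichletMeasure_one,
          ← (hw n).map_eq, Measure.map_apply_of_aemeasurable (hw n).aemeasurable hZ.measurableSet]
        rfl
      rw [h3]
      refine le_trans (measure_mono_ae ?_) (measure_union_le _ _)
      filter_upwards [ae_expSample_pos n] with y hy hyZ
      by_cases hyG : y ∈ Good n
      · left
        refine ⟨?_, hyG⟩
        obtain ⟨η, hη, hzero⟩ := hyZ
        refine ⟨η, hη, ?_⟩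
        have hpos : 0 < ∑ j, y j :=
          Finset.sum_pos (fun j _ => hy j) ⟨⟨0, hn⟩, Finset.mem_univ _⟩
        have h4 : ∑ i, (y i / ∑ j, y j) • g i η = (∑ j, y j)⁻¹ • ∑ i, y i • g i η := by
          rw [Finset.smul_sum]
          exact Finset.sum_congr rfl fun i _ => by rw [smul_smul, div_eq_inv_mul]
        simp only at hzero
        rw [h4] at hzero
        exact (smul_eq_zero.1 hzero).resolve_left (inv_ne_zero hpos.ne')
      · exact Or.inr hyG
    have h5 : P n {ω | √(n : ℝ) • (θ n ω - θ' n) ∈ A} ≤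
        P n {ω | w n ω ∈ zeroWeights (fun i : Fin n => g i) B} +
          P n {ω | ¬(θ n ω ∈ Metric.closedBall θ₀ ρ ∧ ∑ i, w n ω i • g i (θ n ω) = 0)} := by
      refine (measure_mono fun ω hω => ?_).trans (measure_union_le _ _)
      by_cases hN : θ n ω ∈ Metric.closedBall θ₀ ρ ∧ ∑ i, w n ω i • g i (θ n ω) = 0
      · refine Or.inl ⟨θ n ω, ⟨hN.1, _, hω, ?_⟩, hN.2⟩
        simp only
        rw [smul_smul, inv_mul_cancel₀ hn'.ne', one_smul, add_sub_cancel]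
      · exact Or.inr hN
    calc _ ≤ _ := h5
      _ ≤ expSample n (zeroWeights (fun i : Fin n => g i) B ∩ Good n) + expSample n (Good n)ᶜ +
          P n {ω | ¬(θ n ω ∈ Metric.closedBall θ₀ ρ ∧ ∑ i, w n ω i • g i (θ n ω) = 0)} :=
          add_le_add h2 le_rfl
      _ ≤ _ := by
          rw [add_assoc, add_comm (expSample n (Good n)ᶜ)]
          exact add_le_add h1 le_rfl

end UniformBound

/-! ### Matrices as operators -/

section Matrices

variable {d : ℕ}

lemma eq_toEuclideanCLM {L : EuclideanSpace ℝ (Fin d) →L[ℝ] EuclideanSpace ℝ (Fin d)}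
    {A : Matrix (Fin d) (Fin d) ℝ}
    (h : ∀ j k, inner ℝ (L (EuclideanSpace.single k 1)) (EuclideanSpace.single j 1) = A j k) :
    L = Matrix.toEuclideanCLM (𝕜 := ℝ) A := by
  refine ContinuousLinearMap.coe_injective
    ((EuclideanSpace.basisFun (Fin d) ℝ).toBasis.ext fun k => ?_)
  ext j
  have := h j k
  rw [EuclideanSpace.inner_single_right] at this
  simp at this
  simp [Matrix.ofLp_toEuclideanCLM, this]

lemma inner_toEuclideanCLM_symm {A : Matrix (Fin d) (Fin d) ℝ} (hA : A.IsHermitian)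
    (v u : EuclideanSpace ℝ (Fin d)) :
    inner ℝ (Matrix.toEuclideanCLM (𝕜 := ℝ) A v) u =
      inner ℝ v (Matrix.toEuclideanCLM (𝕜 := ℝ) A u) := by
  rw [real_inner_comm, Matrix.inner_toEuclideanCLM, Matrix.inner_toEuclideanCLM,
    Matrix.dotProduct_mulVec, dotProduct_comm, ← Matrix.mulVec_transpose]
  rw [← Matrix.conjTranspose_eq_transpose_of_trivial, hA.eq]

lemma exists_forall_mul_norm_sq_le_inner {E : Type*} [NormedAddCommGroup E]
    [InnerProductSpace ℝ E] [FiniteDimensional ℝ E] {L : E →L[ℝ] E}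
    (h : ∀ v ≠ 0, 0 < inner ℝ (L v) v) :
    ∃ κ > 0, ∀ v, κ * ‖v‖ ^ 2 ≤ inner ℝ (L v) v := by
  rcases subsingleton_or_nontrivial E with hE | hE
  · refine ⟨1, one_pos, fun v => ?_⟩
    rw [Subsingleton.elim v 0]
    simp
  · obtain ⟨u, hu, hmin⟩ := (isCompact_sphere (0 : E) 1).exists_isMinOn
      (NormedSpace.sphere_nonempty.2 zero_le_one)
      (f := fun v => inner ℝ (L v) v) (by fun_prop)
    have hu0 : u ≠ 0 := ne_zero_of_mem_unit_sphere ⟨u, hu⟩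
    refine ⟨_, h u hu0, fun v => ?_⟩
    rcases eq_or_ne v 0 with rfl | hv
    · simp
    have hv' : ‖v‖ ≠ 0 := norm_ne_zero_iff.2 hv
    have h1 : inner ℝ (L u) u ≤ inner ℝ (L (‖v‖⁻¹ • v)) (‖v‖⁻¹ • v) :=
      hmin (by simp [norm_smul, hv'])
    rw [map_smul, real_inner_smul_left, real_inner_smul_right, ← mul_assoc] at h1
    calc _ ≤ ‖v‖⁻¹ * ‖v‖⁻¹ * inner ℝ (L v) v * ‖v‖ ^ 2 := by gcongr
      _ = _ := by field_simp

end Matrices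

/-! ### Verification of the regularity conditions along almost every sequence -/

section Integrals

variable {d : ℕ} {Ω : Type*} [MeasurableSpace Ω] {F₀ : Measure Ω}
  {Θ : Set (EuclideanSpace ℝ (Fin d))} {ℓ : EuclideanSpace ℝ (Fin d) → Ω → ℝ}
  {θ₀ : EuclideanSpace ℝ (Fin d)} {r : ℝ} {G : Ω → ℝ}

/-- The loss is twice continuously differentiable on a ball in the parameter set, with dominated
gradient and Hessian. -/
structure SmoothOn (Θ : Set (EuclideanSpace ℝ (Fin d))) (ℓ : EuclideanSpace ℝ (Fin d) → Ω → ℝ)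
    (F₀ : Measure Ω) (θ₀ : EuclideanSpace ℝ (Fin d)) (r : ℝ) (G : Ω → ℝ) : Prop where
  pos : 0 < r
  ball_subset : Metric.ball θ₀ r ⊆ Θ
  measurable : ∀ θ ∈ Θ, Measurable (ℓ θ)
  integrable : Integrable G F₀
  ae_contDiffOn : ∀ᵐ x ∂F₀, ContDiffOn ℝ 2 (fun θ => ℓ θ x) (Metric.ball θ₀ r)
  ae_norm_sq_le : ∀ᵐ x ∂F₀, ∀ θ ∈ Metric.ball θ₀ r, ‖gradient (fun η => ℓ η x) θ‖ ^ 2 ≤ G x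
  ae_norm_le : ∀ᵐ x ∂F₀, ∀ θ ∈ Metric.ball θ₀ r, ‖iteratedFDeriv ℝ 2 (fun η => ℓ η x) θ‖ ≤ G x

lemma RegularLoss.exists_smoothOn (hreg : RegularLoss Θ ℓ F₀ θ₀) :
    ∃ r G, SmoothOn Θ ℓ F₀ θ₀ r G := by
  obtain ⟨r, hr, hrΘ, G, hG, h⟩ := hreg.smooth
  exact ⟨r, G, hr, hrΘ, hreg.measurable, hG, h.mono fun x hx => hx.1,
    h.mono fun x hx θ hθ => (hx.2 θ hθ).1, h.mono fun x hx θ hθ => (hx.2 θ hθ).2⟩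

lemma ae_hasSmallModulus [IsProbabilityMeasure F₀] {V : Type*} [NormedAddCommGroup V]
    {F : EuclideanSpace ℝ (Fin d) → Ω → V} (hr : 0 < r) (hG : Integrable G F₀)
    (hF : ∀ θ ∈ Metric.ball θ₀ r, AEStronglyMeasurable (F θ) F₀)
    (hc : ∀ᵐ x ∂F₀, ContinuousOn (fun θ => F θ x) (Metric.ball θ₀ r) ∧
      ∀ θ ∈ Metric.ball θ₀ r, ‖F θ x‖ ≤ G x) :
    ∀ᵐ x ∂(Measure.infinitePi fun _ : ℕ => F₀), HasSmallModulus (fun i θ => F θ (x i)) θ₀ := by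
  have h : ∀ k : ℕ, ∀ᵐ x ∂(Measure.infinitePi fun _ : ℕ => F₀), ∃ ρ > 0, ∃ (m : ℕ → ℝ) (c : ℝ),
      HasMean m c ∧ c < 1 / ((k : ℝ) + 1) ∧
        ∀ i, ∀ θ ∈ Metric.ball θ₀ ρ, ‖F θ (x i) - F θ₀ (x i)‖ ≤ m i := fun k => by
    obtain ⟨ρ, hρ, -, m, hm, -, hlt, hle⟩ := exists_integrable_modulus hr hG hF hc
      (η := 1 / ((k : ℝ) + 1)) (by positivity)
    filter_upwards [ae_hasMean hm, ae_infinitePi_forall hle] with x h1 h2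
    exact ⟨ρ, hρ, fun i => m (x i), _, h1, hlt, h2⟩
  filter_upwards [ae_all_iff.2 h] with x hx η hη
  obtain ⟨k, hk⟩ := exists_nat_one_div_lt hη
  obtain ⟨ρ, hρ, m, c, hm, hlt, hle⟩ := hx k
  exact ⟨ρ, hρ, m, c, hm, hlt.trans hk, hle⟩

namespace SmoothOn

lemma aestronglyMeasurable_gradient (hs : SmoothOn Θ ℓ F₀ θ₀ r G)
    {θ : EuclideanSpace ℝ (Fin d)} (hθ : θ ∈ Metric.ball θ₀ r) :
    AEStronglyMeasurable (fun x => gradient (fun η => ℓ η x) θ) F₀ := by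
  simp only [gradient_eq_sum]
  refine (ContinuousLinearMap.continuous _).comp_aestronglyMeasurable
    (aestronglyMeasurable_fderiv ?_ ?_)
  · filter_upwards [Metric.isOpen_ball.mem_nhds hθ] with η hη
    exact (hs.measurable η (hs.ball_subset hη)).aestronglyMeasurable
  · filter_upwards [hs.ae_contDiffOn] with x hx
    exact (hx.contDiffAt (Metric.isOpen_ball.mem_nhds hθ)).differentiableAt two_ne_zero

lemma aestronglyMeasurable_hessian (hs : SmoothOn Θ ℓ F₀ θ₀ r G)
    {θ : EuclideanSpace ℝ (Fin d)} (hθ : θ ∈ Metric.ball θ₀ r) :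
    AEStronglyMeasurable (fun x => fderiv ℝ (gradient fun η => ℓ η x) θ) F₀ := by
  refine aestronglyMeasurable_fderiv (f := fun θ x => gradient (fun η => ℓ η x) θ) ?_ ?_
  · filter_upwards [Metric.isOpen_ball.mem_nhds hθ] with η hη
    exact hs.aestronglyMeasurable_gradient hη
  · filter_upwards [hs.ae_contDiffOn] with x hx
    exact differentiableAt_gradient Metric.isOpen_ball hx hθ

lemma aestronglyMeasurable_outer (hs : SmoothOn Θ ℓ F₀ θ₀ r G)
    {θ : EuclideanSpace ℝ (Fin d)} (hθ : θ ∈ Metric.ball θ₀ r) :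
    AEStronglyMeasurable (fun x => outer (gradient (fun η => ℓ η x) θ)) F₀ :=
  continuous_outer.comp_aestronglyMeasurable (hs.aestronglyMeasurable_gradient hθ)

lemma ae_norm_hessian_le (hs : SmoothOn Θ ℓ F₀ θ₀ r G) :
    ∀ᵐ x ∂F₀, ∀ θ ∈ Metric.ball θ₀ r, ‖fderiv ℝ (gradient fun η => ℓ η x) θ‖ ≤ G x := by
  filter_upwards [hs.ae_contDiffOn, hs.ae_norm_le] with x hx h θ hθ
  exact (norm_fderiv_gradient_le Metric.isOpen_ball hx hθ).trans (h θ hθ)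

lemma mem (hs : SmoothOn Θ ℓ F₀ θ₀ r G) : θ₀ ∈ Metric.ball θ₀ r := Metric.mem_ball_self hs.pos

lemma integrable_hessian (hs : SmoothOn Θ ℓ F₀ θ₀ r G) :
    Integrable (fun x => fderiv ℝ (gradient fun η => ℓ η x) θ₀) F₀ :=
  hs.integrable.mono' (hs.aestronglyMeasurable_hessian hs.mem)
    (hs.ae_norm_hessian_le.mono fun _ hx => hx θ₀ hs.mem)

lemma integrable_outer (hs : SmoothOn Θ ℓ F₀ θ₀ r G) :
    Integrable (fun x => outer (gradient (fun η => ℓ η x) θ₀)) F₀ :=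
  hs.integrable.mono' (hs.aestronglyMeasurable_outer hs.mem)
    (hs.ae_norm_sq_le.mono fun _ hx => (norm_outer _).trans_le (hx θ₀ hs.mem))

lemma integrable_normalized (hs : SmoothOn Θ ℓ F₀ θ₀ r G) :
    Integrable (fun x => (1 + ‖gradient (fun η => ℓ η x) θ₀‖)⁻¹ •
      outer (gradient (fun η => ℓ η x) θ₀)) F₀ := by
  refine hs.integrable_outer.mono ?_ (ae_of_all _ fun x => ?_)
  · refine Continuous.comp_aestronglyMeasurable
      (g := fun v : EuclideanSpace ℝ (Fin d) => (1 + ‖v‖)⁻¹ • outer v) ?_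
      (hs.aestronglyMeasurable_gradient hs.mem)
    exact ((continuous_const.add continuous_norm).inv₀ fun v =>
      (add_pos_of_pos_of_nonneg one_pos (norm_nonneg v)).ne').smul continuous_outer
  · rw [norm_smul, Real.norm_of_nonneg (by positivity)]
    refine mul_le_of_le_one_left (norm_nonneg _) (inv_le_one_of_one_le₀ ?_)
    linarith [norm_nonneg (gradient (fun η => ℓ η x) θ₀)]

/-- Along almost every sequence of observations, the loss gradients are regular. -/
theorem ae_regularGradients [IsProbabilityMeasure F₀] (hs : SmoothOn Θ ℓ F₀ θ₀ r G) :
    ∀ᵐ x ∂(Measure.infinitePi fun _ : ℕ => F₀),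
      RegularGradients (fun i => gradient fun η => ℓ η (x i)) θ₀ r (fun i => G (x i))
        (∫ x, fderiv ℝ (gradient fun η => ℓ η x) θ₀ ∂F₀)
        (∫ x, outer (gradient (fun η => ℓ η x) θ₀) ∂F₀)
        (∫ x, (1 + ‖gradient (fun η => ℓ η x) θ₀‖)⁻¹ •
          outer (gradient (fun η => ℓ η x) θ₀) ∂F₀) := by
  have h1 := ae_hasSmallModulus hs.pos hs.integrable
    (F := fun θ x => fderiv ℝ (gradient fun η => ℓ η x) θ)
    (fun θ hθ => hs.aestronglyMeasurable_hessian hθ)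
    (by
      filter_upwards [hs.ae_contDiffOn, hs.ae_norm_hessian_le] with x hx hx'
      exact ⟨continuousOn_fderiv_gradient Metric.isOpen_ball hx, hx'⟩)
  have h2 := ae_hasSmallModulus hs.pos hs.integrable
    (F := fun θ x => outer (gradient (fun η => ℓ η x) θ))
    (fun θ hθ => hs.aestronglyMeasurable_outer hθ)
    (by
      filter_upwards [hs.ae_contDiffOn, hs.ae_norm_sq_le] with x hx hx'
      exact ⟨continuous_outer.comp_continuousOn
        (contDiffOn_gradient Metric.isOpen_ball hx).continuousOn,
        fun θ hθ => (norm_outer _).trans_le (hx' θ hθ)⟩)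
  filter_upwards [h1, h2, ae_infinitePi_forall hs.ae_contDiffOn,
    ae_infinitePi_forall hs.ae_norm_sq_le, ae_infinitePi_forall hs.ae_norm_hessian_le,
    ae_hasMean hs.integrable, ae_hasMean hs.integrable_hessian, ae_hasMean hs.integrable_outer,
    ae_hasMean hs.integrable_normalized] with x h1 h2 h3 h4 h5 h6 h7 h8 h9
  exact ⟨hs.pos, fun i θ hθ => differentiableAt_gradient Metric.isOpen_ball (h3 i) hθ, h4, h5,
    ⟨_, h6⟩, h7, h8, h9, h1, h2⟩

lemma inner_integral_outer (hs : SmoothOn Θ ℓ F₀ θ₀ r G) (v u : EuclideanSpace ℝ (Fin d)) :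
    inner ℝ ((∫ x, outer (gradient (fun η => ℓ η x) θ₀) ∂F₀) v) u =
      ∫ x, inner ℝ (gradient (fun η => ℓ η x) θ₀) v *
        inner ℝ (gradient (fun η => ℓ η x) θ₀) u ∂F₀ := by
  rw [ContinuousLinearMap.integral_apply hs.integrable_outer, real_inner_comm,
    ← integral_inner (hs.integrable_outer.apply_continuousLinearMap v)]
  simp only [outer_apply, real_inner_smul_right]
  exact integral_congr_ae (ae_of_all _ fun x => by simp only; rw [real_inner_comm u])

lemma integral_outer_eq (hs : SmoothOn Θ ℓ F₀ θ₀ r G) :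
    ∫ x, outer (gradient (fun η => ℓ η x) θ₀) ∂F₀ =
      Matrix.toEuclideanCLM (𝕜 := ℝ) (gradientOuter ℓ F₀ θ₀) := by
  refine eq_toEuclideanCLM fun j k => ?_
  rw [hs.inner_integral_outer]
  simp only [EuclideanSpace.inner_single_right, gradientOuter, Matrix.of_apply]
  simp [mul_comm]

lemma integral_hessian_eq (hs : SmoothOn Θ ℓ F₀ θ₀ r G)
    (hJ : (expectedHessian ℓ F₀ θ₀).IsHermitian) :
    ∫ x, fderiv ℝ (gradient fun η => ℓ η x) θ₀ ∂F₀ =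
      Matrix.toEuclideanCLM (𝕜 := ℝ) (expectedHessian ℓ F₀ θ₀) := by
  refine eq_toEuclideanCLM fun j k => ?_
  rw [ContinuousLinearMap.integral_apply hs.integrable_hessian, real_inner_comm,
    ← integral_inner (hs.integrable_hessian.apply_continuousLinearMap _), ← hJ.apply j k]
  simp only [star_trivial, expectedHessian, Matrix.of_apply]
  refine integral_congr_ae ?_
  filter_upwards [hs.ae_contDiffOn] with x hx
  rw [real_inner_comm, inner_fderiv_gradient Metric.isOpen_ball hx hs.mem]

lemma posSemidef_gradientOuter (hs : SmoothOn Θ ℓ F₀ θ₀ r G) :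
    (gradientOuter ℓ F₀ θ₀).PosSemidef := by
  refine Matrix.PosSemidef.of_dotProduct_mulVec_nonneg ?_ fun v => ?_
  · ext j k
    simp [gradientOuter, mul_comm]
  · have h := Matrix.inner_toEuclideanCLM (gradientOuter ℓ F₀ θ₀) (WithLp.toLp 2 v)
      (WithLp.toLp 2 v)
    rw [← hs.integral_outer_eq, real_inner_comm, hs.inner_integral_outer] at h
    simp only [star_trivial]
    refine (integral_nonneg fun x => mul_self_nonneg _).trans_eq h

lemma posSemidef_sandwichCov (hs : SmoothOn Θ ℓ F₀ θ₀ r G)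
    (hJ : (expectedHessian ℓ F₀ θ₀).IsHermitian) : (sandwichCov ℓ F₀ θ₀).PosSemidef := by
  have h := hs.posSemidef_gradientOuter.mul_mul_conjTranspose_same (expectedHessian ℓ F₀ θ₀)⁻¹
  rwa [hJ.inv.eq] at h

/-- The positive factor `(1 + ‖∇ℓ‖)⁻¹` does not change null directions: a vanishing form makes `⟨∇ℓ,
v⟩` zero almost everywhere, contradicting `hI`. -/
lemma inner_integral_normalized_pos (hs : SmoothOn Θ ℓ F₀ θ₀ r G)
    (hI : (gradientOuter ℓ F₀ θ₀).PosDef) {v : EuclideanSpace ℝ (Fin d)} (hv : v ≠ 0) :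
    0 < inner ℝ ((∫ x, (1 + ‖gradient (fun η => ℓ η x) θ₀‖)⁻¹ •
      outer (gradient (fun η => ℓ η x) θ₀) ∂F₀) v) v := by
  have hint := hs.integrable_normalized.apply_continuousLinearMap v
  rw [ContinuousLinearMap.integral_apply hs.integrable_normalized, real_inner_comm,
    ← integral_inner hint]
  have heq : ∀ x, inner ℝ v (((1 + ‖gradient (fun η => ℓ η x) θ₀‖)⁻¹ •
      outer (gradient (fun η => ℓ η x) θ₀)) v) =
      (1 + ‖gradient (fun η => ℓ η x) θ₀‖)⁻¹ * inner ℝ (gradient (fun η => ℓ η x) θ₀) v ^ 2 :=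
    fun x => by
      rw [smul_apply, real_inner_smul_right, real_inner_comm, inner_outer_apply]
  have hnn : ∀ x, 0 ≤ inner ℝ v (((1 + ‖gradient (fun η => ℓ η x) θ₀‖)⁻¹ •
      outer (gradient (fun η => ℓ η x) θ₀)) v) := fun x => by
    rw [heq]
    positivity
  refine (integral_nonneg hnn).lt_of_ne' fun h0 => ?_
  rw [integral_eq_zero_iff_of_nonneg hnn (hint.const_inner v)] at h0
  have h1 := Matrix.inner_toEuclideanCLM (gradientOuter ℓ F₀ θ₀) v v
  rw [← hs.integral_outer_eq, real_inner_comm, hs.inner_integral_outer] at h1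
  have h2 : ∫ x, inner ℝ (gradient (fun η => ℓ η x) θ₀) v *
      inner ℝ (gradient (fun η => ℓ η x) θ₀) v ∂F₀ = 0 := by
    refine integral_eq_zero_of_ae ?_
    filter_upwards [h0] with x hx
    rw [heq] at hx
    have hpos : (1 + ‖gradient (fun η => ℓ η x) θ₀‖)⁻¹ ≠ 0 := by positivity
    have := pow_eq_zero_iff two_ne_zero |>.1 ((mul_eq_zero.1 hx).resolve_left hpos)
    simp [this]
  rw [h2] at h1
  have h3 := hI.dotProduct_mulVec_pos (x := v.ofLp) (by simpa using hv)
  rw [star_trivial, ← h1] at h3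
  exact h3.false

end SmoothOn

end Integrals

end LossBootstrap

/-! ### The main theorem -/

theorem theorem1 {d : ℕ} {Ω : Type*} [MeasurableSpace Ω]
    (F₀ : Measure Ω) [IsProbabilityMeasure F₀]
    (Θ : Set (EuclideanSpace ℝ (Fin d))) (ℓ : EuclideanSpace ℝ (Fin d) → Ω → ℝ)
    (θ₀ : EuclideanSpace ℝ (Fin d)) (hreg : LossBootstrap.RegularLoss Θ ℓ F₀ θ₀)
    -- the empirical risk minimiser, a function of the observations `x_{1:n}`
    (θhat : (n : ℕ) → (Fin n → Ω) → EuclideanSpace ℝ (Fin d))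
    (hhat : ∀ᵐ x ∂(Measure.infinitePi fun _ : ℕ => F₀), ∀ᶠ n : ℕ in atTop,
      LossBootstrap.IsEmpiricalRiskMinimizer Θ ℓ (fun i : Fin n => x i)
        (θhat n fun i : Fin n => x i))
    -- Dirichlet(1, …, 1) weights, drawn afresh whatever the observations are
    {W : ℕ → Type*} [∀ n, MeasurableSpace (W n)] (PLL : (n : ℕ) → Measure (W n))
    [∀ n, IsProbabilityMeasure (PLL n)] (w : (n : ℕ) → W n → Fin n → ℝ)
    (hw : ∀ n, HasLaw (w n) (LossBootstrap.dirichletMeasure fun _ : Fin n => (1 : ℝ)) (PLL n))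
    -- the loss-likelihood bootstrap draw, given the observations `x_{1:n}`
    (θtilde : (n : ℕ) → (Fin n → Ω) → W n → EuclideanSpace ℝ (Fin d))
    (hmeas : ∀ n x, AEMeasurable (θtilde n x) (PLL n))
    (htilde : ∀ᵐ x ∂(Measure.infinitePi fun _ : ℕ => F₀), ∀ᶠ n : ℕ in atTop,
      ∀ᵐ ω ∂(PLL n), LossBootstrap.IsWeightedMinimizer Θ ℓ (w n ω) (fun i : Fin n => x i)
        (θtilde n (fun i : Fin n => x i) ω)) :
    ∀ᵐ x ∂(Measure.infinitePi fun _ : ℕ => F₀),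
      TendstoInDistribution
        (fun (n : ℕ) (ω : W n) => √(n : ℝ) •
          (θtilde n (fun i : Fin n => x i) ω - θhat n fun i : Fin n => x i))
        atTop (fun z : EuclideanSpace ℝ (Fin d) => z) PLL
        (multivariateGaussian 0 (LossBootstrap.sandwichCov ℓ F₀ θ₀)) ∧
      ((LossBootstrap.gradientOuter ℓ F₀ θ₀).PosDef →
        ∀ A : Set (EuclideanSpace ℝ (Fin d)), MeasurableSet A →
          Tendsto (fun n : ℕ => PLL n {ω | √(n : ℝ) •
              (θtilde n (fun i : Fin n => x i) ω - θhat n fun i : Fin n => x i) ∈ A})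
            atTop (𝓝 (multivariateGaussian 0 (LossBootstrap.sandwichCov ℓ F₀ θ₀) A))) := by
  open LossBootstrap in
  obtain ⟨r, G, hs⟩ := hreg.exists_smoothOn
  have hJherm := hreg.hessian_posDef.isHermitian
  -- From here on the data sequence is fixed and only the weights are random.
  filter_upwards [hhat, htilde, hreg.ae_exists_separated_cover, hs.ae_regularGradients,
    ae_infinitePi_forall hs.ae_contDiffOn] with x hxhat hxtilde hxsep hg hsmooth
  rw [hs.integral_outer_eq, hs.integral_hessian_eq hJherm] at hg
  set H := expectedHessian ℓ F₀ θ₀ with hH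
  set θh : ℕ → EuclideanSpace ℝ (Fin d) := fun n => θhat n fun i : Fin n => x i with hθh
  set θt : (n : ℕ) → W n → EuclideanSpace ℝ (Fin d) :=
    fun n => θtilde n fun i : Fin n => x i with hθt
  have hm : ∀ n, AEMeasurable (θt n) (PLL n) := fun n => hmeas n _
  have hXm : ∀ n : ℕ, AEMeasurable (fun ω => √(n : ℝ) • (θt n ω - θh n)) (PLL n) := fun n =>
    ((hm n).sub_const (θh n)).const_smul √(n : ℝ)
  have hstat : ∀ {n : ℕ} {v : Fin n → ℝ} {θ : EuclideanSpace ℝ (Fin d)},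
      IsWeightedMinimizer Θ ℓ v (fun i : Fin n => x i) θ → θ ∈ Metric.ball θ₀ r →
      ∑ i : Fin n, v i • gradient (fun η => ℓ η (x i)) θ = 0 := fun h hθ =>
    h.sum_gradient_eq_zero
      (mem_of_superset (Metric.isOpen_ball.mem_nhds hθ) hs.ball_subset) fun i =>
        ((hsmooth i).contDiffAt (Metric.isOpen_ball.mem_nhds hθ)).differentiableAt two_ne_zero
  have hhat0 : Tendsto θh atTop (𝓝 θ₀) :=
    tendsto_of_isWeightedMinimizer hreg.mem hxsep isAveraging_uniform
      (Eventually.of_forall fun n i => by positivity) hxhat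
  have htilde' : ∀ᶠ q : Σ n, W n in inProb PLL,
      IsWeightedMinimizer Θ ℓ (w q.1 q.2) (fun i : Fin q.1 => x i) (θt q.1 q.2) :=
    eventually_inProb_of_ae hxtilde
  have htilde0 : Tendsto (fun q : Σ n, W n => θt q.1 q.2) (inProb PLL) (𝓝 θ₀) :=
    tendsto_of_isWeightedMinimizer hreg.mem hxsep (isAveraging_of_hasLaw hw)
      (eventually_nonneg_of_hasLaw hw) htilde'
  have hz : ∀ᶠ q : Σ n, W n in inProb PLL,
      ∑ i, w q.1 q.2 i • gradient (fun η => ℓ η (x i)) (θt q.1 q.2) = 0 := by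
    filter_upwards [htilde', htilde0 (Metric.ball_mem_nhds _ hs.pos)] with q h1 h2
    exact hstat h1 h2
  have hz' : ∀ᶠ n : ℕ in atTop, ∑ i : Fin n, gradient (fun η => ℓ η (x i)) (θh n) = 0 := by
    filter_upwards [hxhat, hhat0 (Metric.ball_mem_nhds _ hs.pos), eventually_gt_atTop 0]
      with n h1 h2 hn
    have h3 := hstat h1 h2
    rw [← Finset.smul_sum] at h3
    exact (smul_eq_zero.1 h3).resolve_left (inv_ne_zero (Nat.cast_ne_zero.2 hn.ne'))
  have hinv : ∀ v, Matrix.toEuclideanCLM (𝕜 := ℝ) H⁻¹ (Matrix.toEuclideanCLM (𝕜 := ℝ) H v) = v :=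
    fun v => by
      rw [← mul_apply_eq_comp, ← map_mul,
        Matrix.nonsing_inv_mul _ ((Matrix.isUnit_iff_isUnit_det _).1 hreg.hessian_posDef.isUnit),
        map_one, one_apply_eq_self]
  have hsymm := inner_toEuclideanCLM_symm hJherm.inv
  have hchar : ∀ t, Tendsto (fun n : ℕ => charFun ((PLL n).map fun ω =>
      √(n : ℝ) • (θt n ω - θh n)) t) atTop
      (𝓝 (charFun (multivariateGaussian 0 (sandwichCov ℓ F₀ θ₀)) t)) := fun t => by
    have h := hg.tendsto_charFun hinv hsymm hw hm htilde0 hhat0 hz hz' t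
    rw [charFun_multivariateGaussian (hs.posSemidef_sandwichCov hJherm)]
    convert h using 3
    rw [inner_zero_right, ← Matrix.inner_toEuclideanCLM, sandwichCov, map_mul, map_mul,
      mul_apply_eq_comp, mul_apply_eq_comp, ← hsymm, real_inner_comm, Complex.ofReal_zero,
      zero_mul, zero_sub, neg_div]
  let μ : ℕ → ProbabilityMeasure (EuclideanSpace ℝ (Fin d)) := fun n =>
    ⟨(PLL n).map fun ω => √(n : ℝ) • (θt n ω - θh n), Measure.isProbabilityMeasure_map (hXm n)⟩
  let ν : ProbabilityMeasure (EuclideanSpace ℝ (Fin d)) :=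
    ⟨multivariateGaussian 0 (sandwichCov ℓ F₀ θ₀), inferInstance⟩
  have hlim : Tendsto μ atTop (𝓝 ν) := ProbabilityMeasure.tendsto_of_tendsto_charFun hchar
  refine ⟨⟨hXm, aemeasurable_id, ?_⟩, fun hI A hA => ?_⟩
  · convert hlim using 2
    exact congrArg 𝓝 (Subtype.ext Measure.map_id)
  -- Positive definiteness of `gradientOuter` enters only here, as coercivity of the normalised
  -- outer product; halving `κ` matches the slack in `exists_uniform_bound`.
  · obtain ⟨κ, hκ, hM⟩ := exists_forall_mul_norm_sq_le_inner
      fun v hv => hs.inner_integral_normalized_pos hI hv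
    obtain ⟨K, ε, hK, hε, hbd⟩ := hg.exists_uniform_bound (half_pos hκ)
      (fun v => by rw [mul_div_cancel₀ _ two_ne_zero]; exact hM v) hw θh htilde0 hz
    have hhaar : (Measure.hausdorffMeasure (Module.finrank ℝ (EuclideanSpace ℝ (Fin d))) :
        Measure (EuclideanSpace ℝ (Fin d))).IsAddHaarMeasure := isAddHaarMeasure_hausdorffMeasure
    have h := tendsto_measure_of_uniform_bound hlim (lam := Measure.hausdorffMeasure
      (Module.finrank ℝ (EuclideanSpace ℝ (Fin d)))) hε hK
      (hbd.mono fun n hn A hA => ?_) hA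
    · refine h.congr fun n => ?_
      exact Measure.map_apply_of_aemeasurable (hXm n) hA
    · exact (Measure.map_apply_of_aemeasurable (hXm n) hA.measurableSet).trans_le (hn A hA)
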